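/- Let $N,d\ge 1$ be integers, $1/2\le H<1$, $0<\beta<N$ and $N-2H-1<\beta<N-2H+1$, and put $\alpha=\tfrac12(2H+1-N+\beta)\in(0,1)$. Write $\mathscr F\phi(\xi)=\int_{\mathbb R^N}e^{-ix\cdot\xi}\phi(x)\,dx$. Let $f:\mathbb R^N\to\mathbb R$ be a function that is the Fourier transform of a measure $h(\xi)\,d\xi$, i.e. $\int f\phi\,dx=\int\mathscr F\phi(\xi)\,h(\xi)\,d\xi$ for all Schwartz functions $\phi$, where $C_1|\xi|^{-\beta}\le h(\xi)\le C_2|\xi|^{-\beta}$ for some constants $0<C_1\le C_2<\infty$ and almost every $\xi$. Let $\rho_H(r)=|r|^{2H-2}$ if $H>1/2$ and $\rho_H=\delta_0$ if $H=1/2$. Let $W=(W_1,\dots,W_d)$ be independent centred Gaussian processes indexed by $C_c^\infty(\mathbb R_+\times\mathbb R^N)$, each with covariance $$\mathbb E[W_j(\varphi)W_j(\psi)]=\langle\varphi,\psi\rangle_{\mathcal{HP}}=\int_{\mathbb R_+}\!dt\int_{\mathbb R_+}\!ds\int_{\mathbb R^N}\!dx\int_{\mathbb R^N}\!dy\;\varphi(t,x)\,\rho_H(t-s)\,f(x-y)\,\psi(s,y).$$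 Let $\mathcal{HP}$ be the completion of $C_c^\infty(\mathbb R_+\times\mathbb R^N)$ for this inner product; its elements are described by their spatial Fourier transforms, with $\|S\|_{\mathcal{HP}}^2=\int d\xi\,h(\xi)\int_{\mathbb R_+}\!\int_{\mathbb R_+}\rho_H(t-s)\,\mathscr FS(t)(\xi)\,\overline{\mathscr FS(s)(\xi)}\,ds\,dt$. Extend each $W_j$ to an isometry $\mathcal{HP}\to L^2(\mathbb P)$. Let $u=(u_1,\dots,u_d)$ be the solution of the system of stochastic wave equations $\partial_t^2u_j=\Delta u_j+\dot W_j$ with zero initial data, that is, $u_j(t,x)=W_j(g_{t,x})$ for $t\ge0$, $x\in\mathbb R^N$, where $g_{t,x}(s,y)=G(t-s,x-y)\mathbf 1_{[0,t]}(s)$ and $G$ is the fundamental solution of the wave equation, $\mathscr FG(r,\cdot)(\xi)=\sin(r|\xi|)/|\xi|$. Then $u$ has a version whose sample functions are a.s. continuous on $(0,\infty)\times\mathbb R^N$. Moreover, for every compact interval $I=[a,b]\times\prod_{i=1}^N[c_i,e_i]\subset(0,\infty)\times\mathbb R^N$ with more than one point there is a constant $0<C<\infty$ such that every such continuous version, again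 denoted by $u$, satisfies $$\lim_{\varepsilon\to0^+}\ \sup_{\substack{(t,x),(s,y)\in I\\ 0<|t-s|+|x-y|\le\varepsilon}}\frac{|u(t,x)-u(s,y)|}{(|t-s|+|x-y|)^{\alpha}\sqrt{\log\left[1+(|t-s|+|x-y|)^{-1}\right]}}=C\qquad\text{a.s.},$$ where $|\cdot|$ denotes the Euclidean norms. -/

import Mathlib

open MeasureTheory ProbabilityTheory Filter Topology Set
open scoped ENNReal SchwartzMap Distributions

noncomputable section

namespace StochWave

/-- Euclidean space `ℝ^n`. -/
abbrev E (n : ℕ) : Type := EuclideanSpace ℝ (Fin n)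

/-- Smooth compactly supported real functions of `(t, x)`. Only the restriction to
`[0, ∞) × ℝ^N` is ever used: every integral below runs over `t ≥ 0`. -/
abbrev Test (N : ℕ) : Type := 𝓓((⊤ : TopologicalSpace.Opens (ℝ × E N)), ℝ)

/-- The Fourier transform `∫ e^{-i x·ξ} φ(x) dx` (no `2π` in the exponent). -/
def fourier {N : ℕ} (φ : E N → ℂ) (ξ : E N) : ℂ :=
  ∫ x, Complex.exp (-Complex.I * (inner ℝ x ξ : ℝ)) * φ x

/-- `∫_{ℝ_+} ∫_{ℝ_+} ρ_H(t-s) k(t,s) ds dt`, where `ρ_H(r) = |r|^{2H-2}` if `H > 1/2` and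
`ρ_H = δ` if `H = 1/2`. -/
def timeIntegral {F : Type*} [NormedAddCommGroup F] [NormedSpace ℝ F]
    (H : ℝ) (k : ℝ → ℝ → F) : F :=
  if H = 1 / 2 then ∫ t in Ici (0 : ℝ), k t t
  else ∫ t in Ici (0 : ℝ), ∫ s in Ici (0 : ℝ), |t - s| ^ (2 * H - 2) • k t s

/-- `f` is the spatial covariance function: it is the Fourier transform of the measure
`h(ξ) dξ`, whose density `h` is comparable to `|ξ|^{-β}`. -/
structure IsSpatialCovariance {N : ℕ} (β : ℝ) (f h : E N → ℝ) : Prop where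
  measurable_density : Measurable h
  comparable : ∃ C₁ C₂ : ℝ, 0 < C₁ ∧ 0 < C₂ ∧
    ∀ᵐ ξ, C₁ * ‖ξ‖ ^ (-β) ≤ h ξ ∧ h ξ ≤ C₂ * ‖ξ‖ ^ (-β)
  integrable : ∀ φ : 𝓢(E N, ℂ), Integrable fun x => (f x : ℂ) * φ x
  fourier_eq : ∀ φ : 𝓢(E N, ℂ), ∫ x, (f x : ℂ) * φ x = ∫ ξ, fourier φ ξ * (h ξ : ℂ)

/-- The inner product `⟨φ, ψ⟩_{HP}` of test functions,
`∫∫ dt ds ∫∫ dx dy φ(t,x) ρ_H(t-s) f(x-y) ψ(s,y)`. -/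
def hpInner {N : ℕ} (H : ℝ) (f : E N → ℝ) (φ ψ : Test N) : ℝ :=
  timeIntegral H fun t s => ∫ x, ∫ y, φ (t, x) * f (x - y) * ψ (s, y)

/-- The squared `HP` norm of a distribution-valued function `S` of time, in terms of its
spatial Fourier transform `A s ξ = 𝓕(S(s))(ξ)`:
`∫ dξ h(ξ) ∫∫ ρ_H(t-s) A(t,ξ) conj(A(s,ξ)) ds dt`.
The `ξ`-integral is outermost since the integrand need not be absolutely integrable in
`(t, s, ξ)` jointly; for fixed `ξ` the time integral is a nonnegative number. -/
def hpNormSq {N : ℕ} (H : ℝ) (h : E N → ℝ) (A : ℝ → E N → ℂ) : ℝ≥0∞ :=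
  ∫⁻ ξ, ENNReal.ofReal
    ((timeIntegral H fun t s => A t ξ * (starRingEnd ℂ) (A s ξ)).re * h ξ)

/-- `W = (W_1, …, W_d)` is the fractional-colored noise: the `W_j` are independent, and each is
a centred Gaussian process indexed by test functions with covariance `⟨·, ·⟩_{HP}`. -/
structure IsNoise {N d : ℕ} {Ω : Type*} [MeasurableSpace Ω] (P : Measure Ω)
    (H : ℝ) (f : E N → ℝ) (W : Fin d → Test N → Ω → ℝ) : Prop where
  measurable : ∀ j φ, Measurable (W j φ)
  gaussian : ∀ j, IsGaussianProcess (W j) P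
  mean_zero : ∀ j φ, ∫ ω, W j φ ω ∂P = 0
  covariance : ∀ j φ ψ, ∫ ω, W j φ ω * W j ψ ω ∂P = hpInner H f φ ψ
  indep : iIndepFun (fun j ω => fun φ => W j φ ω) P

/-- Spatial Fourier transform of a test function at time `s`. -/
def testFourier {N : ℕ} (φ : Test N) (s : ℝ) (ξ : E N) : ℂ :=
  fourier (fun y => (φ (s, y) : ℂ)) ξ

/-- Spatial Fourier transform of `g_{t,x}(s, y) = G(t-s, x-y) 1_{[0,t]}(s)`, where `G` is the
fundamental solution of the wave equation, i.e. the family of tempered distributions `G(r, ·)`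
with Fourier transform `ξ ↦ sin(r|ξ|) / |ξ|`. -/
def waveFourier {N : ℕ} (t : ℝ) (x : E N) (s : ℝ) (ξ : E N) : ℂ :=
  (Icc 0 t).indicator
    (fun s => Complex.exp (-Complex.I * (inner ℝ x ξ : ℝ)) *
      ((Real.sin ((t - s) * ‖ξ‖) / ‖ξ‖ : ℝ) : ℂ)) s

/-- `X = W(S)`, where `W : HP → L²(P)` is the isometry extending the noise `W` and `S ∈ HP` has
spatial Fourier transform `A`: there are test functions `φ_n → S` in `HP` with `W(φ_n) → X` in
`L²(P)`. -/
def IsWienerIntegral {N : ℕ} {Ω : Type*} [MeasurableSpace Ω] (P : Measure Ω)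
    (H : ℝ) (h : E N → ℝ) (W : Test N → Ω → ℝ) (A : ℝ → E N → ℂ) (X : Ω → ℝ) : Prop :=
  MemLp X 2 P ∧ ∃ φ : ℕ → Test N,
    Tendsto (fun n => hpNormSq H h fun s ξ => testFourier (φ n) s ξ - A s ξ) atTop (𝓝 0) ∧
    Tendsto (fun n => eLpNorm (W (φ n) - X) 2 P) atTop (𝓝 0)

/-- `u` is the random field solution of the wave equation driven by `W` with zero initial data:
`u_j(t, x) = W_j(g_{t,x})` for all `t ≥ 0`, `x ∈ ℝ^N`. -/
def IsSolution {N d : ℕ} {Ω : Type*} [MeasurableSpace Ω] (P : Measure Ω)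
    (H : ℝ) (h : E N → ℝ) (W : Fin d → Test N → Ω → ℝ) (u : ℝ → E N → Ω → E d) : Prop :=
  ∀ j t x, 0 ≤ t →
    IsWienerIntegral P H h (W j) (waveFourier t x) (fun ω => u t x ω j)

/-- `v` is a version of `u` with a.s. continuous sample functions on `(0, ∞) × ℝ^N`. -/
def IsContinuousVersion {N d : ℕ} {Ω : Type*} [MeasurableSpace Ω] (P : Measure Ω)
    (u v : ℝ → E N → Ω → E d) : Prop :=
  (∀ t x, 0 ≤ t → v t x =ᵐ[P] u t x) ∧
    ∀ᵐ ω ∂P, ContinuousOn (fun p : ℝ × E N => v p.1 p.2 ω) (Ioi 0 ×ˢ univ)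

/-- The compact interval `[a, b] × ∏ᵢ [cᵢ, eᵢ]` in `ℝ × ℝ^N`. -/
def interval {N : ℕ} (a b : ℝ) (c e : Fin N → ℝ) : Set (ℝ × E N) :=
  Icc a b ×ˢ {x | ∀ i, x i ∈ Icc (c i) (e i)}

/-- The distance `|t-s| + |x-y|`, with `|x-y|` Euclidean. -/
def rho {N : ℕ} (p q : ℝ × E N) : ℝ := |p.1 - q.1| + ‖p.2 - q.2‖

/-- The supremum (in `[0, ∞]`) of `|w(p) - w(q)| / (ρ^α √log(1 + 1/ρ))` over `p, q ∈ I` with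
`0 < ρ ≤ ε`, `ρ = rho p q`. -/
def modulusSup {N d : ℕ} (α : ℝ) (I : Set (ℝ × E N)) (w : ℝ → E N → E d) (ε : ℝ) : ℝ≥0∞ :=
  ⨆ (p ∈ I) (q ∈ I) (_ : 0 < rho p q ∧ rho p q ≤ ε),
    ENNReal.ofReal (‖w p.1 p.2 - w q.1 q.2‖ /
      (rho p q ^ α * √(Real.log (1 + (rho p q)⁻¹))))

end StochWave

end

open scoped FourierTransform

noncomputable section

namespace StochWave

/-! The components of u are centred Gaussian fields, and the exact modulus rests on three facts. The
limit is a deterministic element of [0, ∞] by a zero-one law. It is finite because an increment over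
distance ρ has variance at most C ρ^{2α}. It is positive because along a coordinate segment every
increment of step δ keeps variance at least c δ^{2α} after the earlier points are projected out.

Variance, from above: for H > 1/2 the kernel |t-s|^{2H-2} is a superposition of products of
one-sided exponentials, so at each frequency the time integral is a sum of squares
(`timeIntegral_eq_feature`). An increment of the wave kernel splits into windowed cosines
(`waveFourier_sub_decomp`), whose energy at frequency r is O(r^{1-2H}) by oscillation. Integrating
the result against |ξ|^{-β} gives ρ^{2α} (`hpNormSq_waveFourier_sub_le`).

Variance, from below: pair the kernels with the source (∂² + |ξ|²)(η(s) cos((s-t₀)|ξ|)), where η is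
a smooth switch-on. Duhamel's formula turns a combination of kernels into Σ wᵢ e^{-i xᵢ·ξ}
cos((tᵢ-t₀)|ξ|). Integrating this against a rescaled profile Φ(δξ), chosen so that every point of
the line at distance at least δ contributes zero, isolates the base point (`IsProfile.hpNormSq_ge`).
Profiles are needed only for coordinate directions, since a nontrivial interval contains a segment
parallel to an axis.

From variance to paths: variances and `HP` norms are compared only up to a factor 2
(`IsSolution.integral_sq_sum`). Dyadic chaining with Borel-Cantelli yields the continuous version
and the upper bound (`ae_exists_chainBound`, `ChainBound.norm_sub_le`). For the lower bound, the 2ⁿ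
increments at scale 2⁻ⁿ are all small with probability tending to zero (`measure_forall_abs_le`).

Zero-one law: projecting out finitely many coordinates changes the path by a function that is
Lipschitz in the canonical metric, hence O(ρ^α), which is negligible against ρ^α √log(1 + 1/ρ). The
limit functional is therefore independent of every finite family of coordinates, hence of itself
(`exists_ae_eq_const_of_shift_invariant`). It can be read off from u on a dense sequence
(`tendsto_modulusSup`), so every continuous version has the same constant. -/

/-! ### The time covariance as an energy -/

/-- The one-sided exponential kernel `1_{v ≤ t} e^{-l (t - v)}`. -/
def expKernel (l v t : ℝ) : ℝ := if v ≤ t then Real.exp (-(l * (t - v))) else 0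

/-- The measure `l^{2-2H} dl dv` on `(0, ∞) × ℝ`. -/
def kerMeasure (H : ℝ) : Measure (ℝ × ℝ) :=
  ((volume.restrict (Ioi (0 : ℝ))).withDensity fun l => ENNReal.ofReal (l ^ (2 - 2 * H))).prod
    volume

instance instSFiniteKerMeasure (H : ℝ) : SFinite (kerMeasure H) := by
  unfold kerMeasure; infer_instance

/-- The constant with `∫ K_z(t) K_z(s) dz = kerConst H * |t - s|^{2H-2}`. -/
def kerConst (H : ℝ) : ℝ := Real.Gamma (2 - 2 * H) / 2

lemma kerConst_pos {H : ℝ} (hH : H < 1) : 0 < kerConst H := by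
  have := Real.Gamma_pos_of_pos (show 0 < 2 - 2 * H by linarith)
  unfold kerConst; positivity

/-- The image of `A` under the square root of the time covariance. -/
def feature (A : ℝ → ℂ) (z : ℝ × ℝ) : ℂ :=
  ∫ t in Ici (0 : ℝ), (expKernel z.1 z.2 t : ℂ) * A t

/-- The quadratic form of the time covariance `ρ_H`, written as a sum of squares. -/
def energy (H : ℝ) (A : ℝ → ℂ) : ℝ≥0∞ :=
  if H = 1 / 2 then ∫⁻ t in Ici (0 : ℝ), ‖A t‖ₑ ^ 2
  else (ENNReal.ofReal (kerConst H))⁻¹ * ∫⁻ z, ‖feature A z‖ₑ ^ 2 ∂kerMeasure H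

/-- Bounded measurable functions of time vanishing for large times. -/
structure Adm (A : ℝ → ℂ) : Prop where
  meas : Measurable A
  bdd : ∃ C, ∀ t, ‖A t‖ ≤ C
  supp : ∃ M, ∀ t, M < t → A t = 0

lemma expKernel_nonneg (l v t : ℝ) : 0 ≤ expKernel l v t := by
  unfold expKernel; split_ifs <;> positivity

lemma expKernel_le_one {l v t : ℝ} (hl : 0 ≤ l) : expKernel l v t ≤ 1 := by
  unfold expKernel
  split_ifs with h
  · exact Real.exp_le_one_iff.2 (neg_nonpos.2 (mul_nonneg hl (by linarith)))
  · exact zero_le_one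

lemma measurable_expKernel : Measurable fun x : ℝ × ℝ × ℝ => expKernel x.1 x.2.1 x.2.2 := by
  unfold expKernel
  refine Measurable.ite (measurableSet_le (by fun_prop) (by fun_prop)) (by fun_prop) (by fun_prop)

lemma Adm.add {A B : ℝ → ℂ} (hA : Adm A) (hB : Adm B) : Adm fun t => A t + B t := by
  obtain ⟨C, hC⟩ := hA.bdd
  obtain ⟨C', hC'⟩ := hB.bdd
  obtain ⟨M, hM⟩ := hA.supp
  obtain ⟨M', hM'⟩ := hB.supp
  refine ⟨hA.meas.add hB.meas, ⟨C + C', fun t => (norm_add_le _ _).trans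
    (add_le_add (hC t) (hC' t))⟩, ⟨max M M', fun t ht => ?_⟩⟩
  rw [hM t (lt_of_le_of_lt (le_max_left _ _) ht), hM' t (lt_of_le_of_lt (le_max_right _ _) ht),
    add_zero]

lemma Adm.const_mul {A : ℝ → ℂ} (hA : Adm A) (c : ℂ) : Adm fun t => c * A t := by
  obtain ⟨C, hC⟩ := hA.bdd
  obtain ⟨M, hM⟩ := hA.supp
  refine ⟨hA.meas.const_mul c, ⟨‖c‖ * C, fun t => ?_⟩, ⟨M, fun t ht => by simp [hM t ht]⟩⟩
  rw [norm_mul]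
  exact mul_le_mul_of_nonneg_left (hC t) (norm_nonneg _)

lemma Adm.sub {A B : ℝ → ℂ} (hA : Adm A) (hB : Adm B) : Adm fun t => A t - B t := by
  simpa [sub_eq_add_neg] using hA.add (hB.const_mul (-1))

lemma Adm.zero : Adm fun _ => 0 :=
  ⟨measurable_const, ⟨0, by simp⟩, ⟨0, by simp⟩⟩

lemma Adm.sum {ι : Type*} (s : Finset ι) {A : ι → ℝ → ℂ} (hA : ∀ i ∈ s, Adm (A i)) :
    Adm fun t => ∑ i ∈ s, A i t := by
  classical
  induction s using Finset.induction_on with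
  | empty => simpa using Adm.zero
  | insert i s hi ih =>
    simp only [Finset.sum_insert hi]
    exact (hA i (Finset.mem_insert_self _ _)).add
      (ih fun j hj => hA j (Finset.mem_insert_of_mem hj))

lemma Adm.integrable {A : ℝ → ℂ} (hA : Adm A) : Integrable A (volume.restrict (Ici 0)) := by
  obtain ⟨C, hC⟩ := hA.bdd
  obtain ⟨M, hM⟩ := hA.supp
  have h1 : IntegrableOn A (Icc 0 M) :=
    Measure.integrableOn_of_bounded (M := C) (by simp) hA.meas.aestronglyMeasurable
      (by simpa using Filter.Eventually.of_forall hC)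
  refine h1.of_forall_sdiff_eq_zero measurableSet_Ici fun t ht => hM t ?_
  by_contra h
  exact ht.2 ⟨ht.1, not_lt.1 h⟩

lemma integrable_kernel_mul {A : ℝ → ℂ} (hA : Integrable A (volume.restrict (Ici 0)))
    {l : ℝ} (hl : 0 ≤ l) (v : ℝ) :
    Integrable (fun t => (expKernel l v t : ℂ) * A t) (volume.restrict (Ici 0)) := by
  refine hA.bdd_mul (c := 1) ?_ ?_
  · have : Measurable fun t => expKernel l v t :=
      measurable_expKernel.comp (measurable_const.prodMk (measurable_const.prodMk measurable_id))
    exact (Complex.measurable_ofReal.comp this).aestronglyMeasurable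
  · refine Filter.Eventually.of_forall fun t => ?_
    rw [Complex.norm_real, Real.norm_of_nonneg (expKernel_nonneg _ _ _)]
    exact expKernel_le_one hl

/-- Both kernels live on v ≤ min t s, where their product is e^{-l(t+s)} e^{2lv}. The factor 1/(2l)
combines with the weight of `kerMeasure` to leave a Gamma integral in l. -/
lemma lintegral_expKernel_mul {l : ℝ} (hl : 0 < l) (t s : ℝ) :
    ∫⁻ v, ENNReal.ofReal (expKernel l v t * expKernel l v s) =
      ENNReal.ofReal (Real.exp (-(l * |t - s|)) / (2 * l)) := by
  have h1 : ∀ v, ENNReal.ofReal (expKernel l v t * expKernel l v s) =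
      (Iic (min t s)).indicator (fun v => ENNReal.ofReal
        (Real.exp (-(l * (t + s))) * Real.exp (2 * l * v))) v := by
    intro v
    by_cases hv : v ≤ min t s
    · rw [indicator_of_mem (mem_Iic.2 hv)]
      unfold expKernel
      rw [if_pos (hv.trans (min_le_left _ _)), if_pos (hv.trans (min_le_right _ _)),
        ← Real.exp_add, ← Real.exp_add]
      congr 2; ring
    · rw [indicator_of_notMem (by simpa using hv)]
      unfold expKernel
      rcases not_and_or.1 (mt le_min_iff.2 hv) with h | h <;> simp [h]
  simp_rw [h1]
  rw [lintegral_indicator measurableSet_Iic, ← ofReal_integral_eq_lintegral_ofReal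
    ((integrableOn_exp_mul_Iic (by positivity) _).const_mul _)
    (Filter.Eventually.of_forall fun v => by positivity), integral_const_mul,
    integral_exp_mul_Iic (by positivity), mul_div_assoc', ← Real.exp_add]
  congr 3
  rcases le_total t s with h | h
  · rw [min_eq_left h, abs_of_nonpos (by linarith)]; ring
  · rw [min_eq_right h, abs_of_nonneg (by linarith)]; ring

lemma lintegral_kerMeasure {H : ℝ} {g : ℝ × ℝ → ℝ≥0∞} (hg : Measurable g) :
    ∫⁻ z, g z ∂kerMeasure H =
      ∫⁻ l in Ioi (0 : ℝ), ENNReal.ofReal (l ^ (2 - 2 * H)) * ∫⁻ v, g (l, v) := by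
  unfold kerMeasure
  rw [lintegral_prod _ hg.aemeasurable, lintegral_withDensity_eq_lintegral_mul _ (by fun_prop)
    hg.lintegral_prod_right']
  rfl

/-- After the v-integral this is a Gamma integral in l. The diagonal is excluded because the left
side is infinite there, while a negative real power of 0 is 0 by convention. -/
lemma lintegral_kernel_kernel {H : ℝ} (hH : H < 1) {t s : ℝ} (hts : t ≠ s) :
    ∫⁻ z, ENNReal.ofReal (expKernel z.1 z.2 t * expKernel z.1 z.2 s) ∂kerMeasure H =
      ENNReal.ofReal (kerConst H * |t - s| ^ (2 * H - 2)) := by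
  have hm : ∀ t, Measurable fun z : ℝ × ℝ => expKernel z.1 z.2 t := fun t =>
    measurable_expKernel.comp (measurable_fst.prodMk (measurable_snd.prodMk measurable_const))
  rw [lintegral_kerMeasure (g := fun z => ENNReal.ofReal (expKernel z.1 z.2 t * expKernel z.1 z.2 s))
    ((hm t).mul (hm s)).ennreal_ofReal]
  have hτ : 0 < |t - s| := abs_pos.2 (sub_ne_zero.2 hts)
  have hI := Real.integral_rpow_mul_exp_neg_mul_Ioi (show 0 < 2 - 2 * H by linarith) hτ
  have hG := Real.Gamma_pos_of_pos (show 0 < 2 - 2 * H by linarith)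
  have hint : Integrable (fun l : ℝ => l ^ (2 - 2 * H - 1) * Real.exp (-(|t - s| * l)))
      (volume.restrict (Ioi 0)) := by
    -- A non-integrable function has integral 0 by convention, which would contradict the positive
    -- Gamma value.
    by_contra h
    rw [integral_undef h] at hI
    have : 0 < (1 / |t - s|) ^ (2 - 2 * H) * Real.Gamma (2 - 2 * H) := by positivity
    exact this.ne hI
  calc _ = ∫⁻ l in Ioi (0 : ℝ),
        ENNReal.ofReal (1 / 2 * (l ^ (2 - 2 * H - 1) * Real.exp (-(|t - s| * l)))) := by
        refine setLIntegral_congr_fun measurableSet_Ioi fun l hl => ?_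
        have hl : 0 < l := hl
        simp only
        rw [lintegral_expKernel_mul hl, ← ENNReal.ofReal_mul (by positivity)]
        congr 1
        rw [Real.rpow_sub_one hl.ne', mul_comm |t - s| l]
        field_simp
    _ = _ := by
        rw [← ofReal_integral_eq_lintegral_ofReal (hint.const_mul _), integral_const_mul, hI]
        · congr 1
          rw [one_div |t - s|, Real.inv_rpow hτ.le, ← Real.rpow_neg hτ.le, kerConst]
          ring_nf
        · refine (ae_restrict_iff' measurableSet_Ioi).2 (Filter.Eventually.of_forall fun l hl => ?_)
          have hl : 0 < l := hl
          simp only [Pi.zero_apply]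
          positivity

lemma integrableOn_abs_rpow {p : ℝ} (hp : -1 < p) (M : ℝ) :
    IntegrableOn (fun x : ℝ => |x| ^ p) (Icc (-M) M) := by
  rcases le_total M 0 with h | h
  · exact IntegrableOn.congr_set_ae (t := ∅) (by simp) (ae_eq_empty.2 (by simp; linarith))
  have h0 : IntervalIntegrable (fun x : ℝ => |x| ^ p) volume 0 M := by
    refine (intervalIntegral.intervalIntegrable_rpow' (a := 0) (b := M) hp).congr ?_
    intro x hx
    rw [uIoc_of_le h] at hx
    simp only
    rw [abs_of_pos hx.1]
  have h1 : IntervalIntegrable (fun x : ℝ => |x| ^ p) volume (-M) 0 := by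
    have := (h0.comp_mul_left (c := -1)).symm
    simpa [div_neg] using this
  have := h1.trans h0
  rwa [intervalIntegrable_iff_integrableOn_Icc_of_le (by linarith)] at this

/-- Bounded supports reduce the claim to a convolution integrand of an indicator with a truncated
power, and the power is locally integrable because -1 < p. -/
lemma Adm.integrable_prod {A B : ℝ → ℂ} (hA : Adm A) (hB : Adm B) {p : ℝ} (hp : -1 < p) :
    Integrable (fun x : ℝ × ℝ => (|x.1 - x.2| ^ p : ℝ) • (A x.1 * (starRingEnd ℂ) (B x.2)))
      ((volume.restrict (Ici 0)).prod (volume.restrict (Ici 0))) := by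
  obtain ⟨C, hC⟩ := hA.bdd
  obtain ⟨C', hC'⟩ := hB.bdd
  obtain ⟨M, hM⟩ := hA.supp
  obtain ⟨M', hM'⟩ := hB.supp
  set K := max M M'
  have hC0 : 0 ≤ C := (norm_nonneg _).trans (hC 0)
  have hC0' : 0 ≤ C' := (norm_nonneg _).trans (hC' 0)
  have hf : Integrable ((Icc 0 K).indicator fun _ : ℝ => C * C') :=
    (integrable_indicator_iff measurableSet_Icc).2 (integrableOn_const (by simp))
  have hg : Integrable ((Icc (-K) K).indicator fun x : ℝ => |x| ^ p) :=
    (integrable_indicator_iff measurableSet_Icc).2 (integrableOn_abs_rpow hp K)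
  have := hf.convolution_integrand (ContinuousLinearMap.mul ℝ ℝ) hg
  rw [Measure.prod_restrict]
  refine (this.integrableOn (s := Ici 0 ×ˢ Ici 0)).mono' ?_ ?_
  · refine Measurable.aestronglyMeasurable ?_
    have := hA.meas
    have := hB.meas
    fun_prop
  refine (ae_restrict_iff' (measurableSet_Ici.prod measurableSet_Ici)).2
    (Filter.Eventually.of_forall fun x hx => ?_)
  have hx1 : 0 ≤ x.1 := hx.1
  have hx2 : 0 ≤ x.2 := hx.2
  rw [norm_smul, Real.norm_of_nonneg (by positivity), norm_mul, RCLike.norm_conj]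
  simp only [ContinuousLinearMap.mul_apply']
  by_cases h1 : M < x.1
  · rw [hM _ h1]; simp only [norm_zero, zero_mul, mul_zero]
    refine mul_nonneg (indicator_nonneg (fun _ _ => by positivity) _)
      (indicator_nonneg (fun _ _ => by positivity) _)
  by_cases h2 : M' < x.2
  · rw [hM' _ h2]; simp only [norm_zero, mul_zero]
    refine mul_nonneg (indicator_nonneg (fun _ _ => by positivity) _)
      (indicator_nonneg (fun _ _ => by positivity) _)
  have h1' : x.1 ≤ K := (not_lt.1 h1).trans (le_max_left _ _)
  have h2' : x.2 ≤ K := (not_lt.1 h2).trans (le_max_right _ _)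
  rw [indicator_of_mem (show x.2 ∈ Icc 0 K from ⟨hx2, h2'⟩),
    indicator_of_mem (show x.1 - x.2 ∈ Icc (-K) K from ⟨by linarith, by linarith⟩), mul_comm]
  exact mul_le_mul_of_nonneg_right (mul_le_mul (hC _) (hC' _) (norm_nonneg _) hC0) (by positivity)

lemma measurable_feature {A : ℝ → ℂ} (hA : Measurable A) : Measurable (feature A) := by
  unfold feature
  refine StronglyMeasurable.measurable ?_
  refine StronglyMeasurable.integral_prod_right
    (f := fun (z : ℝ × ℝ) (t : ℝ) => (expKernel z.1 z.2 t : ℂ) * A t) ?_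
  refine Measurable.stronglyMeasurable ?_
  refine Measurable.mul (Complex.measurable_ofReal.comp ?_) (hA.comp measurable_snd)
  exact measurable_expKernel.comp ((measurable_fst.comp measurable_fst).prodMk
    ((measurable_snd.comp measurable_fst).prodMk measurable_snd))

lemma ae_prod_ne : ∀ᵐ x : ℝ × ℝ ∂((volume.restrict (Ici (0:ℝ))).prod (volume.restrict (Ici 0))),
    x.1 ≠ x.2 := by
  have hm : MeasurableSet {x : ℝ × ℝ | ¬ x.1 ≠ x.2} := by
    simpa using measurableSet_eq_fun (measurable_fst (α := ℝ) (β := ℝ)) measurable_snd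
  rw [ae_iff, Measure.measure_prod_null hm]
  refine Filter.Eventually.of_forall fun x => ?_
  have : Prod.mk x ⁻¹' {x : ℝ × ℝ | ¬ x.1 ≠ x.2} = {x} := by ext y; simp [eq_comm]
  simp only [Pi.zero_apply]
  rw [this]; simp

/-- Factor the kernel through `kerMeasure` and exchange the integrals: the two time integrals
separate into a feature and its conjugate. This makes visible that the quadratic form is
nonnegative. -/
lemma timeIntegral_eq_feature {H : ℝ} (hH : 1 / 2 < H) (hH' : H < 1) {A : ℝ → ℂ} (hA : Adm A) :
    Integrable (fun z => ‖feature A z‖ ^ 2) (kerMeasure H) ∧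
    timeIntegral H (fun t s => A t * (starRingEnd ℂ) (A s)) =
      (((kerConst H)⁻¹ * ∫ z, ‖feature A z‖ ^ 2 ∂kerMeasure H : ℝ) : ℂ) := by
  have hc := kerConst_pos hH'
  set m : Measure ℝ := volume.restrict (Ici 0) with hm
  have hP := hA.integrable_prod hA (p := 2 * H - 2) (by linarith)
  have hker : ∀ t s, t ≠ s → Integrable (fun z : ℝ × ℝ => expKernel z.1 z.2 t * expKernel z.1 z.2 s)
      (kerMeasure H) ∧ ∫ z : ℝ × ℝ, expKernel z.1 z.2 t * expKernel z.1 z.2 s ∂kerMeasure H =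
        kerConst H * |t - s| ^ (2 * H - 2) := by
    intro t s hts
    have h := lintegral_kernel_kernel hH' hts
    have hme : ∀ t, Measurable fun z : ℝ × ℝ => expKernel z.1 z.2 t := fun t =>
      measurable_expKernel.comp (measurable_fst.prodMk (measurable_snd.prodMk measurable_const))
    have h0 : 0 ≤ᵐ[kerMeasure H] fun z : ℝ × ℝ => expKernel z.1 z.2 t * expKernel z.1 z.2 s :=
      Filter.Eventually.of_forall fun z => mul_nonneg (expKernel_nonneg _ _ _)
        (expKernel_nonneg _ _ _)
    have hi : Integrable (fun z : ℝ × ℝ => expKernel z.1 z.2 t * expKernel z.1 z.2 s)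
      (kerMeasure H) := by
      refine ⟨((hme t).mul (hme s)).aestronglyMeasurable, ?_⟩
      rw [hasFiniteIntegral_iff_ofReal h0, h]
      exact ENNReal.ofReal_lt_top
    refine ⟨hi, ?_⟩
    rw [← ofReal_integral_eq_lintegral_ofReal hi h0] at h
    rwa [ENNReal.ofReal_eq_ofReal_iff (integral_nonneg_of_ae h0) (by positivity)] at h
  -- the triple integrand
  set F : (ℝ × ℝ) × (ℝ × ℝ) → ℂ := fun x =>
    ((expKernel x.2.1 x.2.2 x.1.1 * expKernel x.2.1 x.2.2 x.1.2 : ℝ) : ℂ) *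
      (A x.1.1 * (starRingEnd ℂ) (A x.1.2)) with hF
  have hFm : Measurable F := by
    have h1 : Measurable fun x : (ℝ × ℝ) × (ℝ × ℝ) => expKernel x.2.1 x.2.2 x.1.1 :=
      measurable_expKernel.comp (f := fun x : (ℝ × ℝ) × (ℝ × ℝ) => (x.2.1, x.2.2, x.1.1))
        (by fun_prop)
    have h2 : Measurable fun x : (ℝ × ℝ) × (ℝ × ℝ) => expKernel x.2.1 x.2.2 x.1.2 :=
      measurable_expKernel.comp (f := fun x : (ℝ × ℝ) × (ℝ × ℝ) => (x.2.1, x.2.2, x.1.2))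
        (by fun_prop)
    have := hA.meas
    fun_prop
  -- Integrating the norm first over the kernel variables gives back `kerConst H` times the singular
  -- kernel, so `hP` is exactly what is needed.
  have hFi : Integrable F ((m.prod m).prod (kerMeasure H)) := by
    rw [integrable_prod_iff hFm.aestronglyMeasurable]
    constructor
    · filter_upwards [ae_prod_ne] with x hx
      exact ((hker x.1 x.2 hx).1.ofReal (𝕜 := ℂ)).mul_const (A x.1 * (starRingEnd ℂ) (A x.2))
    · refine (hP.norm.const_mul (kerConst H)).congr ?_
      filter_upwards [ae_prod_ne] with x hx
      simp only [hF, norm_mul, Complex.norm_real]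
      rw [integral_mul_const, ← norm_mul (A x.1)]
      have : ∀ z : ℝ × ℝ, ‖expKernel z.1 z.2 x.1 * expKernel z.1 z.2 x.2‖ =
          expKernel z.1 z.2 x.1 * expKernel z.1 z.2 x.2 := fun z =>
        Real.norm_of_nonneg (mul_nonneg (expKernel_nonneg _ _ _) (expKernel_nonneg _ _ _))
      simp_rw [← norm_mul, this]
      rw [(hker x.1 x.2 hx).2, norm_smul, Real.norm_of_nonneg (by positivity), mul_assoc]
  have hfeat : ∀ z, ∫ x, F (x, z) ∂(m.prod m) = ((‖feature A z‖ ^ 2 : ℝ) : ℂ) := by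
    intro z
    have h1 : ∀ x : ℝ × ℝ, F (x, z) = ((expKernel z.1 z.2 x.1 : ℂ) * A x.1) *
        (starRingEnd ℂ) ((expKernel z.1 z.2 x.2 : ℂ) * A x.2) := by
      intro x
      simp only [hF, map_mul, Complex.conj_ofReal, Complex.ofReal_mul]
      ring
    simp_rw [h1]
    rw [integral_prod_mul (fun t => (expKernel z.1 z.2 t : ℂ) * A t)
      (fun t => (starRingEnd ℂ) ((expKernel z.1 z.2 t : ℂ) * A t)), integral_conj]
    rw [Complex.mul_conj, Complex.normSq_eq_norm_sq]
    rfl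
  have hint : Integrable (fun z => ((‖feature A z‖ ^ 2 : ℝ) : ℂ)) (kerMeasure H) := by
    simp_rw [← hfeat]
    exact hFi.integral_prod_right
  have hint' : Integrable (fun z => ‖feature A z‖ ^ 2) (kerMeasure H) := by
    refine hint.re.congr (Filter.Eventually.of_forall fun z => ?_)
    exact Complex.ofReal_re _
  refine ⟨hint', ?_⟩
  unfold timeIntegral
  rw [if_neg hH.ne', ← integral_prod (fun x : ℝ × ℝ => (|x.1 - x.2| ^ (2 * H - 2) : ℝ) •
    (A x.1 * (starRingEnd ℂ) (A x.2))) hP]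
  have : ∀ᵐ x ∂(m.prod m), (|x.1 - x.2| ^ (2 * H - 2) : ℝ) • (A x.1 * (starRingEnd ℂ) (A x.2)) =
      ((kerConst H)⁻¹ : ℂ) * ∫ z, F (x, z) ∂kerMeasure H := by
    filter_upwards [ae_prod_ne] with x hx
    simp only [hF]
    rw [integral_mul_const, integral_complex_ofReal, (hker x.1 x.2 hx).2, Complex.real_smul]
    push_cast
    have : (kerConst H : ℂ) ≠ 0 := by exact_mod_cast hc.ne'
    field_simp
  rw [integral_congr_ae this, integral_const_mul, integral_integral_swap hFi]
  simp_rw [hfeat]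
  rw [integral_complex_ofReal]
  push_cast
  rfl

/-- Lets `hpNormSq` be handled through an expression that behaves like a squared Hilbert norm,
uniformly in the two cases for H. -/
lemma ofReal_timeIntegral {H : ℝ} (hH : 1 / 2 ≤ H) (hH' : H < 1) {A : ℝ → ℂ} (hA : Adm A) :
    ENNReal.ofReal (timeIntegral H (fun t s => A t * (starRingEnd ℂ) (A s))).re = energy H A := by
  have hc := kerConst_pos hH'
  rcases hH.eq_or_lt with h | h
  · subst h
    unfold timeIntegral energy
    rw [if_pos rfl, if_pos rfl]
    obtain ⟨C, hC⟩ := hA.bdd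
    have hi : Integrable (fun t => ‖A t‖ ^ 2) (volume.restrict (Ici 0)) := by
      refine (hA.integrable.norm.const_mul C).mono' (by have := hA.meas; fun_prop) ?_
      refine Filter.Eventually.of_forall fun t => ?_
      rw [Real.norm_of_nonneg (by positivity), sq]
      exact mul_le_mul_of_nonneg_right (hC t) (norm_nonneg _)
    have : ∀ t, A t * (starRingEnd ℂ) (A t) = ((‖A t‖ ^ 2 : ℝ) : ℂ) := fun t => by
      rw [Complex.mul_conj, Complex.normSq_eq_norm_sq]
    simp_rw [this]
    rw [integral_complex_ofReal, Complex.ofReal_re, ofReal_integral_eq_lintegral_ofReal hi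
      (Filter.Eventually.of_forall fun t => by positivity)]
    refine lintegral_congr fun t => ?_
    rw [ENNReal.ofReal_pow (norm_nonneg _), ofReal_norm]
  · obtain ⟨h1, h2⟩ := timeIntegral_eq_feature h hH' hA
    rw [h2, Complex.ofReal_re, ENNReal.ofReal_mul (by positivity), ENNReal.ofReal_inv_of_pos hc,
      ofReal_integral_eq_lintegral_ofReal h1 (Filter.Eventually.of_forall fun t => by positivity)]
    unfold energy
    rw [if_neg h.ne']
    congr 1
    refine lintegral_congr fun t => ?_
    rw [ENNReal.ofReal_pow (norm_nonneg _), ofReal_norm]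

lemma ennreal_add_sq_le (a b : ℝ≥0∞) : (a + b) ^ 2 ≤ 2 * a ^ 2 + 2 * b ^ 2 := by
  rcases eq_or_ne a ∞ with rfl | ha
  · simp
  rcases eq_or_ne b ∞ with rfl | hb
  · simp
  lift a to NNReal using ha
  lift b to NNReal using hb
  norm_cast
  rw [← NNReal.coe_le_coe]
  push_cast
  nlinarith [sq_nonneg ((a : ℝ) - b)]

lemma enorm_add_sq_le (x y : ℂ) : ‖x + y‖ₑ ^ 2 ≤ 2 * ‖x‖ₑ ^ 2 + 2 * ‖y‖ₑ ^ 2 :=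
  (pow_le_pow_left' (enorm_add_le x y) 2).trans (ennreal_add_sq_le _ _)

/-- Cauchy–Schwarz for Lebesgue integrals. -/
lemma lintegral_mul_sq_le {α : Type*} [MeasurableSpace α] {μ : Measure α} {f g : α → ℝ≥0∞}
    (hf : AEMeasurable f μ) (hg : AEMeasurable g μ) :
    (∫⁻ x, f x * g x ∂μ) ^ 2 ≤ (∫⁻ x, f x ^ 2 ∂μ) * ∫⁻ x, g x ^ 2 ∂μ := by
  have h := ENNReal.lintegral_mul_le_Lp_mul_Lq μ Real.HolderConjugate.two_two hf hg
  calc _ ≤ ((∫⁻ a, f a ^ (2 : ℝ) ∂μ) ^ (1 / 2 : ℝ) * (∫⁻ a, g a ^ (2 : ℝ) ∂μ) ^ (1 / 2 : ℝ)) ^ 2 :=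
        pow_le_pow_left' h 2
    _ = _ := by
        rw [mul_pow, ← ENNReal.rpow_natCast, ← ENNReal.rpow_mul, ← ENNReal.rpow_natCast,
          ← ENNReal.rpow_mul]
        norm_num

lemma ae_kerMeasure_pos (H : ℝ) : ∀ᵐ z ∂kerMeasure H, 0 < z.1 := by
  unfold kerMeasure
  refine Measure.quasiMeasurePreserving_fst.ae (p := fun l => 0 < l) ?_
  exact (withDensity_absolutelyContinuous _ _).ae_le (ae_restrict_mem measurableSet_Ioi)

lemma energy_congr_ae {H : ℝ} {A B : ℝ → ℂ} (h : A =ᵐ[volume.restrict (Ici 0)] B) :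
    energy H A = energy H B := by
  unfold energy
  split_ifs
  · refine lintegral_congr_ae ?_
    filter_upwards [h] with t ht
    rw [ht]
  · congr 1
    refine lintegral_congr fun z => ?_
    unfold feature
    rw [integral_congr_ae (g := fun t => (expKernel z.1 z.2 t : ℂ) * B t)]
    filter_upwards [h] with t ht
    rw [ht]

/-- Features are linear for l > 0, so this is a pointwise inequality. The factor 2 is harmless
because only orders of magnitude matter later. -/
lemma energy_add_le (H : ℝ) {A B : ℝ → ℂ} (hA : Adm A) (hB : Adm B) :
    energy H (fun t => A t + B t) ≤ 2 * energy H A + 2 * energy H B := by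
  unfold energy
  split_ifs
  · rw [← lintegral_const_mul _ (by have := hA.meas; fun_prop),
      ← lintegral_const_mul _ (by have := hB.meas; fun_prop),
      ← lintegral_add_left (by have := hA.meas; fun_prop)]
    exact lintegral_mono fun t => enorm_add_sq_le _ _
  · have hm := measurable_feature hA.meas
    have hm' := measurable_feature hB.meas
    rw [mul_left_comm, mul_left_comm 2, ← mul_add,
      ← lintegral_const_mul (f := fun z => ‖feature A z‖ₑ ^ 2) _ (by fun_prop),
      ← lintegral_const_mul (f := fun z => ‖feature B z‖ₑ ^ 2) _ (by fun_prop),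
      ← lintegral_add_left (by fun_prop)]
    gcongr 1
    refine lintegral_mono_ae ?_
    filter_upwards [ae_kerMeasure_pos H] with z hz
    have : feature (fun t => A t + B t) z = feature A z + feature B z := by
      unfold feature
      rw [← integral_add (integrable_kernel_mul hA.integrable hz.le _)
        (integrable_kernel_mul hB.integrable hz.le _)]
      simp_rw [mul_add]
    rw [this]
    exact enorm_add_sq_le _ _

lemma energy_const_mul (H : ℝ) (A : ℝ → ℂ) (c : ℂ) :
    energy H (fun t => c * A t) = ‖c‖ₑ ^ 2 * energy H A := by
  have hc : ‖c‖ₑ ^ 2 ≠ ∞ := by simp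
  unfold energy
  split_ifs
  · rw [← lintegral_const_mul' _ _ hc]
    simp_rw [enorm_mul, mul_pow]
  · rw [mul_left_comm, ← lintegral_const_mul' _ _ hc]
    congr 1
    refine lintegral_congr fun z => ?_
    have : feature (fun t => c * A t) z = c * feature A z := by
      unfold feature
      rw [← integral_const_mul]
      congr 1
      ext t
      ring
    rw [this, enorm_mul, mul_pow]

/-! ### Lower bound for the time energy by duality -/

/-- The one-sided exponential is the fundamental solution of d/dt + l: on [0, t] the integrand is
the derivative of e^{-l(t-v)} q(v), and q(0) = 0 by continuity. -/
lemma integral_expKernel_mul_deriv {q q' : ℝ → ℝ} (hq : ∀ t, HasDerivAt q (q' t) t)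
    (hq' : Continuous q') {a : ℝ} (hs : ∀ t ∉ Icc 0 a, q t = 0) (hs' : ∀ t ∉ Icc 0 a, q' t = 0)
    (l : ℝ) {t : ℝ} (ht : 0 ≤ t) :
    ∫ v, expKernel l v t * (q' v + l * q v) = q t := by
  have hqc : Continuous q := continuous_iff_continuousAt.2 fun t => (hq t).continuousAt
  have h0 : q 0 = 0 := by
    have h1 : Tendsto q (𝓝[<] 0) (𝓝 (q 0)) := hqc.continuousAt.tendsto.mono_left nhdsWithin_le_nhds
    have h2 : Tendsto q (𝓝[<] 0) (𝓝 0) := by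
      refine tendsto_const_nhds.congr' ?_
      filter_upwards [self_mem_nhdsWithin] with t ht
      exact (hs t fun h => absurd h.1 (not_le.2 ht)).symm
    exact tendsto_nhds_unique h1 h2
  have h1 : ∀ v, expKernel l v t * (q' v + l * q v) =
      (Icc 0 t).indicator (fun v => Real.exp (-(l * (t - v))) * (q' v + l * q v)) v := by
    intro v
    by_cases hv : v ∈ Icc 0 t
    · rw [indicator_of_mem hv, expKernel, if_pos hv.2]
    · rw [indicator_of_notMem hv]
      by_cases hv0 : 0 ≤ v
      · rw [expKernel, if_neg fun h => hv ⟨hv0, h⟩, zero_mul]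
      · rw [hs v fun h => hv0 h.1, hs' v fun h => hv0 h.1]; simp
  simp_rw [h1]
  rw [integral_indicator measurableSet_Icc, integral_Icc_eq_integral_Ioc,
    ← intervalIntegral.integral_of_le ht,
    intervalIntegral.integral_eq_sub_of_hasDerivAt (f := fun v => Real.exp (-(l * (t - v))) * q v)]
  · simp [h0]
  · intro v _
    have he : HasDerivAt (fun v => Real.exp (-(l * (t - v)))) (Real.exp (-(l * (t - v))) * l) v := by
      have : HasDerivAt (fun v => -(l * (t - v))) l v := by
        have h2 := (((hasDerivAt_id v).const_sub t).const_mul l).neg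
        simp only [mul_neg, mul_one, neg_neg] at h2
        exact h2
      exact this.exp
    refine (he.mul (hq v)).congr_deriv ?_
    ring
  · exact Continuous.intervalIntegrable (by fun_prop) _ _

/-- Insert the previous representation of q and apply Fubini. The rate l is free, so the identity
can be averaged over rates comparable to the frequency of q. -/
lemma integral_mul_eq_feature {A : ℝ → ℂ} (hA : Adm A) {q q' : ℝ → ℝ}
    (hq : ∀ t, HasDerivAt q (q' t) t) (hq' : Continuous q') {a : ℝ}
    (hs : ∀ t ∉ Icc 0 a, q t = 0) (hs' : ∀ t ∉ Icc 0 a, q' t = 0) {l : ℝ} (hl : 0 ≤ l) :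
    ∫ t in Ici (0 : ℝ), A t * (q t : ℂ) = ∫ v, ((q' v + l * q v : ℝ) : ℂ) * feature A (l, v) := by
  have hqc : Continuous q := continuous_iff_continuousAt.2 fun t => (hq t).continuousAt
  have hk : Integrable fun v => q' v + l * q v := by
    refine Continuous.integrable_of_hasCompactSupport (by fun_prop) ?_
    refine HasCompactSupport.intro (isCompact_Icc (a := 0) (b := a)) fun t ht => ?_
    rw [hs t ht, hs' t ht]; simp
  have hi : Integrable (fun x : ℝ × ℝ => ((expKernel l x.2 x.1 : ℝ) : ℂ) *
      (A x.1 * ((q' x.2 + l * q x.2 : ℝ) : ℂ))) ((volume.restrict (Ici 0)).prod volume) := by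
    refine (hA.integrable.mul_prod (hk.ofReal (𝕜 := ℂ))).bdd_mul (c := 1) ?_ ?_
    · refine (Complex.measurable_ofReal.comp (measurable_expKernel.comp
        (f := fun x : ℝ × ℝ => (l, x.2, x.1)) (by fun_prop))).aestronglyMeasurable
    · refine Filter.Eventually.of_forall fun t => ?_
      rw [Complex.norm_real, Real.norm_of_nonneg (expKernel_nonneg _ _ _)]
      exact expKernel_le_one hl
  calc _ = ∫ t in Ici (0 : ℝ), ∫ v, ((expKernel l v t : ℝ) : ℂ) *
      (A t * ((q' v + l * q v : ℝ) : ℂ)) := by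
        refine setIntegral_congr_fun measurableSet_Ici fun t ht => ?_
        rw [← integral_expKernel_mul_deriv hq hq' hs hs' l ht, ← integral_complex_ofReal,
          ← integral_const_mul]
        congr 1
        ext v
        push_cast
        ring
    _ = _ := by
        rw [integral_integral_swap hi]
        congr 1
        ext v
        unfold feature
        rw [← integral_const_mul]
        congr 1
        ext t
        ring

/-- Lower bound for the energy by duality with smooth test functions of time. -/
lemma enorm_integral_mul_sq_le {H : ℝ} (hH : 1 / 2 ≤ H) (hH' : H < 1) {a : ℝ} (ha : 0 < a) :
    ∃ C : ℝ, 0 < C ∧ ∀ A : ℝ → ℂ, Adm A → ∀ Λ amp : ℝ, 1 ≤ Λ → 0 ≤ amp → ∀ q q' : ℝ → ℝ,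
      (∀ t, HasDerivAt q (q' t) t) → Continuous q' → (∀ t ∉ Icc 0 a, q t = 0) →
      (∀ t ∉ Icc 0 a, q' t = 0) → (∀ t, |q t| ≤ amp) → (∀ t, |q' t| ≤ Λ * amp) →
      ‖∫ t in Ici (0 : ℝ), A t * (q t : ℂ)‖ₑ ^ 2 ≤
        ENNReal.ofReal (C * Λ ^ (2 * H - 1) * amp ^ 2) * energy H A := by
  have hc := kerConst_pos hH'
  rcases hH.eq_or_lt with h | h
  · subst h
    refine ⟨a, ha, fun A hA Λ amp hΛ hamp q q' hq hq' hs hs' hb hb' => ?_⟩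
    have hqc : Continuous q := continuous_iff_continuousAt.2 fun t => (hq t).continuousAt
    have hAm := hA.meas
    calc _ ≤ (∫⁻ t in Ici (0 : ℝ), ‖(q t : ℂ)‖ₑ * ‖A t‖ₑ) ^ 2 := by
          refine pow_le_pow_left' ((enorm_integral_le_lintegral_enorm _).trans_eq ?_) 2
          simp_rw [enorm_mul, mul_comm]
      _ ≤ (∫⁻ t in Ici (0 : ℝ), ‖(q t : ℂ)‖ₑ ^ 2) * ∫⁻ t in Ici (0 : ℝ), ‖A t‖ₑ ^ 2 :=
          lintegral_mul_sq_le (by fun_prop) (by fun_prop)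
      _ ≤ _ := by
          unfold energy
          rw [if_pos rfl]
          gcongr
          calc _ ≤ ∫⁻ t, (Icc 0 a).indicator (fun _ => ENNReal.ofReal (amp ^ 2)) t := by
                refine (setLIntegral_le_lintegral _ _).trans (lintegral_mono fun t => ?_)
                by_cases ht : t ∈ Icc 0 a
                · rw [indicator_of_mem ht, ENNReal.ofReal_pow hamp, ← ofReal_norm,
                    Complex.norm_real]
                  gcongr
                  exact hb t
                · simp [hs t ht]
            _ = _ := by
                rw [lintegral_indicator measurableSet_Icc, setLIntegral_const, Real.volume_Icc,
                  ← ENNReal.ofReal_mul (by positivity)]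
                congr 1
                norm_num
                ring
  · refine ⟨9 * a * kerConst H, by positivity,
      fun A hA Λ amp hΛ hamp q q' hq hq' hs hs' hb hb' => ?_⟩
    have hΛ0 : 0 < Λ := by linarith
    have hqc : Continuous q := continuous_iff_continuousAt.2 fun t => (hq t).continuousAt
    have hfm := measurable_feature hA.meas
    set I := ∫ t in Ici (0 : ℝ), A t * (q t : ℂ) with hI
    -- For these l both q' and l q are O(Λ amp), with |q' + l q| ≤ 3 Λ amp on [0, a]; Cauchy-Schwarz
    -- in v then gives 9 a Λ² amp².
    have h1 : ∀ l ∈ Icc Λ (2 * Λ), ‖I‖ₑ ^ 2 ≤ ENNReal.ofReal (9 * a * Λ ^ 2 * amp ^ 2) *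
        ∫⁻ v, ‖feature A (l, v)‖ₑ ^ 2 := by
      intro l hl
      have hl0 : 0 ≤ l := hΛ0.le.trans hl.1
      rw [hI, integral_mul_eq_feature hA hq hq' hs hs' hl0]
      calc _ ≤ (∫⁻ v, ‖((q' v + l * q v : ℝ) : ℂ)‖ₑ * ‖feature A (l, v)‖ₑ) ^ 2 := by
            refine pow_le_pow_left' ((enorm_integral_le_lintegral_enorm _).trans_eq ?_) 2
            simp_rw [enorm_mul]
        _ ≤ (∫⁻ v, ‖((q' v + l * q v : ℝ) : ℂ)‖ₑ ^ 2) * ∫⁻ v, ‖feature A (l, v)‖ₑ ^ 2 :=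
            lintegral_mul_sq_le (by fun_prop) (by fun_prop)
        _ ≤ _ := by
            gcongr
            calc _ ≤ ∫⁻ t, (Icc 0 a).indicator (fun _ => ENNReal.ofReal ((3 * Λ * amp) ^ 2)) t := by
                  refine lintegral_mono fun t => ?_
                  by_cases ht : t ∈ Icc 0 a
                  · rw [indicator_of_mem ht, ENNReal.ofReal_pow (by positivity), ← ofReal_norm,
                      Complex.norm_real]
                    gcongr
                    calc |q' t + l * q t| ≤ |q' t| + l * |q t| := by
                          refine (abs_add_le _ _).trans_eq ?_
                          rw [abs_mul, abs_of_nonneg hl0]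
                      _ ≤ Λ * amp + (2 * Λ) * amp := by
                          gcongr
                          · exact hb' t
                          · exact hl.2
                          · exact hb t
                      _ = _ := by ring
                  · simp [hs t ht, hs' t ht]
              _ = _ := by
                  rw [lintegral_indicator measurableSet_Icc, setLIntegral_const, Real.volume_Icc,
                    ← ENNReal.ofReal_mul (by positivity)]
                  congr 1
                  ring
    -- The rates in [Λ, 2Λ] have weighted mass at least Λ^{3-2H}. Dividing Λ² by it leaves the power
    -- 2H - 1.
    have h2 : ENNReal.ofReal (Λ ^ (3 - 2 * H)) * ‖I‖ₑ ^ 2 ≤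
        ENNReal.ofReal (9 * a * Λ ^ 2 * amp ^ 2) * ∫⁻ z, ‖feature A z‖ₑ ^ 2 ∂kerMeasure H := by
      rw [lintegral_kerMeasure (by fun_prop), ← lintegral_const_mul' _ _ ENNReal.ofReal_ne_top]
      calc _ = ∫⁻ l in Icc Λ (2 * Λ), ENNReal.ofReal (Λ ^ (2 - 2 * H)) * ‖I‖ₑ ^ 2 := by
            rw [setLIntegral_const, Real.volume_Icc, mul_right_comm,
              ← ENNReal.ofReal_mul (by positivity)]
            congr 2
            rw [show 2 * Λ - Λ = Λ by ring, show 3 - 2 * H = (2 - 2 * H) + 1 by ring,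
              Real.rpow_add_one hΛ0.ne']
        _ ≤ ∫⁻ l in Icc Λ (2 * Λ), ENNReal.ofReal (9 * a * Λ ^ 2 * amp ^ 2) *
            (ENNReal.ofReal (l ^ (2 - 2 * H)) * ∫⁻ v, ‖feature A (l, v)‖ₑ ^ 2) := by
            refine setLIntegral_mono' measurableSet_Icc fun l hl => ?_
            rw [mul_left_comm]
            exact mul_le_mul' (ENNReal.ofReal_le_ofReal
              (Real.rpow_le_rpow hΛ0.le hl.1 (by linarith))) (h1 l hl)
        _ ≤ _ := lintegral_mono_set fun l hl => hΛ0.trans_le hl.1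
    have hΛp : 0 < Λ ^ (3 - 2 * H) := by positivity
    have h3 : ‖I‖ₑ ^ 2 ≤ (ENNReal.ofReal (Λ ^ (3 - 2 * H)))⁻¹ *
        (ENNReal.ofReal (9 * a * Λ ^ 2 * amp ^ 2) * ∫⁻ z, ‖feature A z‖ₑ ^ 2 ∂kerMeasure H) := by
      rw [← ENNReal.div_eq_inv_mul, ENNReal.le_div_iff_mul_le (by simp [hΛp]) (by simp), mul_comm]
      exact h2
    refine h3.trans_eq ?_
    unfold energy
    rw [if_neg h.ne', ← mul_assoc, ← mul_assoc, ← ENNReal.ofReal_inv_of_pos hΛp,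
      ← ENNReal.ofReal_inv_of_pos hc, ← ENNReal.ofReal_mul (by positivity),
      ← ENNReal.ofReal_mul (by positivity)]
    congr 2
    rw [show 2 * H - 1 = -(3 - 2 * H) + 2 by ring, Real.rpow_add hΛ0, Real.rpow_neg hΛ0.le,
      show Λ ^ (2 : ℝ) = Λ ^ 2 by norm_cast]
    field_simp

/-! ### Oscillatory integrals and upper bounds for the time energy -/

lemma abs_integral_rpow_mul_le {p : ℝ} (hp : -1 < p) {g : ℝ → ℝ}
    {K : ℝ} (hK : ∀ x, |g x| ≤ K) {D : ℝ} (hD : 0 ≤ D) :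
    |∫ x in (0 : ℝ)..D, x ^ p * g x| ≤ K * (D ^ (p + 1) / (p + 1)) := by
  have hi : IntervalIntegrable (fun x : ℝ => x ^ p) volume 0 D :=
    intervalIntegral.intervalIntegrable_rpow' hp
  have h := intervalIntegral.norm_integral_le_of_norm_le (f := fun x => x ^ p * g x)
    (g := fun x => K * x ^ p) hD (Filter.Eventually.of_forall fun x hx => ?_) (hi.const_mul K)
  · rw [Real.norm_eq_abs] at h
    refine h.trans_eq ?_
    rw [intervalIntegral.integral_const_mul, integral_rpow (Or.inl hp),
      Real.zero_rpow (by linarith), sub_zero]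
  · have : 0 ≤ x ^ p := Real.rpow_nonneg hx.1.le _
    rw [norm_mul, Real.norm_of_nonneg this, mul_comm]
    exact mul_le_mul_of_nonneg_right (hK x) this

/-- The singularity on [0, 1] costs 1/(p+1). Beyond 1, integration by parts leaves two boundary
terms and one integral with monotone weight, each at most 1. The bound is uniform in D and θ. -/
lemma abs_integral_rpow_mul_cos_le {p : ℝ} (hp : -1 < p) (hp0 : p < 0) (θ : ℝ) {D : ℝ}
    (hD : 0 ≤ D) : |∫ x in (0 : ℝ)..D, x ^ p * Real.cos (x + θ)| ≤ 1 / (p + 1) + 3 := by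
  have hc : Continuous fun x => Real.cos (x + θ) := by fun_prop
  have hb : ∀ x, |Real.cos (x + θ)| ≤ 1 := fun x => Real.abs_cos_le_one _
  have hp1 : 0 < p + 1 := by linarith
  rcases le_total D 1 with h | h
  · refine (abs_integral_rpow_mul_le hp hb hD).trans ?_
    rw [one_mul]
    have : D ^ (p + 1) ≤ 1 := Real.rpow_le_one hD h hp1.le
    have : D ^ (p + 1) / (p + 1) ≤ 1 / (p + 1) := by gcongr
    linarith
  have hi : ∀ a b, IntervalIntegrable (fun x : ℝ => x ^ p * Real.cos (x + θ)) volume a b :=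
    fun a b => (intervalIntegral.intervalIntegrable_rpow' hp).mul_continuousOn hc.continuousOn
  rw [← intervalIntegral.integral_add_adjacent_intervals (hi 0 1) (hi 1 D)]
  have h1 := abs_integral_rpow_mul_le hp hb zero_le_one
  rw [Real.one_rpow, one_mul] at h1
  have hpos : ∀ x ∈ uIcc 1 D, 0 < x := fun x hx => by
    rw [uIcc_of_le h] at hx; linarith [hx.1]
  have hpi : IntervalIntegrable (fun x : ℝ => p * x ^ (p - 1)) volume 1 D := by
    refine ContinuousOn.intervalIntegrable fun x hx => ?_
    exact (continuousAt_const.mul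
      (Real.continuousAt_rpow_const _ _ (Or.inl (hpos x hx).ne'))).continuousWithinAt
  have h2 := intervalIntegral.integral_mul_deriv_eq_deriv_mul (a := 1) (b := D)
    (u := fun x : ℝ => x ^ p) (v := fun x => Real.sin (x + θ)) (u' := fun x => p * x ^ (p - 1))
    (v' := fun x => Real.cos (x + θ))
    (fun x hx => Real.hasDerivAt_rpow_const (Or.inl (hpos x hx).ne'))
    (fun x _ => by simpa using ((hasDerivAt_id x).add_const θ).sin)
    hpi (hc.intervalIntegrable _ _)
  have h3 : |∫ x in (1 : ℝ)..D, p * x ^ (p - 1) * Real.sin (x + θ)| ≤ 1 := by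
    have h4 := intervalIntegral.norm_integral_le_of_norm_le
      (f := fun x => p * x ^ (p - 1) * Real.sin (x + θ)) (g := fun x => -(p * x ^ (p - 1))) h
      (Filter.Eventually.of_forall fun x hx => ?_) hpi.neg
    · rw [Real.norm_eq_abs] at h4
      refine h4.trans ?_
      rw [intervalIntegral.integral_neg, intervalIntegral.integral_eq_sub_of_hasDerivAt
        (f := fun x : ℝ => x ^ p)
        (fun x hx => Real.hasDerivAt_rpow_const (Or.inl (hpos x hx).ne')) hpi, Real.one_rpow]
      have : 0 ≤ D ^ p := Real.rpow_nonneg hD _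
      linarith
    · have hx0 : 0 < x := by linarith [hx.1]
      have : 0 ≤ x ^ (p - 1) := Real.rpow_nonneg hx0.le _
      rw [norm_mul, norm_mul, Real.norm_of_nonneg this, Real.norm_of_nonpos hp0.le]
      have hs : ‖Real.sin (x + θ)‖ ≤ 1 := Real.abs_sin_le_one _
      have h0 : 0 ≤ -p * x ^ (p - 1) := mul_nonneg (by linarith) this
      nlinarith
  have h4 : |D ^ p * Real.sin (D + θ)| ≤ 1 := by
    rw [abs_mul, abs_of_nonneg (Real.rpow_nonneg hD _)]
    exact mul_le_one₀ (Real.rpow_le_one_of_one_le_of_nonpos h hp0.le) (abs_nonneg _)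
      (Real.abs_sin_le_one _)
  have h5 : |(1 : ℝ) ^ p * Real.sin (1 + θ)| ≤ 1 := by
    rw [Real.one_rpow, one_mul]; exact Real.abs_sin_le_one _
  rw [h2]
  rw [abs_le] at *
  constructor <;> linarith [h1.1, h1.2, h3.1, h3.2, h4.1, h4.2, h5.1, h5.2]

/-- Scaling by r. With p = 2H - 2 the gain from oscillation is r^{1-2H}. -/
lemma abs_integral_rpow_mul_cos_mul_le {p : ℝ} (hp : -1 < p) (hp0 : p < 0) {r : ℝ} (hr : 0 < r)
    (θ : ℝ) {D : ℝ} (hD : 0 ≤ D) :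
    |∫ x in (0 : ℝ)..D, x ^ p * Real.cos (r * x + θ)| ≤ (1 / (p + 1) + 3) * r ^ (-p - 1) := by
  have h := intervalIntegral.integral_comp_mul_left (a := 0) (b := D)
    (fun y => y ^ p * Real.cos (y + θ)) hr.ne'
  have h1 : ∫ x in (0 : ℝ)..D, x ^ p * Real.cos (r * x + θ) =
      r ^ (-p) * ∫ x in (0 : ℝ)..D, (r * x) ^ p * Real.cos (r * x + θ) := by
    rw [← intervalIntegral.integral_const_mul]
    refine intervalIntegral.integral_congr fun x hx => ?_
    rw [uIcc_of_le hD] at hx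
    rw [Real.mul_rpow hr.le hx.1, ← mul_assoc, ← mul_assoc, ← Real.rpow_add hr]
    simp
  rw [h1, h, smul_eq_mul, mul_zero, ← mul_assoc, ← Real.rpow_neg_one r, ← Real.rpow_add hr, abs_mul,
    abs_of_nonneg (Real.rpow_nonneg hr.le _), mul_comm, ← sub_eq_add_neg]
  exact mul_le_mul_of_nonneg_right (abs_integral_rpow_mul_cos_le hp hp0 θ (by positivity))
    (Real.rpow_nonneg hr.le _)

lemma intervalIntegrable_abs_sub_rpow {p : ℝ} (hp : -1 < p) (v a b : ℝ) :
    IntervalIntegrable (fun w => |v - w| ^ p) volume a b := by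
  set M := max |v - a| |v - b|
  have h := integrableOn_abs_rpow hp M
  have hM : 0 ≤ M := (abs_nonneg _).trans (le_max_left _ _)
  have h1 : IntervalIntegrable (fun x : ℝ => |x| ^ p) volume (-M) M := by
    rwa [intervalIntegrable_iff_integrableOn_Icc_of_le (by linarith)]
  have h2 : IntervalIntegrable (fun x : ℝ => |x| ^ p) volume (v - a) (v - b) := by
    refine h1.mono_set ?_
    have ha : |v - a| ≤ M := le_max_left _ _
    have hb : |v - b| ≤ M := le_max_right _ _
    rw [uIcc_of_le (a := -M) (by linarith)]
    refine uIcc_subset_Icc (abs_le.1 ha) (abs_le.1 hb)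
  have := h2.comp_sub_left v
  simpa using this

/-- Cutting at the singularity turns each half into an integral from 0, the form of the bounds
above. -/
lemma integral_abs_sub_rpow_mul {p : ℝ} (hp : -1 < p) {g : ℝ → ℝ} (hg : Continuous g)
    {c v d : ℝ} (hcv : c ≤ v) (hvd : v ≤ d) :
    ∫ w in c..d, |v - w| ^ p * g w =
      (∫ x in (0 : ℝ)..(v - c), x ^ p * g (v - x)) + ∫ x in (0 : ℝ)..(d - v), x ^ p * g (v + x) := by
  have hi : ∀ a b, IntervalIntegrable (fun w => |v - w| ^ p * g w) volume a b := fun a b =>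
    (intervalIntegrable_abs_sub_rpow hp v a b).mul_continuousOn hg.continuousOn
  rw [← intervalIntegral.integral_add_adjacent_intervals (hi c v) (hi v d)]
  congr 1
  · have := intervalIntegral.integral_comp_sub_left (a := c) (b := v) (fun x => |x| ^ p * g (v - x)) v
    simp only [sub_sub_cancel, sub_self] at this
    rw [this]
    refine intervalIntegral.integral_congr fun x hx => ?_
    rw [uIcc_of_le (by linarith)] at hx
    rw [abs_of_nonneg hx.1]
  · have := intervalIntegral.integral_comp_sub_right (a := v) (b := d)
      (fun x => |x| ^ p * g (v + x)) v
    simp only [add_sub_cancel, sub_self] at this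
    simp_rw [abs_sub_comm v]
    rw [this]
    refine intervalIntegral.integral_congr fun x hx => ?_
    rw [uIcc_of_le (by linarith)] at hx
    rw [abs_of_nonneg hx.1]

/-- A Schur-type bound. The inner integral is later estimated in two ways: by absolute values for
short windows, by oscillation for high frequencies. -/
lemma energy_le_of_inner_bound {H : ℝ} (hH : 1 / 2 < H) (hH' : H < 1) {c d : ℝ} (hcd : c ≤ d)
    {A : ℝ → ℂ} (hA : Adm A) {K B : ℝ} (hK : 0 ≤ K) (hAK : ∀ t, ‖A t‖ ≤ K)
    (hsupp : ∀ t ∉ Icc c d, A t = 0)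
    (hB : ∀ t ∈ Icc c d,
      ‖∫ s in Ici (0 : ℝ), (|t - s| ^ (2 * H - 2) : ℝ) • (starRingEnd ℂ) (A s)‖ ≤ B) :
    energy H A ≤ ENNReal.ofReal ((d - c) * (K * B)) := by
  rw [← ofReal_timeIntegral hH.le hH' hA]
  refine ENNReal.ofReal_le_ofReal ((Complex.re_le_norm _).trans ?_)
  unfold timeIntegral
  rw [if_neg hH.ne']
  have h1 : ∀ t, ∫ s in Ici (0 : ℝ), (|t - s| ^ (2 * H - 2) : ℝ) • (A t * (starRingEnd ℂ) (A s)) =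
      A t * ∫ s in Ici (0 : ℝ), (|t - s| ^ (2 * H - 2) : ℝ) • (starRingEnd ℂ) (A s) := by
    intro t
    rw [← integral_const_mul]
    congr 1
    ext s
    rw [mul_smul_comm]
  simp_rw [h1]
  have hB0 : 0 ≤ B := (norm_nonneg _).trans (hB c ⟨le_rfl, hcd⟩)
  calc _ ≤ ∫ t in Ici (0 : ℝ), (Icc c d).indicator (fun _ => K * B) t := by
        refine norm_integral_le_of_norm_le ?_ (Filter.Eventually.of_forall fun t => ?_)
        · exact ((integrable_indicator_iff measurableSet_Icc).2
            (integrableOn_const (by simp))).integrableOn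
        · by_cases ht : t ∈ Icc c d
          · rw [indicator_of_mem ht, norm_mul]
            exact mul_le_mul (hAK t) (hB t ht) (norm_nonneg _) hK
          · rw [indicator_of_notMem ht, hsupp t ht]; simp
    _ ≤ ∫ t, (Icc c d).indicator (fun _ => K * B) t := by
        refine setIntegral_le_integral ((integrable_indicator_iff measurableSet_Icc).2
            (integrableOn_const (by simp))) (Filter.Eventually.of_forall fun t => ?_)
        exact indicator_nonneg (fun _ _ => by positivity) _
    _ = _ := by
        rw [integral_indicator measurableSet_Icc, setIntegral_const, Measure.real,
          Real.volume_Icc, ENNReal.toReal_ofReal (by linarith), smul_eq_mul]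

lemma adm_indicator {c d : ℝ} {g : ℝ → ℂ} (hg : Measurable g) {K : ℝ} (hK : ∀ t, ‖g t‖ ≤ K) :
    Adm ((Ioc c d).indicator g) := by
  refine ⟨hg.indicator measurableSet_Ioc, ⟨K, fun t => (norm_indicator_le_norm_self _ _).trans
    (hK t)⟩, ⟨d, fun t ht => indicator_of_notMem (fun h => absurd h.2 (not_le.2 ht)) _⟩⟩

lemma energy_half_le {c d : ℝ} (hcd : c ≤ d) {A : ℝ → ℂ} {K : ℝ} (hK : 0 ≤ K)
    (hAK : ∀ t, ‖A t‖ ≤ K) (hsupp : ∀ t ∉ Icc c d, A t = 0) :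
    energy (1 / 2) A ≤ ENNReal.ofReal ((d - c) * K ^ 2) := by
  unfold energy
  rw [if_pos rfl]
  calc _ ≤ ∫⁻ t, (Icc c d).indicator (fun _ => ENNReal.ofReal (K ^ 2)) t := by
        refine (setLIntegral_le_lintegral _ _).trans (lintegral_mono fun t => ?_)
        by_cases ht : t ∈ Icc c d
        · rw [indicator_of_mem ht, ENNReal.ofReal_pow hK, ← ofReal_norm]
          gcongr
          exact hAK t
        · simp [hsupp t ht]
    _ = _ := by
        rw [lintegral_indicator measurableSet_Icc, setLIntegral_const, Real.volume_Icc, mul_comm,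
          ← ENNReal.ofReal_mul (by linarith)]

/-- Energy of a bounded function supported in a short interval. -/
lemma energy_le_of_bound {H : ℝ} (hH : 1 / 2 ≤ H) (hH' : H < 1) :
    ∃ C : ℝ, 0 < C ∧ ∀ (c d K : ℝ) (A : ℝ → ℂ), c ≤ d → Measurable A → 0 ≤ K →
      (∀ t, ‖A t‖ ≤ K) → (∀ t ∉ Icc c d, A t = 0) →
      energy H A ≤ ENNReal.ofReal (C * K ^ 2 * (d - c) ^ (2 * H)) := by
  rcases hH.eq_or_lt with h | h
  · subst h
    refine ⟨1, one_pos, fun c d K A hcd hm hK hAK hs => (energy_half_le hcd hK hAK hs).trans_eq ?_⟩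
    congr 1
    norm_num
    ring
  have hp : -1 < 2 * H - 2 := by linarith
  refine ⟨2 / (2 * H - 1), div_pos two_pos (by linarith), fun c d K A hcd hm hK hAK hs => ?_⟩
  have hA : Adm A := ⟨hm, ⟨K, hAK⟩, ⟨d, fun t ht => hs t fun h => absurd h.2 (not_le.2 ht)⟩⟩
  refine (energy_le_of_inner_bound h hH' hcd hA hK hAK hs
    (B := 2 / (2 * H - 1) * K * (d - c) ^ (2 * H - 1)) ?_).trans_eq ?_
  · intro t ht
    calc _ ≤ ∫ s in Ici (0 : ℝ), (Ioc c d).indicator (fun s => K * |t - s| ^ (2 * H - 2)) s := by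
          refine norm_integral_le_of_norm_le (Integrable.integrableOn ?_) ?_
          · rw [integrable_indicator_iff measurableSet_Ioc]
            exact ((intervalIntegrable_abs_sub_rpow hp t c d).const_mul K).1
          · refine ae_restrict_of_ae ?_
            filter_upwards [show ∀ᵐ s : ℝ, s ≠ c from by simp [ae_iff]] with s hs'
            by_cases hsm : s ∈ Ioc c d
            · rw [indicator_of_mem hsm, norm_smul, Real.norm_of_nonneg (by positivity),
                RCLike.norm_conj, mul_comm]
              exact mul_le_mul_of_nonneg_right (hAK s) (by positivity)
            · rw [indicator_of_notMem hsm, hs s fun h => hsm ⟨lt_of_le_of_ne h.1 hs'.symm, h.2⟩]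
              simp
      _ ≤ ∫ s, (Ioc c d).indicator (fun s => K * |t - s| ^ (2 * H - 2)) s := by
          refine setIntegral_le_integral ?_ (Filter.Eventually.of_forall fun t => ?_)
          · rw [integrable_indicator_iff measurableSet_Ioc]
            exact ((intervalIntegrable_abs_sub_rpow hp t c d).const_mul K).1
          · exact indicator_nonneg (fun _ _ => by positivity) _
      _ = K * ∫ s in c..d, |t - s| ^ (2 * H - 2) * 1 := by
          rw [integral_indicator measurableSet_Ioc, integral_const_mul,
            intervalIntegral.integral_of_le hcd]
          simp
      _ ≤ _ := by
          rw [integral_abs_sub_rpow_mul hp continuous_const ht.1 ht.2]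
          have h1 := (le_abs_self _).trans (abs_integral_rpow_mul_le hp
            (g := fun _ => 1) (K := 1) (by simp) (sub_nonneg.2 ht.1))
          have h2 := (le_abs_self _).trans (abs_integral_rpow_mul_le hp
            (g := fun _ => 1) (K := 1) (by simp) (sub_nonneg.2 ht.2))
          rw [show 2 * H - 2 + 1 = 2 * H - 1 by ring, one_mul] at h1 h2
          have h3 : (t - c) ^ (2 * H - 1) ≤ (d - c) ^ (2 * H - 1) :=
            Real.rpow_le_rpow (sub_nonneg.2 ht.1) (by linarith [ht.2]) (by linarith)
          have h4 : (d - t) ^ (2 * H - 1) ≤ (d - c) ^ (2 * H - 1) :=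
            Real.rpow_le_rpow (sub_nonneg.2 ht.2) (by linarith [ht.1]) (by linarith)
          have hpos : 0 < 2 * H - 1 := by linarith
          calc _ ≤ K * ((t - c) ^ (2 * H - 1) / (2 * H - 1) +
                (d - t) ^ (2 * H - 1) / (2 * H - 1)) :=
                mul_le_mul_of_nonneg_left (add_le_add h1 h2) hK
            _ ≤ K * ((d - c) ^ (2 * H - 1) / (2 * H - 1) +
                (d - c) ^ (2 * H - 1) / (2 * H - 1)) := by gcongr
            _ = _ := by ring
  · congr 1
    rcases hcd.eq_or_lt with h0 | h0
    · rw [h0, sub_self, Real.zero_rpow (show 2 * H ≠ 0 by linarith)]; ring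
    · rw [show 2 * H = (2 * H - 1) + 1 by ring, Real.rpow_add_one (by linarith)]
      ring_nf

/-- Energy of a windowed oscillation. -/
lemma energy_cos_le {H : ℝ} (hH : 1 / 2 ≤ H) (hH' : H < 1) :
    ∃ C : ℝ, 0 < C ∧ ∀ (c d r θ : ℝ), 0 ≤ c → c ≤ d → 0 < r →
      energy H ((Ioc c d).indicator fun t => (Real.cos (r * t + θ) : ℂ)) ≤
        ENNReal.ofReal (C * (d - c) * r ^ (1 - 2 * H)) := by
  have hbd : ∀ c d r θ : ℝ, ∀ t,
      ‖(Ioc c d).indicator (fun t => (Real.cos (r * t + θ) : ℂ)) t‖ ≤ 1 := fun c d r θ t =>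
    (norm_indicator_le_norm_self _ _).trans (by
      rw [Complex.norm_real]; exact Real.abs_cos_le_one _)
  have hsupp : ∀ c d r θ : ℝ, ∀ t ∉ Icc c d,
      (Ioc c d).indicator (fun t => (Real.cos (r * t + θ) : ℂ)) t = 0 := fun c d r θ t ht =>
    indicator_of_notMem (fun h => ht (Ioc_subset_Icc_self h)) _
  rcases hH.eq_or_lt with h | h
  · subst h
    refine ⟨1, one_pos, fun c d r θ hc hcd hr =>
      (energy_half_le hcd zero_le_one (hbd c d r θ) (hsupp c d r θ)).trans_eq ?_⟩
    congr 1
    norm_num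
  have hp : -1 < 2 * H - 2 := by linarith
  have hpos : 0 < 2 * H - 1 := by linarith
  set C := 1 / (2 * H - 1) + 3 with hC
  have hC0 : 0 < C := by positivity
  refine ⟨2 * C, by positivity, fun c d r θ hc hcd hr => ?_⟩
  have hA : Adm ((Ioc c d).indicator fun t => (Real.cos (r * t + θ) : ℂ)) :=
    adm_indicator (K := 1) (by fun_prop) fun t => by
      rw [Complex.norm_real]; exact Real.abs_cos_le_one _
  refine (energy_le_of_inner_bound h hH' hcd hA zero_le_one (hbd c d r θ) (hsupp c d r θ)
    (B := 2 * C * r ^ (1 - 2 * H)) ?_).trans_eq ?_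
  · intro t ht
    have h1 : ∀ s, (|t - s| ^ (2 * H - 2) : ℝ) • (starRingEnd ℂ)
        ((Ioc c d).indicator (fun t => (Real.cos (r * t + θ) : ℂ)) s) =
        (Ioc c d).indicator
          (fun s => ((|t - s| ^ (2 * H - 2) * Real.cos (r * s + θ) : ℝ) : ℂ)) s := by
      intro s
      by_cases hs : s ∈ Ioc c d
      · rw [indicator_of_mem hs, indicator_of_mem hs, Complex.conj_ofReal, Complex.real_smul]
        push_cast
        rfl
      · rw [indicator_of_notMem hs, indicator_of_notMem hs]; simp
    simp_rw [h1]
    rw [setIntegral_indicator measurableSet_Ioc,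
      show Ici (0 : ℝ) ∩ Ioc c d = Ioc c d from
        inter_eq_right.2 fun s hs => hc.trans hs.1.le, integral_complex_ofReal, Complex.norm_real,
      ← intervalIntegral.integral_of_le hcd,
      integral_abs_sub_rpow_mul hp (g := fun s => Real.cos (r * s + θ)) (by fun_prop) ht.1 ht.2]
    refine (norm_add_le _ _).trans ?_
    have e1 : ∀ x, Real.cos (r * (t - x) + θ) = Real.cos (r * x + (-(r * t + θ))) := fun x => by
      rw [← Real.cos_neg]; congr 1; ring
    have e2 : ∀ x, Real.cos (r * (t + x) + θ) = Real.cos (r * x + (r * t + θ)) := fun x => by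
      congr 1; ring
    simp_rw [e1, e2, Real.norm_eq_abs]
    have b1 := abs_integral_rpow_mul_cos_mul_le hp (by linarith) hr (-(r * t + θ))
      (sub_nonneg.2 ht.1)
    have b2 := abs_integral_rpow_mul_cos_mul_le hp (by linarith) hr (r * t + θ)
      (sub_nonneg.2 ht.2)
    rw [show 2 * H - 2 + 1 = 2 * H - 1 by ring, show -(2 * H - 2) - 1 = 1 - 2 * H by ring] at b1 b2
    linarith
  · congr 1
    ring

/-! ### Increments of the fundamental solution at a fixed frequency -/

/-- The spectral bound for the energy of increments at distance `δ` and frequency `r`. -/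
def specBound (H δ r : ℝ) : ℝ :=
  if r ≤ 1 then δ ^ 2 else min 1 (δ ^ 2 * r ^ 2) * r ^ (-2 * H - 1)

/-- The phase `e^{-i x·ξ}`. -/
def phase {N : ℕ} (x ξ : E N) : ℂ := Complex.exp (-Complex.I * (inner ℝ x ξ : ℝ))

/-- The time profile `sin((t - s) r) / r` of the fundamental solution, cut at `[0, t]`. -/
def waveTime (t r s : ℝ) : ℂ :=
  (Icc 0 t).indicator (fun s => ((Real.sin ((t - s) * r) / r : ℝ) : ℂ)) s

lemma waveFourier_eq {N : ℕ} (t : ℝ) (x : E N) (s : ℝ) (ξ : E N) :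
    waveFourier t x s ξ = phase x ξ * waveTime t ‖ξ‖ s := by
  unfold waveFourier waveTime phase
  by_cases hs : s ∈ Icc 0 t
  · rw [indicator_of_mem hs, indicator_of_mem hs]
  · rw [indicator_of_notMem hs, indicator_of_notMem hs, mul_zero]

lemma norm_phase {N : ℕ} (x ξ : E N) : ‖phase x ξ‖ = 1 := by
  unfold phase
  rw [show -Complex.I * (inner ℝ x ξ : ℝ) = ((-(inner ℝ x ξ) : ℝ) : ℂ) * Complex.I by
    push_cast; ring]
  exact Complex.norm_exp_ofReal_mul_I _

lemma phase_sub {N : ℕ} (x y ξ : E N) : phase (x - y) ξ * phase y ξ = phase x ξ := by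
  unfold phase
  rw [← Complex.exp_add, inner_sub_left]
  congr 1
  push_cast
  ring

lemma norm_phase_sub_le {N : ℕ} (x y ξ : E N) :
    ‖phase x ξ - phase y ξ‖ ≤ ‖x - y‖ * ‖ξ‖ := by
  have : phase x ξ - phase y ξ = (phase (x - y) ξ - 1) * phase y ξ := by
    rw [sub_mul, phase_sub, one_mul]
  rw [this, norm_mul, norm_phase, mul_one]
  unfold phase
  rw [show -Complex.I * (inner ℝ (x - y) ξ : ℝ) = Complex.I * ((-(inner ℝ (x - y) ξ) : ℝ) : ℂ) by
    push_cast; ring]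
  refine (Real.norm_exp_I_mul_ofReal_sub_one_le).trans ?_
  rw [norm_neg]
  exact norm_inner_le_norm _ _

lemma norm_sin_div_le {t r : ℝ} (hr : 0 < r) : ‖Real.sin (t * r) / r‖ ≤ |t| := by
  rw [norm_div, Real.norm_of_nonneg hr.le, div_le_iff₀ hr]
  refine (Real.abs_sin_le_abs).trans ?_
  rw [abs_mul, abs_of_pos hr]

lemma measurable_waveTime (t r : ℝ) : Measurable (waveTime t r) := by
  unfold waveTime
  exact Measurable.indicator (by fun_prop) measurableSet_Icc

lemma norm_waveTime_le {t r : ℝ} (hr : 0 < r) (s : ℝ) : ‖waveTime t r s‖ ≤ |t| := by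
  unfold waveTime
  by_cases hs : s ∈ Icc 0 t
  · rw [indicator_of_mem hs, Complex.norm_real]
    refine (norm_sin_div_le hr).trans ?_
    rw [abs_of_nonneg (by linarith [hs.2]), abs_of_nonneg (hs.1.trans hs.2)]
    linarith [hs.1]
  · rw [indicator_of_notMem hs]; simp

lemma adm_waveTime (t : ℝ) {r : ℝ} (hr : 0 < r) : Adm (waveTime t r) :=
  ⟨measurable_waveTime t r, ⟨_, norm_waveTime_le hr⟩,
    ⟨t, fun _ hs => indicator_of_notMem (fun h => absurd h.2 (not_le.2 hs)) _⟩⟩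

lemma energy_const_mul_le {H : ℝ} {A : ℝ → ℂ} {B : ℝ} (c : ℂ)
    (h : energy H A ≤ ENNReal.ofReal B) :
    energy H (fun t => c * A t) ≤ ENNReal.ofReal (‖c‖ ^ 2 * B) := by
  rw [energy_const_mul, ENNReal.ofReal_mul (by positivity), ENNReal.ofReal_pow (norm_nonneg _),
    ofReal_norm]
  gcongr

/-- The windowed oscillation. -/
def cosWindow (c d r θ : ℝ) : ℝ → ℂ := (Ioc c d).indicator fun t => (Real.cos (r * t + θ) : ℂ)

lemma adm_cosWindow (c d r θ : ℝ) : Adm (cosWindow c d r θ) :=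
  adm_indicator (K := 1) (by fun_prop) fun t => by
    rw [Complex.norm_real]; exact Real.abs_cos_le_one _

lemma norm_cosWindow_le (c d r θ t : ℝ) : ‖cosWindow c d r θ t‖ ≤ 1 :=
  (norm_indicator_le_norm_self _ _).trans (by
      rw [Complex.norm_real]; exact Real.abs_cos_le_one _)

lemma cosWindow_of_notMem {c d r θ t : ℝ} (ht : t ∉ Icc c d) : cosWindow c d r θ t = 0 :=
  indicator_of_notMem (fun h => ht (Ioc_subset_Icc_self h)) _

lemma sin_eq_cos_phase (t v r : ℝ) :
    Real.sin ((t - v) * r) = Real.cos (r * v + (Real.pi / 2 - t * r)) := by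
  rw [← Real.cos_pi_div_two_sub]; congr 1; ring

/-- The three terms are the change of space point, the change of time on the common window (by the
sum-to-product formula), and the additional window from s to t. Each is a scalar times a windowed
cosine. The half-open windows differ from the closed ones only at v = 0. -/
lemma waveFourier_sub_decomp {N : ℕ} {t s : ℝ} (hst : s ≤ t) (x y ξ : E N) :
    (fun v => waveFourier t x v ξ - waveFourier s y v ξ) =ᵐ[volume.restrict (Ici 0)]
      fun v => ((phase x ξ - phase y ξ) / ‖ξ‖) *
          cosWindow 0 t ‖ξ‖ (Real.pi / 2 - t * ‖ξ‖) v +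
        ((phase y ξ * ((2 * Real.sin ((t - s) * ‖ξ‖ / 2) / ‖ξ‖ : ℝ) : ℂ)) *
          cosWindow 0 s ‖ξ‖ (-((t + s) * ‖ξ‖ / 2)) v +
        (phase y ξ / ‖ξ‖) * cosWindow s t ‖ξ‖ (Real.pi / 2 - t * ‖ξ‖) v) := by
  refine (ae_restrict_iff' measurableSet_Ici).2 ?_
  filter_upwards [show ∀ᵐ s : ℝ, s ≠ 0 from by simp [ae_iff]] with v hv0 hv
  have hv : 0 < v := lt_of_le_of_ne hv hv0.symm
  simp only [waveFourier_eq, waveTime, cosWindow]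
  set r := ‖ξ‖
  by_cases h1 : v ≤ s
  · have h2 : v ≤ t := h1.trans hst
    rw [indicator_of_mem (show v ∈ Icc 0 t from ⟨hv.le, h2⟩),
      indicator_of_mem (show v ∈ Icc 0 s from ⟨hv.le, h1⟩),
      indicator_of_mem (show v ∈ Ioc 0 t from ⟨hv, h2⟩),
      indicator_of_mem (show v ∈ Ioc 0 s from ⟨hv, h1⟩),
      indicator_of_notMem (show v ∉ Ioc s t from fun h => absurd h.1 (not_lt.2 h1)),
      ← sin_eq_cos_phase]
    have : Real.sin ((s - v) * r) = Real.sin ((t - v) * r) -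
        2 * Real.sin ((t - s) * r / 2) * Real.cos (r * v + -((t + s) * r / 2)) := by
      have h := Real.sin_sub_sin ((t - v) * r) ((s - v) * r)
      rw [show ((t - v) * r - (s - v) * r) / 2 = (t - s) * r / 2 by ring,
        show ((t - v) * r + (s - v) * r) / 2 = -(r * v + -((t + s) * r / 2)) by ring,
        Real.cos_neg] at h
      linarith
    rw [this]
    push_cast
    ring
  by_cases h2 : v ≤ t
  · rw [indicator_of_mem (show v ∈ Icc 0 t from ⟨hv.le, h2⟩),
      indicator_of_notMem (show v ∉ Icc 0 s from fun h => h1 h.2),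
      indicator_of_mem (show v ∈ Ioc 0 t from ⟨hv, h2⟩),
      indicator_of_notMem (show v ∉ Ioc 0 s from fun h => h1 h.2),
      indicator_of_mem (show v ∈ Ioc s t from ⟨not_le.1 h1, h2⟩), ← sin_eq_cos_phase]
    push_cast
    ring
  · rw [indicator_of_notMem (show v ∉ Icc 0 t from fun h => h2 h.2),
      indicator_of_notMem (show v ∉ Icc 0 s from fun h => h1 h.2),
      indicator_of_notMem (show v ∉ Ioc 0 t from fun h => h2 h.2),
      indicator_of_notMem (show v ∉ Ioc 0 s from fun h => h1 h.2),
      indicator_of_notMem (show v ∉ Ioc s t from fun h => h2 h.2)]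
    ring

lemma specBound_nonneg (H δ : ℝ) {r : ℝ} (hr : 0 ≤ r) : 0 ≤ specBound H δ r := by
  unfold specBound; split_ifs <;> positivity

/-- Oscillation is useful only for r > 1; at low frequency the bounded length of the window
suffices. -/
lemma norm_sq_mul_cosWindow_le {H : ℝ} (hH : 1 / 2 ≤ H) (hH' : H < 1) {T : ℝ} (hT : 0 < T) :
    ∃ C : ℝ, 0 < C ∧ ∀ (c d r θ : ℝ), 0 ≤ c → c ≤ d → d ≤ T → 0 < r → ∀ z : ℂ,
      energy H (fun v => z * cosWindow c d r θ v) ≤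
        ENNReal.ofReal (C * ‖z‖ ^ 2 * if r ≤ 1 then 1 else r ^ (1 - 2 * H)) := by
  obtain ⟨C₁, h₁, H₁⟩ := energy_le_of_bound hH hH'
  obtain ⟨C₂, h₂, H₂⟩ := energy_cos_le hH hH'
  refine ⟨C₁ * T ^ (2 * H) + C₂ * T, by positivity, fun c d r θ hc hcd hdT hr z => ?_⟩
  split_ifs with h
  · have := energy_const_mul_le z (H₁ c d 1 (cosWindow c d r θ) hcd (adm_cosWindow c d r θ).meas
      zero_le_one (norm_cosWindow_le c d r θ) fun t ht => cosWindow_of_notMem ht)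
    refine this.trans (ENNReal.ofReal_le_ofReal ?_)
    have h3 : (d - c) ^ (2 * H) ≤ T ^ (2 * H) :=
      Real.rpow_le_rpow (by linarith) (by linarith) (by linarith)
    have h4 : C₁ * (d - c) ^ (2 * H) ≤ C₁ * T ^ (2 * H) + C₂ * T := by
      have : 0 ≤ C₂ * T := by positivity
      nlinarith
    calc _ = ‖z‖ ^ 2 * (C₁ * (d - c) ^ (2 * H)) := by ring
      _ ≤ ‖z‖ ^ 2 * (C₁ * T ^ (2 * H) + C₂ * T) := by gcongr
      _ = _ := by ring
  · have := energy_const_mul_le z (H₂ c d r θ hc hcd hr)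
    refine this.trans (ENNReal.ofReal_le_ofReal ?_)
    have h4 : C₂ * (d - c) ≤ C₁ * T ^ (2 * H) + C₂ * T := by
      have : 0 ≤ C₁ * T ^ (2 * H) := by positivity
      nlinarith
    calc _ = ‖z‖ ^ 2 * (C₂ * (d - c)) * r ^ (1 - 2 * H) := by ring
      _ ≤ ‖z‖ ^ 2 * (C₁ * T ^ (2 * H) + C₂ * T) * r ^ (1 - 2 * H) := by gcongr
      _ = _ := by ring

/-- Here z is a phase difference divided by r. It has two bounds, δ by smoothness and 2/r trivially,
and the minimum in `specBound` records the better one. -/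
lemma sq_mul_rpow_le_specBound {H δ r z : ℝ} (hr : 0 < r) (hz0 : 0 ≤ z)
    (hz1 : z ≤ δ) (hz2 : z * r ≤ 2) :
    z ^ 2 * (if r ≤ 1 then 1 else r ^ (1 - 2 * H)) ≤ 4 * specBound H δ r := by
  unfold specBound
  have h1 : z ^ 2 ≤ δ ^ 2 := by gcongr
  split_ifs with h
  · nlinarith [sq_nonneg z]
  · have e : r ^ (1 - 2 * H) = r ^ 2 * r ^ (-2 * H - 1) := by
      rw [show (1 - 2 * H : ℝ) = 2 + (-2 * H - 1) by ring, Real.rpow_add hr]; norm_cast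
    rw [e, ← mul_assoc, ← mul_assoc]
    have : 0 ≤ r ^ (-2 * H - 1) := by positivity
    refine mul_le_mul_of_nonneg_right ?_ this
    rcases min_cases (1 : ℝ) (δ ^ 2 * r ^ 2) with ⟨h3, -⟩ | ⟨h3, -⟩ <;> rw [h3]
    · have : 0 ≤ z * r := by positivity
      nlinarith
    · have := mul_le_mul_of_nonneg_right h1 (sq_nonneg r)
      nlinarith [mul_nonneg (sq_nonneg z) (sq_nonneg r)]

/-- Energy of the short window `(s, t]`. -/
lemma energy_last_window_le {H : ℝ} (hH : 1 / 2 ≤ H) (hH' : H < 1) {T : ℝ} (hT : 0 < T) :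
    ∃ C : ℝ, 0 < C ∧ ∀ (s t r δ : ℝ), 0 ≤ s → s ≤ t → t ≤ T → 0 < r → t - s ≤ δ → ∀ z : ℂ,
      ‖z‖ = 1 → energy H (fun v => z / r * cosWindow s t r (Real.pi / 2 - t * r) v) ≤
        ENNReal.ofReal (C * specBound H δ r) := by
  obtain ⟨C₁, h₁, H₁⟩ := energy_le_of_bound hH hH'
  obtain ⟨C₂, h₂, H₂⟩ := energy_cos_le hH hH'
  refine ⟨C₁ * T ^ (2 * H) + C₁ + C₂ * T, by positivity, fun s t r δ hs hst htT hr hδ z hz => ?_⟩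
  have hT2 : 0 < T ^ (2 * H) := by positivity
  have hts : 0 ≤ t - s := by linarith
  have hA : ∀ v, ‖z / r * cosWindow s t r (Real.pi / 2 - t * r) v‖ ≤ t - s := by
    intro v
    by_cases hv : v ∈ Ioc s t
    · rw [cosWindow, indicator_of_mem hv, ← sin_eq_cos_phase, norm_mul, norm_div, hz,
        Complex.norm_real, Complex.norm_real, Real.norm_of_nonneg hr.le, one_div_mul_eq_div]
      have := norm_sin_div_le (t := t - v) hr
      rw [norm_div, Real.norm_of_nonneg hr.le, abs_of_nonneg (by linarith [hv.2])] at this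
      linarith [hv.1]
    · rw [cosWindow, indicator_of_notMem hv]; simpa using hts
  have hB := H₁ s t (t - s) _ hst ((adm_cosWindow s t r _).const_mul (z / r)).meas hts hA
    fun v hv => by simp [cosWindow_of_notMem hv]
  have hsq : (t - s) ^ 2 ≤ δ ^ 2 := by gcongr
  by_cases h1 : r ≤ 1
  · refine hB.trans (ENNReal.ofReal_le_ofReal ?_)
    unfold specBound
    rw [if_pos h1]
    have h3 : (t - s) ^ (2 * H) ≤ T ^ (2 * H) :=
      Real.rpow_le_rpow (by linarith) (by linarith) (by linarith)
    calc C₁ * (t - s) ^ 2 * (t - s) ^ (2 * H) ≤ C₁ * δ ^ 2 * T ^ (2 * H) := by gcongr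
      _ ≤ _ := by nlinarith [sq_nonneg δ, mul_nonneg (mul_pos h₂ hT).le (sq_nonneg δ)]
  rw [not_le] at h1
  unfold specBound
  rw [if_neg (not_le.2 h1)]
  -- On a window longer than 1/r the oscillatory bound applies. On a shorter one |sin((t-v)r)/r| ≤ t
  -- - s is better.
  by_cases h2 : 1 ≤ (t - s) * r
  · have h3 : min 1 (δ ^ 2 * r ^ 2) = 1 := by
      refine min_eq_left ?_
      have : 1 ≤ δ * r := h2.trans (by gcongr)
      nlinarith
    have := energy_const_mul_le (z / r) (H₂ s t r (Real.pi / 2 - t * r) hs hst hr)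
    refine this.trans (ENNReal.ofReal_le_ofReal ?_)
    rw [h3, one_mul, norm_div, hz, Complex.norm_real, Real.norm_of_nonneg hr.le,
      show (1 - 2 * H : ℝ) = 2 + (-2 * H - 1) by ring, Real.rpow_add hr,
      show r ^ (2 : ℝ) = r ^ 2 by norm_cast]
    have h4 : 0 < r ^ (-2 * H - 1) := by positivity
    calc _ = C₂ * (t - s) * r ^ (-2 * H - 1) := by field_simp
      _ ≤ (C₁ * T ^ (2 * H) + C₁ + C₂ * T) * r ^ (-2 * H - 1) := by
        refine mul_le_mul_of_nonneg_right ?_ h4.le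
        nlinarith [mul_pos h₁ hT2]
  · rw [not_le] at h2
    refine hB.trans (ENNReal.ofReal_le_ofReal ?_)
    have h3 : (t - s) ^ (2 * H) ≤ r ^ (-2 * H) := by
      rw [neg_mul, Real.rpow_neg hr.le, ← Real.inv_rpow hr.le]
      refine Real.rpow_le_rpow hts ?_ (by linarith)
      rw [← one_div, le_div_iff₀ hr]; exact h2.le
    have h4 : r ^ (-2 * H) = r * r ^ (-2 * H - 1) := by
      rw [Real.rpow_sub_one hr.ne']; field_simp
    have h5 : 0 < r ^ (-2 * H - 1) := by positivity
    have h6 : (t - s) ^ 2 * r ≤ min 1 (δ ^ 2 * r ^ 2) := by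
      have h7 : (t - s) ^ 2 * r ≤ (t - s) ^ 2 * r ^ 2 := by
        gcongr; nlinarith
      refine le_min (h7.trans ?_) (h7.trans (by gcongr))
      rw [← mul_pow]
      exact pow_le_one₀ (by positivity) h2.le
    calc C₁ * (t - s) ^ 2 * (t - s) ^ (2 * H)
        ≤ C₁ * (t - s) ^ 2 * r ^ (-2 * H) := by gcongr
      _ = C₁ * ((t - s) ^ 2 * r) * r ^ (-2 * H - 1) := by rw [h4]; ring
      _ ≤ C₁ * min 1 (δ ^ 2 * r ^ 2) * r ^ (-2 * H - 1) := by gcongr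
      _ ≤ (C₁ * T ^ (2 * H) + C₁ + C₂ * T) * (min 1 (δ ^ 2 * r ^ 2) * r ^ (-2 * H - 1)) := by
        rw [← mul_assoc]
        gcongr
        nlinarith [mul_pos h₁ hT2, mul_pos h₂ hT]

/-- The first two pieces have small amplitude. In the last one the coefficient 1/r is not small in δ
but the window is short, so it needs its own estimate. -/
lemma energy_waveFourier_sub_le_aux {H : ℝ} (hH : 1 / 2 ≤ H) (hH' : H < 1) {T : ℝ} (hT : 0 < T) :
    ∃ C : ℝ, 0 < C ∧ ∀ (N : ℕ) (t s : ℝ) (x y ξ : E N), 0 ≤ s → s ≤ t → t ≤ T → ξ ≠ 0 →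
      energy H (fun v => waveFourier t x v ξ - waveFourier s y v ξ) ≤
        ENNReal.ofReal (C * specBound H (rho (t, x) (s, y)) ‖ξ‖) := by
  obtain ⟨C₁, h₁, H₁⟩ := norm_sq_mul_cosWindow_le hH hH' hT
  obtain ⟨C₂, h₂, H₂⟩ := energy_last_window_le hH hH' hT
  refine ⟨24 * C₁ + 4 * C₂, by positivity, fun N t s x y ξ hs hst htT hξ => ?_⟩
  have hr : 0 < ‖ξ‖ := norm_pos_iff.2 hξ
  rw [energy_congr_ae (waveFourier_sub_decomp hst x y ξ)]
  set r := ‖ξ‖ with hrdef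
  set δ := rho (t, x) (s, y) with hδ
  have hδ1 : t - s ≤ δ := by
    rw [hδ, rho]; exact (le_abs_self _).trans (le_add_of_nonneg_right (norm_nonneg _))
  have hδ2 : ‖x - y‖ ≤ δ := by
    rw [hδ, rho]; exact le_add_of_nonneg_left (abs_nonneg _)
  have hS := specBound_nonneg H δ hr.le
  set z₁ : ℂ := (phase x ξ - phase y ξ) / r
  set z₂ : ℂ := phase y ξ * ((2 * Real.sin ((t - s) * r / 2) / r : ℝ) : ℂ)
  have hz₁ : ‖z₁‖ * r = ‖phase x ξ - phase y ξ‖ := by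
    simp only [z₁, norm_div, Complex.norm_real, Real.norm_of_nonneg hr.le]; field_simp
  have hz₂ : ‖z₂‖ * r = 2 * |Real.sin ((t - s) * r / 2)| := by
    simp only [z₂, norm_mul, norm_phase, Complex.norm_real, norm_div, Real.norm_of_nonneg hr.le,
      Real.norm_eq_abs, abs_two]
    field_simp
  have b1 := H₁ 0 t r (Real.pi / 2 - t * r) le_rfl (hs.trans hst) htT hr z₁
  have b2 := H₁ 0 s r (-((t + s) * r / 2)) le_rfl hs (hst.trans htT) hr z₂
  have b3 := H₂ s t r δ hs hst htT hr hδ1 (phase y ξ) (norm_phase _ _)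
  have c1 := sq_mul_rpow_le_specBound (H := H) (δ := δ) hr (norm_nonneg z₁)
    (by
      refine le_of_mul_le_mul_right ?_ hr
      rw [hz₁]
      exact (norm_phase_sub_le x y ξ).trans (mul_le_mul_of_nonneg_right hδ2 hr.le))
    (by
      rw [hz₁]
      refine (norm_sub_le _ _).trans ?_
      rw [norm_phase, norm_phase]; norm_num)
  have c2 := sq_mul_rpow_le_specBound (H := H) (δ := δ) hr (norm_nonneg z₂)
    (by
      refine le_of_mul_le_mul_right ?_ hr
      rw [hz₂]
      have : |Real.sin ((t - s) * r / 2)| ≤ (t - s) * r / 2 := by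
        refine (Real.abs_sin_le_abs).trans_eq (abs_of_nonneg ?_)
        have : 0 ≤ t - s := by linarith
        positivity
      nlinarith)
    (by rw [hz₂]; linarith [Real.abs_sin_le_one ((t - s) * r / 2)])
  refine (energy_add_le H ((adm_cosWindow _ _ _ _).const_mul _)
    (((adm_cosWindow _ _ _ _).const_mul _).add ((adm_cosWindow _ _ _ _).const_mul _))).trans ?_
  have h23 := energy_add_le H ((adm_cosWindow 0 s r (-((t + s) * r / 2))).const_mul z₂)
    ((adm_cosWindow s t r (Real.pi / 2 - t * r)).const_mul (phase y ξ / r))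
  have b1' : energy H (fun v => z₁ * cosWindow 0 t r (Real.pi / 2 - t * r) v) ≤
      ENNReal.ofReal (4 * C₁ * specBound H δ r) :=
    b1.trans (ENNReal.ofReal_le_ofReal (by rw [mul_assoc]; nlinarith))
  have b2' : energy H (fun v => z₂ * cosWindow 0 s r (-((t + s) * r / 2)) v) ≤
      ENNReal.ofReal (4 * C₁ * specBound H δ r) :=
    b2.trans (ENNReal.ofReal_le_ofReal (by rw [mul_assoc]; nlinarith))
  calc _ ≤ 2 * ENNReal.ofReal (4 * C₁ * specBound H δ r) +
        2 * (2 * ENNReal.ofReal (4 * C₁ * specBound H δ r) +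
          2 * ENNReal.ofReal (C₂ * specBound H δ r)) := by
        gcongr
        refine h23.trans ?_
        gcongr
    _ = _ := by
        rw [show (2 : ℝ≥0∞) = ENNReal.ofReal 2 by norm_num]
        simp only [← ENNReal.ofReal_mul (show (0 : ℝ) ≤ 2 by norm_num)]
        rw [← ENNReal.ofReal_add (by positivity) (by positivity),
          ← ENNReal.ofReal_mul (by norm_num), ← ENNReal.ofReal_add (by positivity) (by positivity)]
        congr 1
        ring

lemma rho_comm {N : ℕ} (p q : ℝ × E N) : rho p q = rho q p := by
  unfold rho; rw [abs_sub_comm, norm_sub_rev]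

lemma rho_nonneg {N : ℕ} (p q : ℝ × E N) : 0 ≤ rho p q := by unfold rho; positivity

lemma energy_waveFourier_sub_le {H : ℝ} (hH : 1 / 2 ≤ H) (hH' : H < 1) {T : ℝ} (hT : 0 < T) :
    ∃ C : ℝ, 0 < C ∧ ∀ (N : ℕ) (t s : ℝ) (x y ξ : E N), 0 ≤ s → 0 ≤ t → s ≤ T → t ≤ T → ξ ≠ 0 →
      energy H (fun v => waveFourier t x v ξ - waveFourier s y v ξ) ≤
        ENNReal.ofReal (C * specBound H (rho (t, x) (s, y)) ‖ξ‖) := by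
  obtain ⟨C, hC, h⟩ := energy_waveFourier_sub_le_aux hH hH' hT
  refine ⟨C, hC, fun N t s x y ξ hs ht hsT htT hξ => ?_⟩
  rcases le_total s t with hst | hst
  · exact h N t s x y ξ hs hst htT hξ
  · have h1 := energy_const_mul H (fun v => waveFourier s y v ξ - waveFourier t x v ξ) (-1)
    simp only [neg_mul, one_mul, neg_sub, enorm_neg, enorm_one, one_pow] at h1
    rw [h1, rho_comm]
    exact h N s t y x ξ ht hst hsT hξ

/-! ### Spectral integrals -/

lemma nontrivial_E {N : ℕ} (hN : 0 < N) : Nontrivial (E N) := by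
  have : Nonempty (Fin N) := ⟨⟨0, hN⟩⟩
  infer_instance

lemma ae_ne_zero {N : ℕ} (hN : 0 < N) : ∀ᵐ ξ : E N, ξ ≠ 0 := by
  have := nontrivial_E hN
  simp [ae_iff]

/-- In polar coordinates the Jacobian turns the exponents a - N and -b - N into a - 1 and -b - 1. -/
lemma integrable_of_radial_bound {N : ℕ} (hN : 0 < N) {F : Type*} [NormedAddCommGroup F]
    {g : E N → F} (hg : AEStronglyMeasurable g) {a b C : ℝ} (ha : 0 < a) (hb : 0 < b)
    (h1 : ∀ ξ : E N, 0 < ‖ξ‖ → ‖ξ‖ ≤ 1 → ‖g ξ‖ ≤ C * ‖ξ‖ ^ (a - N))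
    (h2 : ∀ ξ : E N, 1 < ‖ξ‖ → ‖g ξ‖ ≤ C * ‖ξ‖ ^ (-b - N)) : Integrable g := by
  have := nontrivial_E hN
  set f : ℝ → ℝ := fun y => if y ≤ 1 then C * y ^ (a - N) else C * y ^ (-b - N) with hf
  have hfi : Integrable (fun ξ : E N => f ‖ξ‖) := by
    rw [integrable_fun_norm_addHaar volume (f := f), finrank_euclideanSpace_fin,
      ← Ioc_union_Ioi_eq_Ioi zero_le_one, integrableOn_union]
    have key : ∀ (y : ℝ) (e : ℝ), 0 < y → y ^ (N - 1) • (C * y ^ (e - N)) = C * y ^ (e - 1) := by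
      intro y e hy
      rw [smul_eq_mul, ← Real.rpow_natCast, mul_left_comm, ← Real.rpow_add hy]
      congr 2
      rw [Nat.cast_sub hN]
      push_cast
      ring
    constructor
    · have h3 : IntegrableOn (fun y : ℝ => C * y ^ (a - 1)) (Ioc 0 1) :=
        ((intervalIntegral.intervalIntegrable_rpow' (a := 0) (b := 1)
          (show -1 < a - 1 by linarith)).const_mul C).1
      refine h3.congr_fun (fun y hy => ?_) measurableSet_Ioc
      simp only [hf, if_pos hy.2]
      exact (key y a hy.1).symm
    · have h3 : IntegrableOn (fun y : ℝ => C * y ^ (-b - 1)) (Ioi 1) :=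
        (integrableOn_Ioi_rpow_of_lt (show -b - 1 < -1 by linarith) one_pos).const_mul C
      refine h3.congr_fun (fun y hy => ?_) measurableSet_Ioi
      have hy : 1 < y := hy
      simp only [hf, if_neg (not_le.2 hy)]
      exact (key y (-b) (by linarith)).symm
  refine hfi.mono' hg ?_
  filter_upwards [ae_ne_zero hN] with ξ hξ
  simp only [hf]
  split_ifs with h
  · exact h1 ξ (norm_pos_iff.2 hξ) h
  · exact h2 ξ (not_le.1 h)

/-- Frequencies up to 1 contribute δ² ∫ |ξ|^{-β}, finite since β < N. Above 1, the substitution η =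
δξ extracts δ^γ and leaves min(1, |η|²) |η|^{-γ-N}, integrable exactly when 0 < γ < 2, which is what
`hβH` says. Since γ < 2, δ² is absorbed into δ^γ for δ ≤ D. -/
lemma lintegral_specBound_le {N : ℕ} {H β : ℝ} (hβ : β < N)
    (hβH : (N : ℝ) - 2 * H - 1 < β ∧ β < (N : ℝ) - 2 * H + 1) (hN : 0 < N) {D : ℝ} (hD : 0 < D) :
    ∃ C : ℝ, 0 < C ∧ ∀ δ : ℝ, 0 ≤ δ → δ ≤ D →
      ∫⁻ ξ : E N, ENNReal.ofReal (specBound H δ ‖ξ‖ * ‖ξ‖ ^ (-β)) ≤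
        ENNReal.ofReal (C * δ ^ (2 * H + 1 - N + β)) := by
  set γ := 2 * H + 1 - N + β with hγ
  have hγ0 : 0 < γ := by rw [hγ]; linarith [hβH.1]
  have hγ2 : γ < 2 := by rw [hγ]; linarith [hβH.2]
  set g₁ : E N → ℝ := fun ξ => if ‖ξ‖ ≤ 1 then ‖ξ‖ ^ (-β) else 0 with hg₁
  set g₂ : E N → ℝ := fun ξ => min 1 (‖ξ‖ ^ 2) * ‖ξ‖ ^ (-γ - N) with hg₂
  have hi₁ : Integrable g₁ := by
    refine integrable_of_radial_bound hN (C := 1) (a := N - β) (b := 1) ?_ (by linarith) one_pos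
      (fun ξ h0 h1 => ?_) (fun ξ h0 => ?_)
    · refine Measurable.aestronglyMeasurable ?_
      exact Measurable.ite (measurableSet_le (by fun_prop) (by fun_prop)) (by fun_prop)
        measurable_const
    · simp only [hg₁, if_pos h1]
      rw [Real.norm_of_nonneg (by positivity), one_mul]
      exact le_of_eq (by congr 1; ring)
    · simp only [hg₁, if_neg (not_le.2 h0), norm_zero]
      positivity
  have hi₂ : Integrable g₂ := by
    refine integrable_of_radial_bound hN (C := 1) (a := 2 - γ) (b := γ) (by fun_prop)
      (by linarith) hγ0 (fun ξ h0 h1 => ?_) (fun ξ h0 => ?_)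
    · simp only [hg₂]
      rw [Real.norm_of_nonneg (by positivity), one_mul, show 2 - γ - N = 2 + (-γ - N) by ring,
        Real.rpow_add h0, Real.rpow_two]
      gcongr
      exact min_le_right _ _
    · simp only [hg₂]
      rw [Real.norm_of_nonneg (by positivity)]
      gcongr
      exact min_le_left _ _
  have hp₁ : 0 ≤ ∫ ξ, g₁ ξ := integral_nonneg fun ξ => by
    simp only [hg₁]; split_ifs <;> positivity
  have hp₂ : 0 ≤ ∫ ξ, g₂ ξ := integral_nonneg fun ξ => by simp only [hg₂]; positivity
  refine ⟨D ^ (2 - γ) * (∫ ξ, g₁ ξ) + (∫ ξ, g₂ ξ) + 1, by positivity, fun δ hδ hδD => ?_⟩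
  rcases hδ.eq_or_lt with rfl | hδ0
  · have : ∀ ξ : E N, specBound H 0 ‖ξ‖ = 0 := by
      intro ξ; unfold specBound; split_ifs <;> simp
    simp [this]
  have hbound : ∀ ξ : E N, ξ ≠ 0 → specBound H δ ‖ξ‖ * ‖ξ‖ ^ (-β) ≤
      δ ^ 2 * g₁ ξ + δ ^ (γ + N) * g₂ (δ • ξ) := by
    intro ξ hξ
    have hr : 0 < ‖ξ‖ := norm_pos_iff.2 hξ
    have h0 : 0 ≤ δ ^ (γ + N) * g₂ (δ • ξ) := by simp only [hg₂]; positivity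
    unfold specBound
    split_ifs with h
    · simp only [hg₁, if_pos h]; linarith
    · simp only [hg₁, if_neg h, mul_zero, zero_add, hg₂, norm_smul, Real.norm_of_nonneg hδ0.le]
      rw [Real.mul_rpow hδ0.le hr.le, mul_pow, mul_left_comm, ← mul_assoc (δ ^ (γ + N)),
        ← Real.rpow_add hδ0, mul_assoc, ← Real.rpow_add hr]
      rw [show γ + N + (-γ - N) = 0 by ring, Real.rpow_zero, one_mul]
      apply le_of_eq
      congr 2
      rw [hγ]; ring
  have hs : Integrable fun ξ => g₂ (δ • ξ) := hi₂.comp_smul hδ0.ne'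
  calc _ ≤ ∫⁻ ξ : E N, ENNReal.ofReal (δ ^ 2 * g₁ ξ + δ ^ (γ + N) * g₂ (δ • ξ)) := by
        refine lintegral_mono_ae ?_
        filter_upwards [ae_ne_zero hN] with ξ hξ
        exact ENNReal.ofReal_le_ofReal (hbound ξ hξ)
    _ = ENNReal.ofReal (∫ ξ, (δ ^ 2 * g₁ ξ + δ ^ (γ + N) * g₂ (δ • ξ))) := by
        refine (ofReal_integral_eq_lintegral_ofReal
          ((hi₁.const_mul _).add (hs.const_mul _)) (Filter.Eventually.of_forall fun ξ => ?_)).symm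
        simp only [hg₁, hg₂, Pi.zero_apply, Pi.add_apply]
        split_ifs <;> positivity
    _ ≤ _ := by
        refine ENNReal.ofReal_le_ofReal ?_
        rw [integral_add (hi₁.const_mul _) (hs.const_mul _), integral_const_mul,
          integral_const_mul, Measure.integral_comp_smul, finrank_euclideanSpace_fin, smul_eq_mul,
          abs_of_nonneg (by positivity), ← mul_assoc]
        have e1 : δ ^ (γ + N) * (δ ^ N)⁻¹ = δ ^ γ := by
          rw [Real.rpow_add hδ0, Real.rpow_natCast]; field_simp
        have e2 : δ ^ 2 ≤ D ^ (2 - γ) * δ ^ γ := by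
          have : δ ^ 2 = δ ^ (2 - γ) * δ ^ γ := by
            rw [← Real.rpow_add hδ0]; norm_num
          rw [this]
          have : δ ^ (2 - γ) ≤ D ^ (2 - γ) := Real.rpow_le_rpow hδ hδD (by linarith)
          gcongr
        rw [e1]
        have hδγ : 0 < δ ^ γ := by positivity
        have := mul_le_mul_of_nonneg_right e2 hp₁
        nlinarith

lemma IsSpatialCovariance.nonneg {N : ℕ} {β : ℝ} {f h : E N → ℝ}
    (hf : IsSpatialCovariance β f h) : ∀ᵐ ξ, 0 ≤ h ξ := by
  obtain ⟨C₁, C₂, h1, -, h3⟩ := hf.comparable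
  filter_upwards [h3] with ξ hξ
  exact le_trans (by positivity) hξ.1

lemma hpNormSq_eq {N : ℕ} {H : ℝ} (hH : 1 / 2 ≤ H) (hH' : H < 1) {h : E N → ℝ}
    (hh : ∀ᵐ ξ, 0 ≤ h ξ) {A : ℝ → E N → ℂ} (hA : ∀ᵐ ξ, Adm fun s => A s ξ) :
    hpNormSq H h A = ∫⁻ ξ, energy H (fun s => A s ξ) * ENNReal.ofReal (h ξ) := by
  unfold hpNormSq
  refine lintegral_congr_ae ?_
  filter_upwards [hh, hA] with ξ h1 h2
  rw [ENNReal.ofReal_mul' h1, ofReal_timeIntegral hH hH' h2]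

lemma adm_waveFourier {N : ℕ} (t : ℝ) (x : E N) {ξ : E N} (hξ : ξ ≠ 0) :
    Adm fun s => waveFourier t x s ξ := by
  simp_rw [waveFourier_eq]
  exact (adm_waveTime t (norm_pos_iff.2 hξ)).const_mul _

/-- The canonical metric of the solution is at most `ρ^α`. -/
theorem hpNormSq_waveFourier_sub_le {N : ℕ} {H β : ℝ} (hH : 1 / 2 ≤ H ∧ H < 1) (hβ : 0 < β ∧ β < N)
    (hβH : (N : ℝ) - 2 * H - 1 < β ∧ β < (N : ℝ) - 2 * H + 1) {f h : E N → ℝ}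
    (hf : IsSpatialCovariance β f h) {T D : ℝ} (hT : 0 < T) (hD : 0 < D) :
    ∃ C : ℝ, 0 < C ∧ ∀ (t s : ℝ) (x y : E N), 0 ≤ s → 0 ≤ t → s ≤ T → t ≤ T →
      rho (t, x) (s, y) ≤ D →
      hpNormSq H h (fun v ξ => waveFourier t x v ξ - waveFourier s y v ξ) ≤
        ENNReal.ofReal (C * rho (t, x) (s, y) ^ (2 * H + 1 - N + β)) := by
  have hN : 0 < N := by
    have : (0 : ℝ) < N := hβ.1.trans hβ.2
    exact_mod_cast this
  obtain ⟨C₁, h₁, H₁⟩ := energy_waveFourier_sub_le hH.1 hH.2 hT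
  obtain ⟨C₂, h₂, H₂⟩ := lintegral_specBound_le hβ.2 hβH hN hD
  obtain ⟨c₁, c₂, hc₁, hc₂, hc⟩ := hf.comparable
  refine ⟨C₁ * c₂ * C₂, by positivity, fun t s x y hs ht hsT htT hρ => ?_⟩
  rw [hpNormSq_eq hH.1 hH.2 hf.nonneg]
  · calc _ ≤ ∫⁻ ξ : E N, ENNReal.ofReal (C₁ * c₂) * ENNReal.ofReal
          (specBound H (rho (t, x) (s, y)) ‖ξ‖ * ‖ξ‖ ^ (-β)) := by
          refine lintegral_mono_ae ?_
          filter_upwards [hc, ae_ne_zero hN] with ξ h1 h2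
          have hS := specBound_nonneg H (rho (t, x) (s, y)) (norm_nonneg ξ)
          calc _ ≤ ENNReal.ofReal (C₁ * specBound H (rho (t, x) (s, y)) ‖ξ‖) *
                ENNReal.ofReal (c₂ * ‖ξ‖ ^ (-β)) := by
                gcongr
                · exact H₁ N t s x y ξ hs ht hsT htT h2
                · exact h1.2
            _ = _ := by
                rw [← ENNReal.ofReal_mul (by positivity), ← ENNReal.ofReal_mul (by positivity)]
                congr 1
                ring
      _ ≤ ENNReal.ofReal (C₁ * c₂) *
          ENNReal.ofReal (C₂ * rho (t, x) (s, y) ^ (2 * H + 1 - N + β)) := by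
          rw [lintegral_const_mul' _ _ ENNReal.ofReal_ne_top]
          gcongr
          exact H₂ _ (rho_nonneg _ _) hρ
      _ = _ := by
          rw [← ENNReal.ofReal_mul (by positivity)]
          congr 1
          ring
  · filter_upwards [ae_ne_zero hN] with ξ hξ
    exact (adm_waveFourier t x hξ).sub (adm_waveFourier s y hξ)

/-! ### Lower bounds by duality -/

/-- A smooth switch-on: η cos solves the wave equation from rest with a source living in [0, a]. The
source involves η'' and the duality estimate differentiates it once, hence three derivatives. -/
lemma exists_cutoff {a : ℝ} (ha : 0 < a) : ∃ (η η₁ η₂ η₃ : ℝ → ℝ) (K : ℝ), 0 < K ∧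
    (∀ t, HasDerivAt η (η₁ t) t) ∧ (∀ t, HasDerivAt η₁ (η₂ t) t) ∧
    (∀ t, HasDerivAt η₂ (η₃ t) t) ∧ Continuous η₃ ∧ η 0 = 0 ∧ η₁ 0 = 0 ∧ (∀ t, a ≤ t → η t = 1) ∧
    (∀ t ∉ Icc 0 a, η₁ t = 0 ∧ η₂ t = 0 ∧ η₃ t = 0) ∧
    ∀ t, |η₁ t| ≤ K ∧ |η₂ t| ≤ K ∧ |η₃ t| ≤ K := by
  set η : ℝ → ℝ := fun t => Real.smoothTransition (t / a) with hη
  have hs : ContDiff ℝ 4 η := Real.smoothTransition.contDiff.comp (by fun_prop)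
  have hs1 : ContDiff ℝ 3 (deriv η) :=
    (contDiff_succ_iff_deriv.1 (show ContDiff ℝ (3 + 1) η from hs)).2.2
  have hs2 : ContDiff ℝ 2 (deriv (deriv η)) :=
    (contDiff_succ_iff_deriv.1 (show ContDiff ℝ (2 + 1) _ from hs1)).2.2
  have hs3 : ContDiff ℝ 1 (deriv (deriv (deriv η))) :=
    (contDiff_succ_iff_deriv.1 (show ContDiff ℝ (1 + 1) _ from hs2)).2.2
  have hz : ∀ g : ℝ → ℝ, (∃ c, ∀ t < 0, g t = c) → (∃ c, ∀ t, a < t → g t = c) →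
      ∀ t ∉ Icc 0 a, deriv g t = 0 := by
    rintro g ⟨c, hc⟩ ⟨c', hc'⟩ t ht
    by_cases h0 : t < 0
    · have : g =ᶠ[𝓝 t] fun _ => c := by
        filter_upwards [Iio_mem_nhds h0] with s hs using hc s hs
      rw [this.deriv_eq, deriv_const]
    · have h1 : a < t := by
        by_contra h1
        exact ht ⟨not_lt.1 h0, not_lt.1 h1⟩
      have : g =ᶠ[𝓝 t] fun _ => c' := by
        filter_upwards [Ioi_mem_nhds h1] with s hs using hc' s hs
      rw [this.deriv_eq, deriv_const]
  have hmem : ∀ t, t < 0 → t ∉ Icc 0 a := fun t h h' => absurd h'.1 (not_le.2 h)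
  have hmem' : ∀ t, a < t → t ∉ Icc 0 a := fun t h h' => absurd h'.2 (not_le.2 h)
  have h1 : ∀ t ∉ Icc 0 a, deriv η t = 0 := by
    refine hz η ⟨0, fun t ht => ?_⟩ ⟨1, fun t ht => ?_⟩
    · exact Real.smoothTransition.zero_of_nonpos (div_nonpos_of_nonpos_of_nonneg ht.le ha.le)
    · exact Real.smoothTransition.one_of_one_le ((one_le_div ha).2 ht.le)
  have h2 := hz (deriv η) ⟨0, fun t ht => h1 t (hmem t ht)⟩ ⟨0, fun t ht => h1 t (hmem' t ht)⟩
  have h3 := hz (deriv (deriv η)) ⟨0, fun t ht => h2 t (hmem t ht)⟩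
    ⟨0, fun t ht => h2 t (hmem' t ht)⟩
  have hb : ∀ g : ℝ → ℝ, Continuous g → (∀ t ∉ Icc 0 a, g t = 0) → ∃ K, ∀ t, |g t| ≤ K := by
    intro g hg h0
    obtain ⟨K, hK⟩ := (isCompact_Icc (a := 0) (b := a)).exists_bound_of_continuousOn hg.continuousOn
    refine ⟨max K 0, fun t => ?_⟩
    by_cases ht : t ∈ Icc 0 a
    · exact (hK t ht).trans (le_max_left _ _)
    · rw [h0 t ht, abs_zero]; exact le_max_right _ _
  obtain ⟨K₁, hK₁⟩ := hb _ hs1.continuous h1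
  obtain ⟨K₂, hK₂⟩ := hb _ hs2.continuous h2
  obtain ⟨K₃, hK₃⟩ := hb _ hs3.continuous h3
  have hη0 : η 0 = 0 := by simp [hη]
  refine ⟨η, deriv η, deriv (deriv η), deriv (deriv (deriv η)), max (max K₁ K₂) (max K₃ 1),
    ?_, fun t => (hs.differentiable (by norm_num) t).hasDerivAt,
    fun t => (hs1.differentiable (by norm_num) t).hasDerivAt,
    fun t => (hs2.differentiable (by norm_num) t).hasDerivAt, hs3.continuous, hη0, ?_, ?_,
    fun t ht => ⟨h1 t ht, h2 t ht, h3 t ht⟩, fun t => ⟨?_, ?_, ?_⟩⟩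
  · exact lt_of_lt_of_le one_pos ((le_max_right K₃ 1).trans (le_max_right _ _))
  · refine IsLocalMin.deriv_eq_zero (Filter.Eventually.of_forall fun t => ?_)
    rw [hη0]
    exact Real.smoothTransition.nonneg _
  · exact fun t ht => Real.smoothTransition.one_of_one_le ((one_le_div ha).2 ht)
  · exact (hK₁ t).trans ((le_max_left _ _).trans (le_max_left _ _))
  · exact (hK₂ t).trans ((le_max_right _ _).trans (le_max_left _ _))
  · exact (hK₃ t).trans ((le_max_left _ _).trans (le_max_right _ _))

/-- Duhamel's formula for the source `q = η'' cos((s - t₀) r) - 2 r η' sin((s - t₀) r)`. -/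
lemma integral_waveTime_mul {η η₁ η₂ : ℝ → ℝ} (h0 : ∀ t, HasDerivAt η (η₁ t) t)
    (h1 : ∀ t, HasDerivAt η₁ (η₂ t) t) (h2 : Continuous η₂) (hz : η 0 = 0) (hz1 : η₁ 0 = 0)
    {t r : ℝ} (ht : 0 ≤ t) (hr : 0 < r) (t₀ : ℝ) :
    ∫ s in Ici (0 : ℝ), waveTime t r s *
      ((η₂ s * Real.cos ((s - t₀) * r) - 2 * r * η₁ s * Real.sin ((s - t₀) * r) : ℝ) : ℂ) =
      ((η t * Real.cos ((t - t₀) * r) : ℝ) : ℂ) := by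
  have c0 : Continuous η := continuous_iff_continuousAt.2 fun t => (h0 t).continuousAt
  have c1 : Continuous η₁ := continuous_iff_continuousAt.2 fun t => (h1 t).continuousAt
  set q : ℝ → ℝ := fun s =>
    η₂ s * Real.cos ((s - t₀) * r) - 2 * r * η₁ s * Real.sin ((s - t₀) * r) with hq
  have e : ∀ s, waveTime t r s * (q s : ℂ) =
      (Icc 0 t).indicator (fun s => ((Real.sin ((t - s) * r) / r * q s : ℝ) : ℂ)) s := by
    intro s
    unfold waveTime
    by_cases hs : s ∈ Icc 0 t
    · rw [indicator_of_mem hs, indicator_of_mem hs]; push_cast; rfl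
    · rw [indicator_of_notMem hs, indicator_of_notMem hs, zero_mul]
  have hcos : ∀ s, HasDerivAt (fun s => Real.cos ((s - t₀) * r))
      (-(r * Real.sin ((s - t₀) * r))) s := fun s => by
    have := (((hasDerivAt_id s).sub_const t₀).mul_const r).cos
    refine this.congr_deriv ?_
    simp only [id_eq]
    ring
  have hsin : ∀ s, HasDerivAt (fun s => Real.sin ((s - t₀) * r))
      (r * Real.cos ((s - t₀) * r)) s := fun s => by
    have := (((hasDerivAt_id s).sub_const t₀).mul_const r).sin
    refine this.congr_deriv ?_
    simp only [id_eq]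
    ring
  have hcos' : ∀ s, HasDerivAt (fun s => Real.cos ((t - s) * r))
      (r * Real.sin ((t - s) * r)) s := fun s => by
    have := (((hasDerivAt_id s).const_sub t).mul_const r).cos
    refine this.congr_deriv ?_
    simp only [id_eq]
    ring
  have hsin' : ∀ s, HasDerivAt (fun s => Real.sin ((t - s) * r))
      (-(r * Real.cos ((t - s) * r))) s := fun s => by
    have := (((hasDerivAt_id s).const_sub t).mul_const r).sin
    refine this.congr_deriv ?_
    simp only [id_eq]
    ring
  change ∫ s in Ici (0 : ℝ), waveTime t r s * (q s : ℂ) = _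
  simp_rw [e]
  rw [setIntegral_indicator measurableSet_Icc,
    show Ici (0 : ℝ) ∩ Icc 0 t = Icc 0 t from inter_eq_right.2 fun s hs => hs.1,
    integral_complex_ofReal, integral_Icc_eq_integral_Ioc, ← intervalIntegral.integral_of_le ht]
  congr 1
  -- With w = η cos((s-t₀)r), this antiderivative is sin((t-s)r)/r · w' + cos((t-s)r) · w; its
  -- derivative is sin((t-s)r)/r · (w'' + r²w).
  rw [intervalIntegral.integral_eq_sub_of_hasDerivAt (f := fun s =>
    Real.sin ((t - s) * r) / r * (η₁ s * Real.cos ((s - t₀) * r) +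
      η s * (-(r * Real.sin ((s - t₀) * r)))) +
    Real.cos ((t - s) * r) * (η s * Real.cos ((s - t₀) * r)))]
  · simp [hz, hz1]
  · intro s _
    have d1 := ((h1 s).mul (hcos s)).add ((h0 s).mul ((hsin s).const_mul r).neg)
    have d2 := (((hsin' s).div_const r).mul d1).add ((hcos' s).mul ((h0 s).mul (hcos s)))
    refine d2.congr_deriv ?_
    simp only [hq, Pi.add_apply, Pi.mul_apply, Pi.neg_apply]
    field_simp
    ring
  · refine Continuous.intervalIntegrable ?_ _ _
    simp only [hq]
    fun_prop

/-- Pointwise duality in frequency. -/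
lemma enorm_sum_phase_sq_le {H : ℝ} (hH : 1 / 2 ≤ H) (hH' : H < 1) {a : ℝ} (ha : 0 < a) :
    ∃ C : ℝ, 0 < C ∧ ∀ (N : ℕ) (ι : Type) [Fintype ι] (w : ι → ℝ) (t : ι → ℝ) (x : ι → E N)
      (t₀ : ℝ) (ξ : E N), ξ ≠ 0 → (∀ i, a ≤ t i) →
      ‖∑ i, (w i : ℂ) * (phase (x i) ξ * (Real.cos ((t i - t₀) * ‖ξ‖) : ℂ))‖ₑ ^ 2 ≤
        ENNReal.ofReal (C * (1 + ‖ξ‖) ^ (2 * H + 1)) *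
          energy H (fun s => ∑ i, (w i : ℂ) * waveFourier (t i) (x i) s ξ) := by
  obtain ⟨C, hC, hdual⟩ := enorm_integral_mul_sq_le hH hH' ha
  obtain ⟨η, η₁, η₂, η₃, K, hK, d0, d1, d2, c3, z0, z1, hone, hsupp, hbd⟩ := exists_cutoff ha
  refine ⟨C * 9 * K ^ 2, by positivity, fun N ι _ w t x t₀ ξ hξ hta => ?_⟩
  have hr : 0 < ‖ξ‖ := norm_pos_iff.2 hξ
  set r := ‖ξ‖ with hrdef
  have c2 : Continuous η₂ := continuous_iff_continuousAt.2 fun t => (d2 t).continuousAt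
  have c1 : Continuous η₁ := continuous_iff_continuousAt.2 fun t => (d1 t).continuousAt
  have hcos : ∀ s, HasDerivAt (fun s => Real.cos ((s - t₀) * r))
      (-(r * Real.sin ((s - t₀) * r))) s := fun s => by
    have := (((hasDerivAt_id s).sub_const t₀).mul_const r).cos
    refine this.congr_deriv ?_
    simp only [id_eq]
    ring
  have hsin : ∀ s, HasDerivAt (fun s => Real.sin ((s - t₀) * r))
      (r * Real.cos ((s - t₀) * r)) s := fun s => by
    have := (((hasDerivAt_id s).sub_const t₀).mul_const r).sin
    refine this.congr_deriv ?_
    simp only [id_eq]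
    ring
  set q : ℝ → ℝ := fun s =>
    η₂ s * Real.cos ((s - t₀) * r) - 2 * r * η₁ s * Real.sin ((s - t₀) * r) with hq
  set q' : ℝ → ℝ := fun s => η₃ s * Real.cos ((s - t₀) * r) -
    3 * r * η₂ s * Real.sin ((s - t₀) * r) - 2 * r ^ 2 * η₁ s * Real.cos ((s - t₀) * r) with hq'
  have hder : ∀ s, HasDerivAt q (q' s) s := by
    intro s
    refine (((d2 s).mul (hcos s)).sub (((d1 s).const_mul (2 * r)).mul (hsin s))).congr_deriv ?_
    simp only [hq']
    ring
  have hAdm : Adm fun s => ∑ i, (w i : ℂ) * waveFourier (t i) (x i) s ξ :=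
    Adm.sum _ fun i _ => (adm_waveFourier (t i) (x i) hξ).const_mul _
  have hcb : ∀ s, |Real.cos ((s - t₀) * r)| ≤ 1 := fun s => Real.abs_cos_le_one _
  have hsb : ∀ s, |Real.sin ((s - t₀) * r)| ≤ 1 := fun s => Real.abs_sin_le_one _
  have hmul : ∀ x y c : ℝ, 0 ≤ c → |x| ≤ K → |y| ≤ 1 → |c * x * y| ≤ c * K := by
    intro x y c hc hx hy
    rw [abs_mul, abs_mul, abs_of_nonneg hc]
    calc c * |x| * |y| ≤ c * K * 1 := by gcongr
      _ = _ := mul_one _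
  have hqb : ∀ s, |q s| ≤ 3 * K * (1 + r) := by
    intro s
    have b1 := hmul (η₂ s) _ 1 zero_le_one (hbd s).2.1 (hcb s)
    have b2 := hmul (η₁ s) _ (2 * r) (by positivity) (hbd s).1 (hsb s)
    rw [one_mul] at b1
    calc |q s| ≤ _ := abs_sub _ _
      _ ≤ 1 * K + 2 * r * K := add_le_add b1 b2
      _ ≤ _ := by nlinarith [mul_pos hK hr]
  have hqb' : ∀ s, |q' s| ≤ (1 + r) * (3 * K * (1 + r)) := by
    intro s
    have b1 := hmul (η₃ s) _ 1 zero_le_one (hbd s).2.2 (hcb s)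
    have b2 := hmul (η₂ s) _ (3 * r) (by positivity) (hbd s).2.1 (hsb s)
    have b3 := hmul (η₁ s) _ (2 * r ^ 2) (by positivity) (hbd s).1 (hcb s)
    rw [one_mul] at b1
    calc |q' s| ≤ _ := abs_sub _ _
      _ ≤ (1 * K + 3 * r * K) + 2 * r ^ 2 * K :=
          add_le_add ((abs_sub _ _).trans (add_le_add b1 b2)) b3
      _ ≤ _ := by nlinarith [mul_pos hK hr, mul_pos (mul_pos hK hr) hr]
  -- Taking Λ = 1 + r and amplitude 3K(1 + r) produces (1 + r)^{2H-1} (1 + r)² = (1 + r)^{2H+1}.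
  have key := hdual _ hAdm (1 + r) (3 * K * (1 + r)) (by linarith) (by positivity) q q' hder
    (by simp only [hq']; fun_prop) (fun s hs => by simp [hq, hsupp s hs])
    (fun s hs => by simp [hq', hsupp s hs]) hqb hqb'
  -- The source does not depend on i: all times satisfy tᵢ ≥ a, where the switch-on equals 1.
  have hint : ∫ s in Ici (0 : ℝ), (∑ i, (w i : ℂ) * waveFourier (t i) (x i) s ξ) * (q s : ℂ) =
      ∑ i, (w i : ℂ) * (phase (x i) ξ * (Real.cos ((t i - t₀) * r) : ℂ)) := by
    simp_rw [Finset.sum_mul]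
    rw [integral_finsetSum]
    · refine Finset.sum_congr rfl fun i _ => ?_
      have h3 := integral_waveTime_mul d0 d1 c2 z0 z1 (ha.le.trans (hta i)) hr t₀
      rw [hone _ (hta i), one_mul] at h3
      simp_rw [waveFourier_eq, mul_assoc]
      rw [integral_const_mul, integral_const_mul, ← h3]
    · intro i _
      have := ((adm_waveFourier (t i) (x i) hξ).const_mul (w i)).integrable
      refine this.mul_bdd (c := 3 * K * (1 + r)) ?_ (Filter.Eventually.of_forall fun s => ?_)
      · have : Continuous q := continuous_iff_continuousAt.2 fun t => (hder t).continuousAt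
        exact (Complex.continuous_ofReal.comp this).aestronglyMeasurable
      · rw [Complex.norm_real]; exact hqb s
  rw [hint] at key
  refine key.trans_eq ?_
  congr 2
  have h1r : (0 : ℝ) < 1 + r := by positivity
  rw [show 2 * H + 1 = (2 * H - 1) + 2 by ring, Real.rpow_add h1r, Real.rpow_two]
  ring

/-- Duality for the noise norm. -/
lemma enorm_integral_sum_phase_sq_le {N : ℕ} {H β : ℝ} (hH : 1 / 2 ≤ H ∧ H < 1) (hN : 0 < N)
    {f h : E N → ℝ} (hf : IsSpatialCovariance β f h) {a : ℝ} (ha : 0 < a) :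
    ∃ C : ℝ, 0 < C ∧ ∀ (ι : Type) [Fintype ι] (w : ι → ℝ) (t : ι → ℝ) (x : ι → E N)
      (t₀ : ℝ) (M : E N → ℂ), Measurable M → (∀ i, a ≤ t i) →
      ‖∫ ξ, (∑ i, (w i : ℂ) * (phase (x i) ξ * (Real.cos ((t i - t₀) * ‖ξ‖) : ℂ))) * M ξ‖ₑ ^ 2 ≤
        ENNReal.ofReal C * (∫⁻ ξ, ‖M ξ‖ₑ ^ 2 * ENNReal.ofReal ((1 + ‖ξ‖) ^ (2 * H + 1) * ‖ξ‖ ^ β)) *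
          hpNormSq H h (fun s ξ => ∑ i, (w i : ℂ) * waveFourier (t i) (x i) s ξ) := by
  obtain ⟨C, hC, hpt⟩ := enorm_sum_phase_sq_le hH.1 hH.2 ha
  obtain ⟨c₁, c₂, hc₁, hc₂, hc⟩ := hf.comparable
  refine ⟨C / c₁, by positivity, fun ι _ w t x t₀ M hM hta => ?_⟩
  set S : E N → ℂ := fun ξ => ∑ i, (w i : ℂ) * (phase (x i) ξ * (Real.cos ((t i - t₀) * ‖ξ‖) : ℂ))
  have hS : Measurable S := by
    simp only [S, phase]
    fun_prop
  -- A splitting weight for Cauchy-Schwarz: k² (1 + |ξ|)^{2H+1} = |ξ|^{-β} is dominated by h, and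
  -- k⁻² is the weight left on M.
  set k : E N → ℝ := fun ξ => (1 + ‖ξ‖) ^ (-(H + 1 / 2)) * ‖ξ‖ ^ (-(β / 2)) with hk
  have hkm : Measurable k := by simp only [hk]; fun_prop
  have hk2 : ∀ ξ : E N, ξ ≠ 0 → k ξ ^ 2 * (1 + ‖ξ‖) ^ (2 * H + 1) = ‖ξ‖ ^ (-β) ∧
      (k ξ)⁻¹ ^ 2 = (1 + ‖ξ‖) ^ (2 * H + 1) * ‖ξ‖ ^ β ∧ 0 < k ξ := by
    intro ξ hξ
    have hr : 0 < ‖ξ‖ := norm_pos_iff.2 hξ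
    have h1 : 0 < 1 + ‖ξ‖ := by positivity
    have e : k ξ ^ 2 = (1 + ‖ξ‖) ^ (-(2 * H + 1)) * ‖ξ‖ ^ (-β) := by
      simp only [hk]
      rw [mul_pow, ← Real.rpow_natCast, ← Real.rpow_natCast, ← Real.rpow_mul h1.le,
        ← Real.rpow_mul hr.le]
      congr 2 <;> push_cast <;> ring
    refine ⟨?_, ?_, by simp only [hk]; positivity⟩
    · rw [e, mul_right_comm, ← Real.rpow_add h1]; simp
    · rw [inv_pow, e, mul_inv, Real.rpow_neg h1.le, Real.rpow_neg hr.le, inv_inv, inv_inv]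
  rw [hpNormSq_eq hH.1 hH.2 hf.nonneg]
  swap
  · filter_upwards [ae_ne_zero hN] with ξ hξ
    exact Adm.sum _ fun i _ => (adm_waveFourier (t i) (x i) hξ).const_mul _
  calc _ ≤ (∫⁻ ξ, (‖S ξ‖ₑ * ENNReal.ofReal (k ξ)) * (‖M ξ‖ₑ * ENNReal.ofReal (k ξ)⁻¹)) ^ 2 := by
        refine pow_le_pow_left' ((enorm_integral_le_lintegral_enorm _).trans
          (lintegral_mono_ae ?_)) 2
        filter_upwards [ae_ne_zero hN] with ξ hξ
        have hk0 := (hk2 ξ hξ).2.2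
        rw [enorm_mul, mul_mul_mul_comm, ← ENNReal.ofReal_mul hk0.le, mul_inv_cancel₀ hk0.ne',
          ENNReal.ofReal_one, mul_one]
    _ ≤ (∫⁻ ξ, (‖S ξ‖ₑ * ENNReal.ofReal (k ξ)) ^ 2) *
        ∫⁻ ξ, (‖M ξ‖ₑ * ENNReal.ofReal (k ξ)⁻¹) ^ 2 :=
        lintegral_mul_sq_le (by fun_prop) (by fun_prop)
    _ ≤ (ENNReal.ofReal (C / c₁) * ∫⁻ ξ, energy H (fun s => ∑ i, (w i : ℂ) *
          waveFourier (t i) (x i) s ξ) * ENNReal.ofReal (h ξ)) *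
        ∫⁻ ξ, ‖M ξ‖ₑ ^ 2 * ENNReal.ofReal ((1 + ‖ξ‖) ^ (2 * H + 1) * ‖ξ‖ ^ β) := by
        rw [← lintegral_const_mul' _ _ ENNReal.ofReal_ne_top]
        refine mul_le_mul' (lintegral_mono_ae ?_) (lintegral_mono_ae ?_)
        · filter_upwards [ae_ne_zero hN, hc] with ξ hξ hcξ
          obtain ⟨e1, -, e3⟩ := hk2 ξ hξ
          rw [mul_pow, ← ENNReal.ofReal_pow e3.le]
          calc _ ≤ (ENNReal.ofReal (C * (1 + ‖ξ‖) ^ (2 * H + 1)) *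
              energy H (fun s => ∑ i, (w i : ℂ) * waveFourier (t i) (x i) s ξ)) *
                ENNReal.ofReal (k ξ ^ 2) := by
                gcongr
                exact hpt N ι w t x t₀ ξ hξ hta
            _ = ENNReal.ofReal (C * ‖ξ‖ ^ (-β)) *
              energy H (fun s => ∑ i, (w i : ℂ) * waveFourier (t i) (x i) s ξ) := by
                rw [mul_right_comm, ← ENNReal.ofReal_mul (by positivity), ← e1]
                congr 2
                ring
            _ ≤ ENNReal.ofReal (C / c₁ * h ξ) *
              energy H (fun s => ∑ i, (w i : ℂ) * waveFourier (t i) (x i) s ξ) := by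
                refine mul_le_mul_left (ENNReal.ofReal_le_ofReal ?_) _
                rw [div_mul_eq_mul_div, le_div_iff₀ hc₁]
                nlinarith [hcξ.1]
            _ = _ := by
                rw [ENNReal.ofReal_mul (by positivity)]
                ring
        · filter_upwards [ae_ne_zero hN] with ξ hξ
          obtain ⟨-, e2, e3⟩ := hk2 ξ hξ
          rw [mul_pow, ← ENNReal.ofReal_pow (by positivity), e2]
    _ = _ := by ring

/-- A spectral profile which isolates the origin on the line `ℝ • D`. -/
structure IsProfile {N : ℕ} (H β : ℝ) (D : ℝ × E N) (Φ : E N → ℂ) : Prop where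
  meas : Measurable Φ
  integrable : Integrable Φ
  weight : ∫⁻ ξ, ‖Φ ξ‖ₑ ^ 2 * ENNReal.ofReal ((1 + ‖ξ‖) ^ (2 * H + 1) * ‖ξ‖ ^ β) ≠ ∞
  integral_ne : ∫ ξ, Φ ξ ≠ 0
  vanish : ∀ σ : ℝ, 1 ≤ |σ| →
    ∫ ξ, phase (σ • D.2) ξ * (Real.cos (σ * D.1 * ‖ξ‖) : ℂ) * Φ ξ = 0

lemma lintegral_comp_smul {N : ℕ} {F : E N → ℝ≥0∞} (hF : Measurable F) {δ : ℝ} (hδ : 0 < δ) :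
    ∫⁻ ξ, F (δ • ξ) = ENNReal.ofReal (δ ^ N)⁻¹ * ∫⁻ ξ, F ξ := by
  rw [← lintegral_map (f := F) (g := fun ξ => δ • ξ) hF (by fun_prop),
    Measure.map_addHaar_smul _ hδ.ne', lintegral_smul_measure, finrank_euclideanSpace_fin,
    abs_of_nonneg (by positivity), smul_eq_mul]

lemma measurable_phase {N : ℕ} (x : E N) : Measurable (phase x) := by
  unfold phase; fun_prop

/-- Strong local nondeterminism along a line. -/
theorem IsProfile.hpNormSq_ge {N : ℕ} {H β : ℝ} (hH : 1 / 2 ≤ H ∧ H < 1) (hN : 0 < N)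
    {f h : E N → ℝ} (hf : IsSpatialCovariance β f h) {a : ℝ} (ha : 0 < a) {D : ℝ × E N}
    {Φ : E N → ℂ} (hΦ : IsProfile H β D Φ) :
    ∃ c : ℝ, 0 < c ∧ ∀ (ι : Type) [Fintype ι] (w σ : ι → ℝ) (t₀ : ℝ) (x₀ : E N) (δ : ℝ),
      0 < δ → δ ≤ 1 → a ≤ t₀ → (∀ i, a ≤ t₀ + σ i * D.1) → (∀ i, δ ≤ |σ i|) →
      ENNReal.ofReal (c * δ ^ (2 * H + 1 - N + β)) ≤ hpNormSq H h (fun s ξ =>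
        waveFourier t₀ x₀ s ξ +
          ∑ i, (w i : ℂ) * waveFourier (t₀ + σ i * D.1) (x₀ + σ i • D.2) s ξ) := by
  obtain ⟨C, hC, hdual⟩ := enorm_integral_sum_phase_sq_le hH hN hf ha
  set J := (∫⁻ ξ, ‖Φ ξ‖ₑ ^ 2 * ENNReal.ofReal ((1 + ‖ξ‖) ^ (2 * H + 1) * ‖ξ‖ ^ β)) with hJ
  set I := ∫ ξ, Φ ξ with hI
  have hI0 : 0 < ‖I‖ := norm_pos_iff.2 hΦ.integral_ne
  have hJ0 : 0 ≤ J.toReal := ENNReal.toReal_nonneg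
  refine ⟨‖I‖ ^ 2 / (C * (J.toReal + 1)), by positivity,
    fun ι _ w σ t₀ x₀ δ hδ hδ1 ht₀ hta hσ => ?_⟩
  -- Rescaling localises the profile at distance δ; the phase recentres it at x₀.
  set M : E N → ℂ := fun ξ => Φ (δ • ξ) * phase (-x₀) ξ with hM
  have hMm : Measurable M := (hΦ.meas.comp (by fun_prop)).mul (measurable_phase _)
  have key := hdual (Option ι) (fun o => o.elim 1 w) (fun o => o.elim t₀ fun i => t₀ + σ i * D.1)
    (fun o => o.elim x₀ fun i => x₀ + σ i • D.2) t₀ M hMm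
    (fun o => by cases o <;> simp [ht₀, hta])
  simp only [Fintype.sum_option, Option.elim_none, Option.elim_some, sub_self, zero_mul,
    Real.cos_zero, Complex.ofReal_one, mul_one, one_mul, add_sub_cancel_left] at key
  -- the weight
  have hw : ∫⁻ ξ, ‖M ξ‖ₑ ^ 2 * ENNReal.ofReal ((1 + ‖ξ‖) ^ (2 * H + 1) * ‖ξ‖ ^ β) ≤
      ENNReal.ofReal (δ ^ (-(2 * H + 1 + β + N))) * J := by
    calc _ ≤ ∫⁻ ξ, ENNReal.ofReal (δ ^ (-(2 * H + 1 + β))) * ((fun η : E N => ‖Φ η‖ₑ ^ 2 *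
          ENNReal.ofReal ((1 + ‖η‖) ^ (2 * H + 1) * ‖η‖ ^ β)) (δ • ξ)) := by
          refine lintegral_mono fun ξ => ?_
          simp only [hM, enorm_mul]
          have : ‖phase (-x₀) ξ‖ₑ = 1 := by rw [← ofReal_norm, norm_phase, ENNReal.ofReal_one]
          rw [this, mul_one, mul_left_comm, ← ENNReal.ofReal_mul (by positivity)]
          refine mul_le_mul_right (ENNReal.ofReal_le_ofReal ?_) _
          rw [norm_smul, Real.norm_of_nonneg hδ.le, neg_add, Real.rpow_add hδ, Real.rpow_neg hδ.le,
            Real.rpow_neg hδ.le, Real.mul_rpow hδ.le (norm_nonneg _)]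
          -- This is where δ ≤ 1 enters: 1 + |ξ| ≤ δ⁻¹ (1 + δ|ξ|).
          have e1 : (1 + ‖ξ‖) ^ (2 * H + 1) ≤
              (δ ^ (2 * H + 1))⁻¹ * (1 + δ * ‖ξ‖) ^ (2 * H + 1) := by
            rw [← Real.inv_rpow hδ.le, ← Real.mul_rpow (by positivity) (by positivity)]
            refine Real.rpow_le_rpow (by positivity) ?_ (by linarith [hH.1])
            rw [mul_add, ← mul_assoc, inv_mul_cancel₀ hδ.ne', one_mul, mul_one]
            have := one_le_inv_iff₀.2 ⟨hδ, hδ1⟩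
            linarith
          have e2 : 0 < δ ^ β := by positivity
          calc _ ≤ ((δ ^ (2 * H + 1))⁻¹ * (1 + δ * ‖ξ‖) ^ (2 * H + 1)) * ‖ξ‖ ^ β := by gcongr
            _ = _ := by field_simp
      _ = _ := by
          rw [lintegral_const_mul' _ _ ENNReal.ofReal_ne_top,
            lintegral_comp_smul (F := fun η : E N => ‖Φ η‖ₑ ^ 2 *
              ENNReal.ofReal ((1 + ‖η‖) ^ (2 * H + 1) * ‖η‖ ^ β)) (by have := hΦ.meas; fun_prop) hδ, ← mul_assoc,
            ← ENNReal.ofReal_mul (by positivity)]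
          congr 2
          rw [← Real.rpow_natCast, ← Real.rpow_neg hδ.le, ← Real.rpow_add hδ]
          congr 1
          ring
  -- the integral
  have hterm : ∀ ρ : ℝ, ∫ ξ, (phase (x₀ + ρ • D.2) ξ * (Real.cos (ρ * D.1 * ‖ξ‖) : ℂ)) * M ξ =
      ((δ ^ N)⁻¹ : ℝ) • ∫ ξ, phase ((ρ / δ) • D.2) ξ *
        (Real.cos (ρ / δ * D.1 * ‖ξ‖) : ℂ) * Φ ξ := by
    intro ρ
    have := Measure.integral_comp_smul volume (fun ξ : E N => phase ((ρ / δ) • D.2) ξ *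
        (Real.cos (ρ / δ * D.1 * ‖ξ‖) : ℂ) * Φ ξ) δ
    rw [finrank_euclideanSpace_fin, abs_of_nonneg (by positivity)] at this
    rw [← this]
    congr 1
    ext ξ
    have e1 : phase ((ρ / δ) • D.2) (δ • ξ) = phase (x₀ + ρ • D.2) ξ * phase (-x₀) ξ := by
      unfold phase
      rw [← Complex.exp_add, inner_smul_left, inner_smul_right, inner_add_left, inner_smul_left,
        inner_neg_left]
      congr 1
      simp only [conj_trivial]
      push_cast
      have : (δ : ℂ) ≠ 0 := by exact_mod_cast hδ.ne'
      field_simp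
      ring
    have e2 : ρ / δ * D.1 * ‖δ • ξ‖ = ρ * D.1 * ‖ξ‖ := by
      rw [norm_smul, Real.norm_of_nonneg hδ.le]; field_simp
    simp only [hM, e1, e2]
    ring
  have hint : ∀ ρ : ℝ, Integrable fun ξ =>
      (phase (x₀ + ρ • D.2) ξ * (Real.cos (ρ * D.1 * ‖ξ‖) : ℂ)) * M ξ := by
    intro ρ
    have h1 : Integrable fun ξ => Φ (δ • ξ) := hΦ.integrable.comp_smul hδ.ne'
    have h2 : Integrable M := by
      refine h1.mul_bdd (c := 1) (measurable_phase _).aestronglyMeasurable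
        (Filter.Eventually.of_forall fun ξ => (norm_phase _ _).le)
    refine h2.bdd_mul (c := 1) ?_ (Filter.Eventually.of_forall fun ξ => ?_)
    · have := measurable_phase (x₀ + ρ • D.2)
      exact Measurable.aestronglyMeasurable (by fun_prop)
    · rw [norm_mul, norm_phase, one_mul, Complex.norm_real]
      exact Real.abs_cos_le_one _
  -- After scaling, the i-th term is the profile integral at σᵢ/δ, of modulus at least 1, so it
  -- vanishes; only the base point survives.
  have hval : ∫ ξ, (phase x₀ ξ + ∑ i, (w i : ℂ) *
      (phase (x₀ + σ i • D.2) ξ * (Real.cos (σ i * D.1 * ‖ξ‖) : ℂ))) * M ξ =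
        ((δ ^ N)⁻¹ : ℝ) • I := by
    have h0 := hterm 0
    have i0 := hint 0
    simp only [zero_smul, add_zero, zero_mul, Real.cos_zero, Complex.ofReal_one, mul_one, zero_div]
      at h0 i0
    simp_rw [add_mul, Finset.sum_mul, mul_assoc (_ : ℂ) (_ * _)]
    rw [integral_add i0 (integrable_finsetSum _ fun i _ => (hint (σ i)).const_mul _), h0,
      integral_finsetSum _ fun i _ => (hint (σ i)).const_mul _]
    rw [Finset.sum_eq_zero]
    · rw [add_zero, hI]
      congr 2
      ext ξ
      simp [phase]
    · intro i _
      rw [integral_const_mul, hterm (σ i), hΦ.vanish (σ i / δ), smul_zero, mul_zero]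
      rw [abs_div, abs_of_pos hδ, le_div_iff₀ hδ, one_mul]
      exact hσ i
  rw [hval] at key
  set Q := hpNormSq H h (fun s ξ => waveFourier t₀ x₀ s ξ +
    ∑ i, (w i : ℂ) * waveFourier (t₀ + σ i * D.1) (x₀ + σ i • D.2) s ξ) with hQ
  have key2 : ENNReal.ofReal ((δ ^ N)⁻¹ ^ 2 * ‖I‖ ^ 2) ≤
      ENNReal.ofReal (C * (δ ^ (-(2 * H + 1 + β + N)) * (J.toReal + 1))) * Q := by
    calc _ = ‖((δ ^ N)⁻¹ : ℝ) • I‖ₑ ^ 2 := by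
          rw [← ofReal_norm, norm_smul, Real.norm_of_nonneg (by positivity),
            ← ENNReal.ofReal_pow (by positivity), mul_pow]
      _ ≤ _ := key
      _ ≤ _ := by
          refine mul_le_mul_left ?_ _
          rw [ENNReal.ofReal_mul hC.le, ENNReal.ofReal_mul (by positivity)]
          refine mul_le_mul_right (hw.trans (mul_le_mul_right ?_ _)) _
          calc J = ENNReal.ofReal J.toReal := (ENNReal.ofReal_toReal hΦ.weight).symm
            _ ≤ _ := ENNReal.ofReal_le_ofReal (by linarith)
  have hB : 0 < C * (δ ^ (-(2 * H + 1 + β + N)) * (J.toReal + 1)) := by positivity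
  have key3 : ENNReal.ofReal ((δ ^ N)⁻¹ ^ 2 * ‖I‖ ^ 2) /
      ENNReal.ofReal (C * (δ ^ (-(2 * H + 1 + β + N)) * (J.toReal + 1))) ≤ Q :=
    ENNReal.div_le_of_le_mul' key2
  refine le_trans (le_of_eq ?_) key3
  rw [← ENNReal.ofReal_div_of_pos hB]
  congr 1
  -- The squared integral contributes δ^{-2N} and the weight δ^{-(2H+1+β+N)}; their quotient is the
  -- power claimed.
  have e3 : δ ^ (2 * H + 1 - N + β) = (δ ^ N)⁻¹ ^ 2 * δ ^ (2 * H + 1 + β + N) := by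
    rw [← Real.rpow_natCast δ N, ← Real.rpow_neg hδ.le, ← Real.rpow_natCast, ← Real.rpow_mul hδ.le,
      ← Real.rpow_add hδ]
    congr 1
    push_cast
    ring
  rw [e3, Real.rpow_neg hδ.le]
  field_simp

/-! ### Spectral profiles for the coordinate directions -/

lemma schwartz_decay {V : Type*} [NormedAddCommGroup V] [NormedSpace ℝ V] (g : 𝓢(V, ℂ)) (k : ℕ) :
    ∃ C : ℝ, 0 < C ∧ ∀ x, ‖g x‖ ≤ C ∧ ‖x‖ ^ k * ‖g x‖ ≤ C := by
  obtain ⟨C₁, h₁, H₁⟩ := g.decay k 0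
  obtain ⟨C₂, h₂, H₂⟩ := g.decay 0 0
  simp only [norm_iteratedFDeriv_zero, pow_zero, one_mul] at H₁ H₂
  exact ⟨max C₁ C₂, lt_max_of_lt_left h₁, fun x =>
    ⟨(H₂ x).trans (le_max_right _ _), (H₁ x).trans (le_max_left _ _)⟩⟩

lemma fourier_fourier {V : Type*} [NormedAddCommGroup V] [InnerProductSpace ℝ V]
    [MeasurableSpace V] [BorelSpace V] [FiniteDimensional ℝ V] (φ : 𝓢(V, ℂ)) (x : V) :
    𝓕 (𝓕 (φ : V → ℂ)) x = φ (-x) := by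
  have h1 : 𝓕⁻ (𝓕 φ) = φ := FourierTransform.fourierInv_fourier_eq φ
  have h2 := congrArg (fun g : 𝓢(V, ℂ) => g (-x)) h1
  simp only [SchwartzMap.fourierInv_coe, SchwartzMap.fourier_coe] at h2
  rw [Real.fourierInv_eq_fourier_neg, neg_neg] at h2
  exact h2

/-- Take Φ to be the Fourier transform of a bump of radius 1/8. By inversion its integral against
the phase of σeᵢ is the bump at distance |σ|/(2π) from the origin, and 1/(2π) > 1/8. -/
lemma exists_space_profile {N : ℕ} {H β : ℝ} (hH : 1 / 2 ≤ H ∧ H < 1) (hβ : 0 < β ∧ β < N)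
    (hN : 0 < N) (i : Fin N) :
    ∃ Φ, IsProfile H β ((0 : ℝ), (EuclideanSpace.single i (1 : ℝ) : E N)) Φ := by
  let bump : ContDiffBump (0 : E N) := ⟨1 / 16, 1 / 8, by norm_num, by norm_num⟩
  have hcs : HasCompactSupport fun x => (bump x : ℂ) :=
    bump.hasCompactSupport.comp_left Complex.ofReal_zero
  have hcd : ContDiff ℝ ((⊤ : ℕ∞) : WithTop ℕ∞) fun x => (bump x : ℂ) :=
    Complex.ofRealCLM.contDiff.comp bump.contDiff
  set φ : 𝓢(E N, ℂ) := hcs.toSchwartzMap hcd with hφ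
  have hφv : ∀ x, φ x = (bump x : ℂ) := fun x => rfl
  set Ψ : 𝓢(E N, ℂ) := 𝓕 φ with hΨ
  have hpi : (0 : ℝ) < 2 * Real.pi := by positivity
  have hint : ∀ z : E N, ∫ ξ, phase z ξ * Ψ ξ = φ (-((2 * Real.pi)⁻¹ • z)) := by
    intro z
    rw [← fourier_fourier φ, Real.fourier_eq', ← SchwartzMap.fourier_coe, ← hΨ]
    congr 1
    ext ξ
    rw [smul_eq_mul]
    congr 1
    unfold phase
    congr 1
    rw [inner_smul_right, real_inner_comm z ξ]
    push_cast
    have : (Real.pi : ℂ) ≠ 0 := by exact_mod_cast Real.pi_ne_zero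
    field_simp
  obtain ⟨C, hC, hdec⟩ := schwartz_decay Ψ (N + 2)
  refine ⟨Ψ, Ψ.continuous.measurable, Ψ.integrable, ?_, ?_, ?_⟩
  · have hi : Integrable fun ξ => ‖Ψ ξ‖ ^ 2 * ((1 + ‖ξ‖) ^ (2 * H + 1) * ‖ξ‖ ^ β) := by
      have hm : Measurable Ψ := Ψ.continuous.measurable
      refine integrable_of_radial_bound hN (a := N) (b := 1) (C := 8 * C ^ 2)
        (Measurable.aestronglyMeasurable (by fun_prop)) (by exact_mod_cast hN) one_pos
        (fun ξ h0 h1 => ?_) (fun ξ h0 => ?_)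
      · rw [Real.norm_of_nonneg (by positivity), sub_self, Real.rpow_zero, mul_one]
        have b1 : ‖Ψ ξ‖ ^ 2 ≤ C ^ 2 := by gcongr; exact (hdec ξ).1
        have b2 : (1 + ‖ξ‖) ^ (2 * H + 1) ≤ 8 := by
          calc (1 + ‖ξ‖) ^ (2 * H + 1) ≤ 2 ^ (2 * H + 1) :=
                Real.rpow_le_rpow (by positivity) (by linarith) (by linarith)
            _ ≤ 2 ^ (3 : ℝ) := Real.rpow_le_rpow_of_exponent_le (by norm_num) (by linarith)
            _ = 8 := by norm_num
        have b3 : ‖ξ‖ ^ β ≤ 1 := Real.rpow_le_one h0.le h1 hβ.1.le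
        calc _ ≤ C ^ 2 * (8 * 1) := by gcongr
          _ = _ := by ring
      · have h0' : 0 < ‖ξ‖ := by linarith
        rw [Real.norm_of_nonneg (by positivity)]
        have b1 : ‖Ψ ξ‖ ≤ C * ‖ξ‖ ^ (-(N + 2 : ℝ)) := by
          rw [Real.rpow_neg h0'.le, ← div_eq_mul_inv, le_div_iff₀ (by positivity), mul_comm]
          have := (hdec ξ).2
          rw [← Real.rpow_natCast] at this
          push_cast at this
          exact this
        have b2 : (1 + ‖ξ‖) ^ (2 * H + 1) ≤ 8 * ‖ξ‖ ^ (3 : ℝ) := by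
          calc (1 + ‖ξ‖) ^ (2 * H + 1) ≤ (1 + ‖ξ‖) ^ (3 : ℝ) :=
                Real.rpow_le_rpow_of_exponent_le (by linarith) (by linarith)
            _ ≤ (2 * ‖ξ‖) ^ (3 : ℝ) := Real.rpow_le_rpow (by positivity) (by linarith) (by norm_num)
            _ = _ := by rw [Real.mul_rpow (by norm_num) h0'.le]; norm_num
        have b3 : ‖ξ‖ ^ β ≤ ‖ξ‖ ^ (N : ℝ) := Real.rpow_le_rpow_of_exponent_le h0.le hβ.2.le
        calc _ ≤ (C * ‖ξ‖ ^ (-(N + 2 : ℝ))) ^ 2 * (8 * ‖ξ‖ ^ (3 : ℝ) * ‖ξ‖ ^ (N : ℝ)) := by gcongr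
          _ = 8 * C ^ 2 * (‖ξ‖ ^ (-(N + 2 : ℝ)) * ‖ξ‖ ^ (-(N + 2 : ℝ)) *
              (‖ξ‖ ^ (3 : ℝ) * ‖ξ‖ ^ (N : ℝ))) := by ring
          _ = _ := by
              rw [← Real.rpow_add h0', ← Real.rpow_add h0', ← Real.rpow_add h0']
              congr 2
              ring
    have := hi.lintegral_lt_top
    refine ne_of_lt (lt_of_le_of_lt (le_of_eq ?_) this)
    refine lintegral_congr fun ξ => ?_
    rw [ENNReal.ofReal_mul (p := ‖Ψ ξ‖ ^ 2) (by positivity), ENNReal.ofReal_pow (norm_nonneg _),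
      ofReal_norm]
  · have h0 := hint 0
    have : ∀ ξ : E N, phase 0 ξ = 1 := fun ξ => by simp [phase]
    simp only [this, one_mul, smul_zero, neg_zero] at h0
    rw [h0, hφv, bump.one_of_mem_closedBall (by simp [bump])]
    simp
  · intro σ hσ
    simp only [mul_zero, zero_mul, Real.cos_zero, Complex.ofReal_one, mul_one]
    rw [hint, hφv, bump.zero_of_le_dist, Complex.ofReal_zero]
    rw [dist_zero_right, norm_neg, norm_smul, norm_smul, PiLp.norm_single, norm_inv,
      Real.norm_of_nonneg hpi.le, Real.norm_eq_abs, norm_one, mul_one]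
    have h8 : (1 / 8 : ℝ) ≤ (2 * Real.pi)⁻¹ := by
      rw [one_div]
      exact inv_anti₀ hpi (by linarith [Real.pi_lt_d2])
    calc (1 / 8 : ℝ) = 1 / 8 * 1 := by ring
      _ ≤ (2 * Real.pi)⁻¹ * |σ| := by gcongr

/-- Unfold the half line to the whole line and write the cosine as two exponentials; Fourier
inversion then evaluates ψ at ±σ/(2π). -/
lemma integral_cos_mul_fourier (ψ : 𝓢(ℝ, ℂ)) (σ : ℝ) :
    ∫ y in Ioi (0 : ℝ), (Real.cos (σ * y) : ℂ) * ((𝓕 ψ) y + (𝓕 ψ) (-y)) =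
      (ψ (-((2 * Real.pi)⁻¹ * σ)) + ψ ((2 * Real.pi)⁻¹ * σ)) / 2 := by
  set Ψ : 𝓢(ℝ, ℂ) := 𝓕 ψ with hΨ
  set g : ℝ → ℂ := fun y => (Real.cos (σ * y) : ℂ) * Ψ y with hg
  have hgi : Integrable g := by
    refine Ψ.integrable.bdd_mul (c := 1) ?_ (Filter.Eventually.of_forall fun y => ?_)
    · exact Measurable.aestronglyMeasurable (by fun_prop)
    · rw [Complex.norm_real]; exact Real.abs_cos_le_one _
  have h1 : ∫ y in Ioi (0 : ℝ), (Real.cos (σ * y) : ℂ) * (Ψ y + Ψ (-y)) = ∫ y, g y := by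
    have e : ∀ y, (Real.cos (σ * y) : ℂ) * (Ψ y + Ψ (-y)) = g y + g (-y) := by
      intro y
      simp only [hg, mul_neg, Real.cos_neg]
      ring
    simp_rw [e]
    rw [integral_add hgi.integrableOn hgi.comp_neg.integrableOn, integral_comp_neg_Ioi, neg_zero,
      add_comm, intervalIntegral.integral_Iic_add_Ioi hgi.integrableOn hgi.integrableOn]
  have h2 : ∀ s : ℝ, Integrable (fun y : ℝ => Complex.exp ((s * y : ℝ) * Complex.I) * Ψ y) := by
    intro s
    refine Ψ.integrable.bdd_mul (c := 1) ?_ (Filter.Eventually.of_forall fun y => ?_)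
    · exact Measurable.aestronglyMeasurable (by fun_prop)
    · rw [Complex.norm_exp_ofReal_mul_I]
  have h3 : ∀ s : ℝ, ∫ y : ℝ, Complex.exp ((s * y : ℝ) * Complex.I) * Ψ y =
      ψ ((2 * Real.pi)⁻¹ * s) := by
    intro s
    rw [show (2 * Real.pi)⁻¹ * s = -(-((2 * Real.pi)⁻¹ * s)) by ring, ← fourier_fourier ψ,
      Real.fourier_real_eq_integral_exp_smul, ← SchwartzMap.fourier_coe, ← hΨ]
    congr 1
    ext y
    rw [smul_eq_mul]
    congr 4
    have := Real.pi_ne_zero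
    field_simp
  rw [h1]
  have h4 : ∀ y, g y = (Complex.exp ((-σ * y : ℝ) * Complex.I) * Ψ y +
      Complex.exp ((σ * y : ℝ) * Complex.I) * Ψ y) / 2 := by
    intro y
    simp only [hg]
    rw [← add_mul, Complex.ofReal_cos, Complex.cos]
    push_cast
    ring_nf
  simp_rw [h4]
  rw [integral_div, integral_add (h2 _) (h2 _), h3, h3, mul_neg]

/-- A radial Φ reduces the integral to a one-dimensional cosine transform, hence to the even part of
ψ, which vanishes beyond 1/8. Choosing ψ as the derivative of x · bump keeps ψ(0) = 1 while its
Fourier transform vanishes at 0, and this extra zero makes the weight integrable at the origin. -/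
lemma exists_time_profile {N : ℕ} {H β : ℝ} (hH : 1 / 2 ≤ H ∧ H < 1) (hβ : 0 < β ∧ β < N)
    (hβH : (N : ℝ) - 2 * H - 1 < β) (hN : 0 < N) :
    ∃ Φ, IsProfile H β ((1 : ℝ), (0 : E N)) Φ := by
  have := nontrivial_E hN
  let bump : ContDiffBump (0 : ℝ) := ⟨1 / 16, 1 / 8, by norm_num, by norm_num⟩
  have hcs : HasCompactSupport fun x : ℝ => (x : ℂ) * (bump x : ℂ) :=
    HasCompactSupport.mul_left (bump.hasCompactSupport.comp_left Complex.ofReal_zero)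
  have hcd : ContDiff ℝ ((⊤ : ℕ∞) : WithTop ℕ∞) fun x : ℝ => (x : ℂ) * (bump x : ℂ) :=
    Complex.ofRealCLM.contDiff.mul (Complex.ofRealCLM.contDiff.comp bump.contDiff)
  set χ : 𝓢(ℝ, ℂ) := hcs.toSchwartzMap hcd with hχ
  have hχv : ∀ x, χ x = (x : ℂ) * (bump x : ℂ) := fun x => rfl
  set ψ : 𝓢(ℝ, ℂ) := SchwartzMap.derivCLM ℂ ℂ χ with hψ
  have hψv : ∀ x, ψ x = deriv χ x := fun x => SchwartzMap.derivCLM_apply ℂ χ x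
  have hψ0 : ψ 0 = 1 := by
    rw [hψv]
    have : (χ : ℝ → ℂ) =ᶠ[𝓝 0] fun x : ℝ => (x : ℂ) := by
      filter_upwards [Metric.ball_mem_nhds (0 : ℝ) (show (0 : ℝ) < 1 / 16 by norm_num)] with x hx
      rw [hχv, bump.one_of_mem_closedBall (Metric.ball_subset_closedBall hx)]
      simp
    rw [this.deriv_eq]
    exact Complex.ofRealCLM.hasDerivAt.deriv
  have hψz : ∀ x : ℝ, 1 / 8 < |x| → ψ x = 0 := by
    intro x hx
    rw [hψv]
    have : (χ : ℝ → ℂ) =ᶠ[𝓝 x] fun _ => 0 := by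
      filter_upwards [continuous_abs.continuousAt.eventually (lt_mem_nhds hx)] with y hy
      rw [hχv, bump.zero_of_le_dist (by rw [dist_zero_right]; exact hy.le)]
      simp
    rw [this.deriv_eq, deriv_const]
  set Ψ : 𝓢(ℝ, ℂ) := 𝓕 ψ with hΨ
  have hΨd : ∀ x : ℝ, Ψ x = (2 * Real.pi * Complex.I * x) * (𝓕 χ) x := by
    intro x
    have h1 := congrFun (Real.fourier_deriv χ.integrable χ.differentiable
      (by have := ψ.integrable (μ := volume); rwa [show (ψ : ℝ → ℂ) = deriv χ from funext hψv] at this)) x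
    rw [hΨ, SchwartzMap.fourier_coe, SchwartzMap.fourier_coe,
      show (ψ : ℝ → ℂ) = deriv χ from funext hψv, h1, smul_eq_mul]
  obtain ⟨C₁, hC₁, hd₁⟩ := schwartz_decay (𝓕 χ) 0
  obtain ⟨C₂, hC₂, hd₂⟩ := schwartz_decay Ψ 3
  set C := 2 * (2 * Real.pi * C₁) + 2 * C₂ with hC
  have hC0 : 0 < C := by positivity
  set m : ℝ → ℂ := fun y => Ψ y + Ψ (-y) with hm
  have hmm : Measurable m := (by fun_prop : Continuous m).measurable
  have hm1 : ∀ y : ℝ, 0 < y → ‖m y‖ ≤ C * y := by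
    intro y hy
    have b : ∀ x : ℝ, |x| = y → ‖Ψ x‖ ≤ 2 * Real.pi * C₁ * y := by
      intro x hx
      rw [hΨd]
      simp only [norm_mul, Complex.norm_I, mul_one, Complex.norm_real, Real.norm_eq_abs,
        abs_of_pos Real.pi_pos, hx]
      have := (hd₁ x).1
      rw [Complex.norm_two]
      calc 2 * Real.pi * y * ‖(𝓕 χ) x‖ ≤ 2 * Real.pi * y * C₁ := by gcongr
        _ = _ := by ring
    have b1 := b y (abs_of_pos hy)
    have b2 := b (-y) (by rw [abs_neg, abs_of_pos hy])
    refine (norm_add_le _ _).trans ?_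
    rw [hC]
    nlinarith [mul_pos hC₂ hy]
  have hm2 : ∀ y : ℝ, 0 < y → ‖m y‖ ≤ C * y ^ (-3 : ℝ) := by
    intro y hy
    have b : ∀ x : ℝ, |x| = y → ‖Ψ x‖ ≤ C₂ * y ^ (-3 : ℝ) := by
      intro x hx
      have := (hd₂ x).2
      rw [Real.norm_eq_abs, hx] at this
      rw [Real.rpow_neg hy.le, ← div_eq_mul_inv, le_div_iff₀ (by positivity), mul_comm]
      exact_mod_cast this
    have b1 := b y (abs_of_pos hy)
    have b2 := b (-y) (by rw [abs_neg, abs_of_pos hy])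
    refine (norm_add_le _ _).trans ?_
    rw [hC]
    have : 0 ≤ 2 * (2 * Real.pi * C₁) * y ^ (-3 : ℝ) := by positivity
    nlinarith
  -- The factor |ξ|^{1-N} cancels the Jacobian of polar coordinates.
  set Φ : E N → ℂ := fun ξ => ((‖ξ‖ ^ (1 - N : ℝ) : ℝ) : ℂ) * m ‖ξ‖ with hΦ
  have hΦm : Measurable Φ := by simp only [hΦ]; fun_prop
  have hΦ1 : ∀ ξ : E N, 0 < ‖ξ‖ → ‖Φ ξ‖ ≤ C * ‖ξ‖ ^ (2 - N : ℝ) := by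
    intro ξ h0
    simp only [hΦ]
    rw [norm_mul, Complex.norm_real, Real.norm_of_nonneg (by positivity),
      show (2 - N : ℝ) = (1 - N) + 1 by ring, Real.rpow_add_one h0.ne']
    calc _ ≤ ‖ξ‖ ^ (1 - N : ℝ) * (C * ‖ξ‖) := by gcongr; exact hm1 _ h0
      _ = _ := by ring
  have hΦ2 : ∀ ξ : E N, 0 < ‖ξ‖ → ‖Φ ξ‖ ≤ C * ‖ξ‖ ^ (-2 - N : ℝ) := by
    intro ξ h0
    simp only [hΦ]
    rw [norm_mul, Complex.norm_real, Real.norm_of_nonneg (by positivity),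
      show (-2 - N : ℝ) = (1 - N) + -3 by ring, Real.rpow_add h0]
    calc _ ≤ ‖ξ‖ ^ (1 - N : ℝ) * (C * ‖ξ‖ ^ (-3 : ℝ)) := by gcongr; exact hm2 _ h0
      _ = _ := by ring
  have hval : ∀ σ : ℝ, ∫ ξ : E N, (Real.cos (σ * ‖ξ‖) : ℂ) * Φ ξ =
      N • (volume : Measure (E N)).real (Metric.ball 0 1) •
        ((ψ (-((2 * Real.pi)⁻¹ * σ)) + ψ ((2 * Real.pi)⁻¹ * σ)) / 2) := by
    intro σ
    rw [integral_fun_norm_addHaar volume (fun y : ℝ =>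
      (Real.cos (σ * y) : ℂ) * (((y ^ (1 - N : ℝ) : ℝ) : ℂ) * m y)), finrank_euclideanSpace_fin,
      ← integral_cos_mul_fourier]
    congr 2
    refine setIntegral_congr_fun measurableSet_Ioi fun y hy => ?_
    have hy : 0 < y := hy
    have e : y ^ (N - 1) * y ^ (1 - N : ℝ) = 1 := by
      rw [← Real.rpow_natCast, ← Real.rpow_add hy, Nat.cast_sub hN]
      simp
    have e' : ((y ^ (N - 1) : ℝ) : ℂ) * ((y ^ (1 - N : ℝ) : ℝ) : ℂ) = 1 := by
      rw [← Complex.ofReal_mul, e, Complex.ofReal_one]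
    rw [Complex.real_smul]
    linear_combination ((Real.cos (σ * y) : ℂ) * m y) * e'
  refine ⟨Φ, hΦm, ?_, ?_, ?_, ?_⟩
  · refine integrable_of_radial_bound hN (a := 2) (b := 2) (C := C) hΦm.aestronglyMeasurable
      two_pos two_pos (fun ξ h0 _ => hΦ1 ξ h0) (fun ξ h0 => hΦ2 ξ (by linarith))
  · have hi : Integrable fun ξ => ‖Φ ξ‖ ^ 2 * ((1 + ‖ξ‖) ^ (2 * H + 1) * ‖ξ‖ ^ β) := by
      -- Near 0 the integrand is of order |ξ|^{2(2-N)+β}; 4 - N + β > 0 because β > N - 2H - 1 and H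
      -- < 1. Without the zero of the transform the condition would be 2 - N + β > 0, which can
      -- fail.
      refine integrable_of_radial_bound hN (a := 4 - N + β) (b := 1) (C := 8 * C ^ 2)
        (Measurable.aestronglyMeasurable (by fun_prop)) (by linarith) one_pos
        (fun ξ h0 h1 => ?_) (fun ξ h0 => ?_)
      · rw [Real.norm_of_nonneg (by positivity)]
        have b2 : (1 + ‖ξ‖) ^ (2 * H + 1) ≤ 8 := by
          calc (1 + ‖ξ‖) ^ (2 * H + 1) ≤ 2 ^ (2 * H + 1) :=
                Real.rpow_le_rpow (by positivity) (by linarith) (by linarith)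
            _ ≤ 2 ^ (3 : ℝ) := Real.rpow_le_rpow_of_exponent_le (by norm_num) (by linarith)
            _ = 8 := by norm_num
        calc _ ≤ (C * ‖ξ‖ ^ (2 - N : ℝ)) ^ 2 * (8 * ‖ξ‖ ^ β) := by
              gcongr
              exact hΦ1 ξ h0
          _ = 8 * C ^ 2 * (‖ξ‖ ^ (2 - N : ℝ) * ‖ξ‖ ^ (2 - N : ℝ) * ‖ξ‖ ^ β) := by ring
          _ = _ := by
              rw [← Real.rpow_add h0, ← Real.rpow_add h0]
              congr 2
              ring
      · have h0' : 0 < ‖ξ‖ := by linarith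
        rw [Real.norm_of_nonneg (by positivity)]
        have b2 : (1 + ‖ξ‖) ^ (2 * H + 1) ≤ 8 * ‖ξ‖ ^ (3 : ℝ) := by
          calc (1 + ‖ξ‖) ^ (2 * H + 1) ≤ (1 + ‖ξ‖) ^ (3 : ℝ) :=
                Real.rpow_le_rpow_of_exponent_le (by linarith) (by linarith)
            _ ≤ (2 * ‖ξ‖) ^ (3 : ℝ) := Real.rpow_le_rpow (by positivity) (by linarith) (by norm_num)
            _ = _ := by rw [Real.mul_rpow (by norm_num) h0'.le]; norm_num
        have b3 : ‖ξ‖ ^ β ≤ ‖ξ‖ ^ (N : ℝ) := Real.rpow_le_rpow_of_exponent_le h0.le hβ.2.le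
        calc _ ≤ (C * ‖ξ‖ ^ (-2 - N : ℝ)) ^ 2 * (8 * ‖ξ‖ ^ (3 : ℝ) * ‖ξ‖ ^ (N : ℝ)) := by
              gcongr
              exact hΦ2 ξ h0'
          _ = 8 * C ^ 2 * (‖ξ‖ ^ (-2 - N : ℝ) * ‖ξ‖ ^ (-2 - N : ℝ) *
              (‖ξ‖ ^ (3 : ℝ) * ‖ξ‖ ^ (N : ℝ))) := by ring
          _ = _ := by
              rw [← Real.rpow_add h0', ← Real.rpow_add h0', ← Real.rpow_add h0']
              congr 2
              ring
    have := hi.lintegral_lt_top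
    refine ne_of_lt (lt_of_le_of_lt (le_of_eq ?_) this)
    refine lintegral_congr fun ξ => ?_
    rw [ENNReal.ofReal_mul (p := ‖Φ ξ‖ ^ 2) (by positivity), ENNReal.ofReal_pow (norm_nonneg _),
      ofReal_norm]
  · have h0 := hval 0
    simp only [zero_mul, Real.cos_zero, Complex.ofReal_one, one_mul, mul_zero, neg_zero, hψ0] at h0
    rw [h0]
    have hb : (volume : Measure (E N)).real (Metric.ball 0 1) ≠ 0 := by
      rw [Measure.real, ENNReal.toReal_ne_zero]
      exact ⟨(Metric.measure_ball_pos _ _ one_pos).ne', measure_ball_lt_top.ne⟩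
    have hN' : N ≠ 0 := hN.ne'
    norm_num [hb, hN']
  · intro σ hσ
    have hph : ∀ ξ : E N, phase (σ • (0 : E N)) ξ = 1 := fun ξ => by simp [phase]
    simp only [hph, mul_one, one_mul]
    have h8 : (1 / 8 : ℝ) < |(2 * Real.pi)⁻¹ * σ| := by
      have hpi : (0 : ℝ) < 2 * Real.pi := by positivity
      rw [abs_mul, abs_of_pos (by positivity)]
      have : (1 / 8 : ℝ) < (2 * Real.pi)⁻¹ := by
        rw [one_div]
        exact inv_strictAnti₀ hpi (by linarith [Real.pi_lt_d2])
      calc (1 / 8 : ℝ) < (2 * Real.pi)⁻¹ * 1 := by linarith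
        _ ≤ (2 * Real.pi)⁻¹ * |σ| := by gcongr
    rw [hval, hψz _ h8, hψz _ (by rwa [abs_neg])]
    simp

/-! ### The time integral as an integral over a measure -/

/-- The measure `ρ_H(t - s) dt ds` on `[0, ∞)²`. -/
def timeMeasure (H : ℝ) : Measure (ℝ × ℝ) :=
  if H = 1 / 2 then (volume.restrict (Ici (0 : ℝ))).map fun t => (t, t)
  else ((volume.restrict (Ici (0 : ℝ))).prod (volume.restrict (Ici 0))).withDensity
    fun x => ENNReal.ofReal (|x.1 - x.2| ^ (2 * H - 2))

instance instSFiniteTimeMeasure (H : ℝ) : SFinite (timeMeasure H) := by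
  unfold timeMeasure
  split_ifs <;> infer_instance

/-- A single measure covers both cases for H, so exchanging time and frequency needs only one
argument. -/
lemma timeIntegral_eq_integral {F : Type*} [NormedAddCommGroup F] [NormedSpace ℝ F]
    {H : ℝ} {k : ℝ → ℝ → F}
    (hk : Integrable (fun x : ℝ × ℝ => k x.1 x.2) (timeMeasure H)) :
    timeIntegral H k = ∫ x, k x.1 x.2 ∂timeMeasure H := by
  unfold timeIntegral timeMeasure at *
  split_ifs at * with h
  · rw [integral_map (by fun_prop) hk.1]
  · have hm : Measurable fun x : ℝ × ℝ => ENNReal.ofReal (|x.1 - x.2| ^ (2 * H - 2)) := by fun_prop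
    have ht : ∀ x : ℝ × ℝ, (ENNReal.ofReal (|x.1 - x.2| ^ (2 * H - 2))).toReal =
        |x.1 - x.2| ^ (2 * H - 2) := fun x => ENNReal.toReal_ofReal (by positivity)
    rw [integral_withDensity_eq_integral_toReal_smul hm (by simp)]
    rw [integrable_withDensity_iff_integrable_smul' hm (by simp)] at hk
    simp_rw [ht] at hk ⊢
    rw [integral_prod _ hk]

lemma ae_timeMeasure (H : ℝ) : ∀ᵐ x ∂timeMeasure H, 0 ≤ x.1 ∧ 0 ≤ x.2 := by
  unfold timeMeasure
  split_ifs
  · rw [ae_map_iff (p := fun x : ℝ × ℝ => 0 ≤ x.1 ∧ 0 ≤ x.2) (by fun_prop) ((measurableSet_le measurable_const measurable_fst).inter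
      (measurableSet_le measurable_const measurable_snd))]
    filter_upwards [ae_restrict_mem measurableSet_Ici] with t ht
    exact ⟨ht, ht⟩
  · refine (withDensity_absolutelyContinuous _ _).ae_le ?_
    rw [Measure.prod_restrict]
    exact ae_restrict_mem (measurableSet_Ici.prod measurableSet_Ici)

lemma timeMeasure_Icc_lt_top {H : ℝ} (hH : 1 / 2 ≤ H) (M : ℝ) :
    timeMeasure H (Icc 0 M ×ˢ Icc 0 M) < ∞ := by
  have hms : MeasurableSet (Icc 0 M ×ˢ Icc 0 M) := measurableSet_Icc.prod measurableSet_Icc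
  unfold timeMeasure
  split_ifs with h
  · rw [Measure.map_apply (by fun_prop) hms]
    have : (fun t : ℝ => (t, t)) ⁻¹' (Icc 0 M ×ˢ Icc 0 M) = Icc 0 M := by ext; simp
    rw [this]
    exact lt_of_le_of_lt (Measure.restrict_apply_le _ _) (by simp)
  · have hA : Adm ((Icc 0 M).indicator fun _ => (1 : ℂ)) :=
      ⟨measurable_const.indicator measurableSet_Icc, ⟨1, fun t =>
        (norm_indicator_le_norm_self _ _).trans (by simp)⟩,
        ⟨M, fun t ht => indicator_of_notMem (fun h => absurd h.2 (not_le.2 ht)) _⟩⟩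
    have hi := (hA.integrable_prod hA (p := 2 * H - 2)
      (by have := lt_of_le_of_ne hH (Ne.symm h); linarith)).norm.lintegral_lt_top
    rw [withDensity_apply _ hms, ← lintegral_indicator hms]
    refine lt_of_le_of_lt (lintegral_mono fun x => ?_) hi
    by_cases hx : x ∈ Icc 0 M ×ˢ Icc 0 M
    · rw [indicator_of_mem hx, indicator_of_mem hx.1, indicator_of_mem hx.2]
      simp [abs_of_nonneg (Real.rpow_nonneg (abs_nonneg _) _)]
    · rw [indicator_of_notMem hx]; exact bot_le

lemma integrable_timeMeasure {F : Type*} [NormedAddCommGroup F] {H : ℝ} (hH : 1 / 2 ≤ H)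
    {k : ℝ × ℝ → F} (hm : AEStronglyMeasurable k (timeMeasure H)) {M C : ℝ}
    (hC : ∀ x, ‖k x‖ ≤ C) (hs : ∀ x, M < x.1 ∨ M < x.2 → k x = 0) :
    Integrable k (timeMeasure H) := by
  have hms : MeasurableSet (Icc 0 M ×ˢ Icc 0 M) := measurableSet_Icc.prod measurableSet_Icc
  have hi : Integrable ((Icc 0 M ×ˢ Icc 0 M).indicator fun _ => C) (timeMeasure H) :=
    (integrable_indicator_iff hms).2 (integrableOn_const (timeMeasure_Icc_lt_top hH M).ne)
  refine hi.mono' hm ?_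
  filter_upwards [ae_timeMeasure H] with x hx
  by_cases h : M < x.1 ∨ M < x.2
  · rw [hs x h, norm_zero]
    exact indicator_nonneg (fun _ _ => (norm_nonneg _).trans (hC x)) _
  · rw [not_or, not_lt, not_lt] at h
    rw [indicator_of_mem (show x ∈ Icc 0 M ×ˢ Icc 0 M from ⟨⟨hx.1, h.1⟩, ⟨hx.2, h.2⟩⟩)]
    exact hC x

lemma Adm.integrable_timeMeasure {H : ℝ} (hH : 1 / 2 ≤ H) {A B : ℝ → ℂ} (hA : Adm A)
    (hB : Adm B) :
    Integrable (fun x : ℝ × ℝ => A x.1 * (starRingEnd ℂ) (B x.2)) (timeMeasure H) := by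
  obtain ⟨C, hC⟩ := hA.bdd
  obtain ⟨C', hC'⟩ := hB.bdd
  obtain ⟨M, hM⟩ := hA.supp
  obtain ⟨M', hM'⟩ := hB.supp
  have := hA.meas
  have := hB.meas
  refine StochWave.integrable_timeMeasure hH (Measurable.aestronglyMeasurable (by fun_prop))
    (M := max M M') (C := C * C') (fun x => ?_) fun x hx => ?_
  · rw [norm_mul, RCLike.norm_conj]
    exact mul_le_mul (hC _) (hC' _) (norm_nonneg _) ((norm_nonneg _).trans (hC x.1))
  · rcases hx with h | h
    · rw [hM _ (lt_of_le_of_lt (le_max_left _ _) h), zero_mul]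
    · rw [hM' _ (lt_of_le_of_lt (le_max_right _ _) h), map_zero, mul_zero]

lemma timeIntegral_ofReal (H : ℝ) (k : ℝ → ℝ → ℝ) :
    ((timeIntegral H k : ℝ) : ℂ) = timeIntegral H fun t s => (k t s : ℂ) := by
  unfold timeIntegral
  split_ifs
  · rw [integral_complex_ofReal]
  · rw [← integral_complex_ofReal]
    congr 1
    ext t
    rw [← integral_complex_ofReal]
    congr 1
    ext s
    simp

lemma timeIntegral_self_eq {H : ℝ} (hH : 1 / 2 ≤ H) (hH' : H < 1) {A : ℝ → ℂ} (hA : Adm A) :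
    ∃ r : ℝ, 0 ≤ r ∧ timeIntegral H (fun t s => A t * (starRingEnd ℂ) (A s)) = (r : ℂ) := by
  rcases hH.eq_or_lt with h | h
  · subst h
    refine ⟨∫ t in Ici (0 : ℝ), ‖A t‖ ^ 2, integral_nonneg fun t => by positivity, ?_⟩
    unfold timeIntegral
    rw [if_pos rfl, ← integral_complex_ofReal]
    congr 1
    ext t
    show A t * (starRingEnd ℂ) (A t) = _
    rw [Complex.mul_conj, Complex.normSq_eq_norm_sq]
  · have hc := kerConst_pos hH'
    exact ⟨_, mul_nonneg (by positivity) (integral_nonneg fun z => by positivity),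
      (timeIntegral_eq_feature h hH' hA).2⟩

/-! ### The inner product of test functions in Fourier variables -/

lemma fourier_eq_fourier_smul {N : ℕ} (φ : E N → ℂ) (ξ : E N) :
    fourier φ ξ = 𝓕 φ ((2 * Real.pi)⁻¹ • ξ) := by
  rw [Real.fourier_eq']
  unfold fourier
  congr 1
  ext x
  rw [smul_eq_mul, inner_smul_right]
  congr 2
  push_cast
  field_simp

/-- At the origin |ξ|^{-β} is integrable since β < N; at infinity the Schwartz decay of the
transform takes over. -/
lemma integrable_fourier_mul_density {N : ℕ} {β : ℝ} (hN : 0 < N) (hβ : 0 < β ∧ β < N)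
    {f h : E N → ℝ} (hf : IsSpatialCovariance β f h) (g : 𝓢(E N, ℂ)) :
    Integrable fun ξ => fourier g ξ * (h ξ : ℂ) := by
  have hc : Continuous (fourier g) := by
    have : fourier g = fun ξ => (𝓕 g) ((2 * Real.pi)⁻¹ • ξ) := by
      ext ξ; rw [fourier_eq_fourier_smul, SchwartzMap.fourier_coe]
    rw [this]
    exact (𝓕 g).continuous.comp (by fun_prop)
  obtain ⟨C, hC, hCb⟩ := schwartz_decay (𝓕 g) N
  obtain ⟨C₁, C₂, h1, h2, hcomp⟩ := hf.comparable
  have hπ : 0 < (2 * Real.pi) := by positivity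
  have hb1 : ∀ ξ, ‖fourier g ξ‖ ≤ C := fun ξ => by
    rw [fourier_eq_fourier_smul, ← SchwartzMap.fourier_coe]; exact (hCb _).1
  have hb2 : ∀ ξ, ‖ξ‖ ^ N * ‖fourier g ξ‖ ≤ (2 * Real.pi) ^ N * C := fun ξ => by
    have := (hCb ((2 * Real.pi)⁻¹ • ξ)).2
    rw [SchwartzMap.fourier_coe, ← fourier_eq_fourier_smul, norm_smul, mul_pow, norm_inv,
      Real.norm_of_nonneg hπ.le] at this
    have h3 := mul_le_mul_of_nonneg_left this (show 0 ≤ (2 * Real.pi) ^ N by positivity)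
    refine le_trans (le_of_eq ?_) h3
    rw [inv_pow]
    field_simp
  have hi : Integrable fun ξ => ‖fourier g ξ‖ * ‖ξ‖ ^ (-β) := by
    refine integrable_of_radial_bound hN (a := N - β) (b := β) (C := C + (2 * Real.pi) ^ N * C)
      (Measurable.aestronglyMeasurable (by fun_prop)) (by linarith) hβ.1
      (fun ξ h0 h1 => ?_) fun ξ h1 => ?_
    · rw [Real.norm_of_nonneg (by positivity), show (N : ℝ) - β - N = -β by ring]
      gcongr
      exact (hb1 ξ).trans (le_add_of_nonneg_right (by positivity))
    · have h0 : 0 < ‖ξ‖ := by linarith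
      rw [Real.norm_of_nonneg (by positivity), Real.rpow_sub h0, Real.rpow_natCast, ← mul_div_assoc,
        le_div_iff₀ (by positivity)]
      have := mul_le_mul_of_nonneg_right (hb2 ξ) (show 0 ≤ ‖ξ‖ ^ (-β) by positivity)
      have h3 : 0 ≤ C * ‖ξ‖ ^ (-β) := by positivity
      linarith
  refine (hi.const_mul C₂).mono' (by
    have := hf.measurable_density
    exact Measurable.aestronglyMeasurable (by fun_prop)) ?_
  filter_upwards [hcomp] with ξ hξ
  have : 0 ≤ h ξ := le_trans (by positivity) hξ.1
  rw [norm_mul, Complex.norm_real, Real.norm_of_nonneg this]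
  calc _ ≤ ‖fourier g ξ‖ * (C₂ * ‖ξ‖ ^ (-β)) := by gcongr; exact hξ.2
    _ = _ := by ring

/-- Integrability of f is assumed only against Schwartz functions; a bump equal to 1 on the ball
extracts local integrability. -/
lemma IsSpatialCovariance.integrableOn_closedBall {N : ℕ} {β : ℝ} {f h : E N → ℝ}
    (hf : IsSpatialCovariance β f h) (R : ℝ) : IntegrableOn f (Metric.closedBall 0 R) := by
  have hR : 0 < |R| + 1 := by positivity
  let b : ContDiffBump (0 : E N) := ⟨|R| + 1, |R| + 2, hR, by linarith⟩
  have hb : ContDiff ℝ ((⊤ : ℕ∞) : WithTop ℕ∞) fun x => ((b x : ℝ) : ℂ) :=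
    Complex.ofRealCLM.contDiff.comp b.contDiff
  have hs : HasCompactSupport fun x => ((b x : ℝ) : ℂ) :=
    b.hasCompactSupport.comp_left Complex.ofReal_zero
  have hi := (hf.integrable (hs.toSchwartzMap hb)).re.integrableOn (s := Metric.closedBall 0 R)
  refine hi.congr_fun (fun x hx => ?_) measurableSet_closedBall
  have : b x = 1 := b.one_of_mem_closedBall (Metric.closedBall_subset_closedBall
    (by show R ≤ |R| + 1; linarith [le_abs_self R]) hx)
  change RCLike.re ((f x : ℂ) * ((b x : ℝ) : ℂ)) = f x
  simp [this]

lemma fourier_neg_eq_conj {N : ℕ} (b : E N → ℝ) (ξ : E N) :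
    fourier (fun y => (b (-y) : ℂ)) ξ = (starRingEnd ℂ) (fourier (fun y => (b y : ℂ)) ξ) := by
  unfold fourier
  rw [← integral_conj, ← integral_neg_eq_self]
  congr 1
  ext x
  simp only [neg_neg, map_mul, Complex.conj_ofReal, ← Complex.exp_conj, map_neg, Complex.conj_I,
    inner_neg_left, Complex.ofReal_neg]
  ring_nf

lemma integrable_convolution_kernel {N : ℕ} {β : ℝ} {f h : E N → ℝ}
    (hf : IsSpatialCovariance β f h) {a b : E N → ℝ} (ha : Continuous a) (hb : Continuous b)
    {R : ℝ} (ha' : ∀ x, R < ‖x‖ → a x = 0) (hb' : ∀ x, R < ‖x‖ → b x = 0) {M : ℝ}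
    (haM : ∀ x, |a x| ≤ M) :
    Integrable (fun p : E N × E N => a p.1 * f (p.1 - p.2) * b p.2) ∧
      Integrable (fun p : E N × E N => a (p.1 + p.2) * f p.1 * b p.2) := by
  set F := (Metric.closedBall (0 : E N) (2 * R)).indicator f with hF
  have hFi : Integrable F :=
    (integrable_indicator_iff measurableSet_closedBall).2 (hf.integrableOn_closedBall _)
  have hbi : Integrable b := hb.integrable_of_hasCompactSupport
    (HasCompactSupport.intro (isCompact_closedBall (0 : E N) R) fun x hx =>
      hb' x (by simpa using hx))
  have key : ∀ x y, a x * f (x - y) * b y = a x * (b y * F (x - y)) := by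
    intro x y
    by_cases h1 : R < ‖x‖
    · simp [ha' x h1]
    by_cases h2 : R < ‖y‖
    · simp [hb' y h2]
    rw [hF, indicator_of_mem]
    · ring
    · simp only [Metric.mem_closedBall, dist_zero_right]
      exact (norm_sub_le _ _).trans (by linarith)
  constructor
  · have h1 := (Integrable.convolution_integrand (ContinuousLinearMap.mul ℝ ℝ) hbi hFi).bdd_mul
      (c := M) (f := fun p => a p.1) (Measurable.aestronglyMeasurable (by fun_prop))
      (Eventually.of_forall fun p => haM p.1)
    refine h1.congr (Eventually.of_forall fun p => ?_)
    simp [key]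
  · have h1 := (hFi.mul_prod hbi).bdd_mul
      (c := M) (f := fun p => a (p.1 + p.2)) (Measurable.aestronglyMeasurable (by fun_prop))
      (Eventually.of_forall fun p => haM _)
    refine h1.congr (Eventually.of_forall fun p => ?_)
    have := key (p.1 + p.2) p.2
    simp only [add_sub_cancel_right] at this
    simp only [this]
    ring

/-- Substituting x = y + z, the double integral becomes ∫ f c with c the correlation of a and b.
This c is a Schwartz function, and its transform is the product of one transform and the conjugate
of the other, so `fourier_eq` applies. -/
theorem spatial_pairing {N : ℕ} {β : ℝ} (hN : 0 < N) (hβ : 0 < β ∧ β < N) {f h : E N → ℝ}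
    (hf : IsSpatialCovariance β f h) {a b : E N → ℝ}
    (ha : ContDiff ℝ ((⊤ : ℕ∞) : WithTop ℕ∞) a) (hb : ContDiff ℝ ((⊤ : ℕ∞) : WithTop ℕ∞) b)
    {R : ℝ} (ha' : ∀ x, R < ‖x‖ → a x = 0) (hb' : ∀ x, R < ‖x‖ → b x = 0) :
    Integrable (fun ξ => fourier (fun x => (a x : ℂ)) ξ *
      (starRingEnd ℂ) (fourier (fun x => (b x : ℂ)) ξ) * (h ξ : ℂ)) ∧
    ((∫ x, ∫ y, a x * f (x - y) * b y : ℝ) : ℂ) = ∫ ξ, fourier (fun x => (a x : ℂ)) ξ *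
      (starRingEnd ℂ) (fourier (fun x => (b x : ℂ)) ξ) * (h ξ : ℂ) := by
  have hac : HasCompactSupport a := HasCompactSupport.intro (isCompact_closedBall (0 : E N) R)
    fun x hx => ha' x (by simpa using hx)
  have hbc : HasCompactSupport b := HasCompactSupport.intro (isCompact_closedBall (0 : E N) R)
    fun x hx => hb' x (by simpa using hx)
  have hnc : HasCompactSupport fun y => b (-y) := HasCompactSupport.intro
    (isCompact_closedBall (0 : E N) R) fun x hx => hb' (-x) (by simpa using hx)
  have hA1 : ContDiff ℝ ((⊤ : ℕ∞) : WithTop ℕ∞) fun x => (a x : ℂ) :=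
    Complex.ofRealCLM.contDiff.comp ha
  have hB1 : ContDiff ℝ ((⊤ : ℕ∞) : WithTop ℕ∞) fun x => (b (-x) : ℂ) :=
    Complex.ofRealCLM.contDiff.comp (hb.comp contDiff_neg)
  have hA2 : HasCompactSupport fun x => (a x : ℂ) := hac.comp_left Complex.ofReal_zero
  have hB2 : HasCompactSupport fun x => (b (-x) : ℂ) := hnc.comp_left (g := fun r : ℝ => (r : ℂ))
    Complex.ofReal_zero
  set A : 𝓢(E N, ℂ) := hA2.toSchwartzMap hA1 with hAdef
  set B : 𝓢(E N, ℂ) := hB2.toSchwartzMap hB1 with hBdef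
  have hAa : (A : E N → ℂ) = fun x => (a x : ℂ) := rfl
  have hBb : (B : E N → ℂ) = fun x => (b (-x) : ℂ) := rfl
  set c : 𝓢(E N, ℂ) := SchwartzMap.convolution (ContinuousLinearMap.mul ℂ ℂ) B A with hc
  have hcf : ∀ ξ, fourier c ξ = fourier (fun x => (a x : ℂ)) ξ *
      (starRingEnd ℂ) (fourier (fun x => (b x : ℂ)) ξ) := by
    intro ξ
    have h1 : (c : E N → ℂ) = convolution B A (ContinuousLinearMap.mul ℂ ℂ) volume := by
      ext x; rw [hc, SchwartzMap.convolution_apply]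
    rw [← fourier_neg_eq_conj, ← hAa, ← hBb, fourier_eq_fourier_smul, h1,
      Real.fourier_mul_convolution_eq B.integrable A.integrable, fourier_eq_fourier_smul,
      fourier_eq_fourier_smul, mul_comm]
  have hcv : ∀ z, c z = ((∫ y, a (z + y) * b y : ℝ) : ℂ) := by
    intro z
    rw [hc, SchwartzMap.convolution_apply, convolution_def, ← integral_neg_eq_self,
      ← integral_complex_ofReal]
    congr 1
    ext y
    simp [hAa, hBb, mul_comm]
  obtain ⟨M, hM⟩ := ha.continuous.bounded_above_of_compact_support hac
  obtain ⟨hi1, hi2⟩ := integrable_convolution_kernel hf ha.continuous hb.continuous ha' hb' hM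
  have hi := integrable_fourier_mul_density hN hβ hf c
  have he := hf.fourier_eq c
  simp_rw [hcf] at hi he
  refine ⟨hi, ?_⟩
  rw [← he]
  simp_rw [hcv, ← Complex.ofReal_mul]
  rw [integral_complex_ofReal]
  congr 1
  rw [integral_integral_swap hi1]
  have e1 : ∀ y, ∫ x, a x * f (x - y) * b y = ∫ z, a (z + y) * f z * b y := by
    intro y
    rw [← integral_add_right_eq_self _ y]
    simp
  simp_rw [e1]
  rw [← integral_integral_swap hi2]
  congr 1
  ext z
  rw [← integral_const_mul]
  congr 1
  ext y
  ring

lemma Test.exists_bound {N : ℕ} (φ : Test N) : ∃ R M : ℝ, 0 ≤ M ∧ (∀ p, |φ p| ≤ M) ∧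
    (∀ t x, R < ‖x‖ → φ (t, x) = 0) ∧ (∀ t x, R < |t| → φ (t, x) = 0) := by
  obtain ⟨M, hM⟩ := φ.continuous.bounded_above_of_compact_support φ.hasCompactSupport
  obtain ⟨R, hR⟩ := φ.hasCompactSupport.isCompact.isBounded.subset_closedBall 0
  have h : ∀ p, R < ‖p‖ → φ p = 0 := fun p hp => by
    by_contra h0
    have := hR (subset_tsupport _ h0)
    rw [mem_closedBall_zero_iff] at this
    linarith
  exact ⟨R, M, (abs_nonneg _).trans (hM 0), hM,
    fun t x hx => h _ (lt_of_lt_of_le hx (le_max_right _ _)),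
    fun t x ht => h _ (lt_of_lt_of_le ht (le_max_left _ _))⟩

lemma Test.contDiff_slice {N : ℕ} (φ : Test N) (t : ℝ) :
    ContDiff ℝ ((⊤ : ℕ∞) : WithTop ℕ∞) fun x => φ (t, x) :=
  φ.contDiff.comp (contDiff_const.prodMk contDiff_id)

lemma measurable_testFourier {N : ℕ} (φ : Test N) :
    Measurable fun p : ℝ × E N => testFourier φ p.1 p.2 := by
  have := φ.continuous
  have h : StronglyMeasurable fun q : (ℝ × E N) × E N =>
      Complex.exp (-Complex.I * (inner ℝ q.2 q.1.2 : ℝ)) * (φ (q.1.1, q.2) : ℂ) :=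
    Continuous.stronglyMeasurable (by fun_prop)
  exact h.integral_prod_right.measurable

lemma testFourier_eq_zero {N : ℕ} {φ : Test N} {t : ℝ} (h : ∀ x, φ (t, x) = 0) (ξ : E N) :
    testFourier φ t ξ = 0 := by
  unfold testFourier fourier
  simp [h]

lemma norm_testFourier_le {N : ℕ} {φ : Test N} {t R M : ℝ} (hM : ∀ p, |φ p| ≤ M)
    (hx : ∀ t x, R < ‖x‖ → φ (t, x) = 0) (ξ : E N) :
    ‖testFourier φ t ξ‖ ≤ M * (volume (Metric.closedBall (0 : E N) R)).toReal := by
  unfold testFourier fourier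
  rw [← setIntegral_eq_integral_of_forall_compl_eq_zero (s := Metric.closedBall (0 : E N) R)]
  · refine norm_setIntegral_le_of_norm_le_const measure_closedBall_lt_top fun y _ => ?_
    have := norm_phase y ξ
    unfold phase at this
    rw [norm_mul, this, one_mul, Complex.norm_real]
    exact hM _
  · intro y hy
    simp [hx t y (by simpa using hy)]

lemma measurable_testFourier_time {N : ℕ} (φ : Test N) (ξ : E N) :
    Measurable fun s => testFourier φ s ξ :=
  (measurable_testFourier φ).comp (g := fun p : ℝ × E N => testFourier φ p.1 p.2)
    (f := fun s : ℝ => (s, ξ)) (by fun_prop)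

lemma exists_norm_testFourier_le {N : ℕ} (φ : Test N) (ξ : E N) :
    ∃ M, ∀ t, ‖testFourier φ t ξ‖ ≤ M := by
  obtain ⟨R, M, hM0, hM, hx, ht⟩ := φ.exists_bound
  exact ⟨_, fun t => norm_testFourier_le hM hx ξ⟩

lemma exists_testFourier_eq_zero {N : ℕ} (φ : Test N) (ξ : E N) :
    ∃ M, ∀ t, M < t → testFourier φ t ξ = 0 := by
  obtain ⟨R, M, hM0, hM, hx, ht⟩ := φ.exists_bound
  exact ⟨R, fun t h =>
    testFourier_eq_zero (fun x => ht t x (lt_of_lt_of_le h (le_abs_self t))) ξ⟩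

lemma adm_testFourier {N : ℕ} (φ : Test N) (ξ : E N) : Adm fun s => testFourier φ s ξ :=
  Adm.mk (measurable_testFourier_time φ ξ) (exists_norm_testFourier_le φ ξ)
    (exists_testFourier_eq_zero φ ξ)

/-- The point is uniformity in t, needed to exchange time and frequency. Read back in space, the
integral is controlled by the sup of φ and by ∫ |f| over a ball of radius 2R. -/
lemma integral_norm_sq_testFourier_le {N : ℕ} {β : ℝ} (hN : 0 < N) (hβ : 0 < β ∧ β < N)
    {f h : E N → ℝ} (hf : IsSpatialCovariance β f h) (φ : Test N) :
    ∃ C : ℝ, ∀ t, Integrable (fun ξ => ‖testFourier φ t ξ‖ ^ 2 * h ξ) ∧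
      ∫ ξ, ‖testFourier φ t ξ‖ ^ 2 * h ξ ≤ C := by
  obtain ⟨R, M, hM0, hM, hx, ht⟩ := φ.exists_bound
  set K := Metric.closedBall (0 : E N) R with hK
  set I := ∫ z in Metric.closedBall (0 : E N) (2 * R), |f z| with hI
  refine ⟨M * I * M * (volume K).toReal, fun t => ?_⟩
  obtain ⟨h1, h2⟩ := spatial_pairing hN hβ hf (φ.contDiff_slice t) (φ.contDiff_slice t) (hx t) (hx t)
  have e : ∀ ξ, fourier (fun x => (φ (t, x) : ℂ)) ξ *
      (starRingEnd ℂ) (fourier (fun x => (φ (t, x) : ℂ)) ξ) * (h ξ : ℂ) =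
      ((‖testFourier φ t ξ‖ ^ 2 * h ξ : ℝ) : ℂ) := by
    intro ξ
    rw [Complex.mul_conj, Complex.normSq_eq_norm_sq]
    push_cast
    rfl
  simp_rw [e] at h1 h2
  rw [integral_complex_ofReal, Complex.ofReal_inj] at h2
  refine ⟨by simpa only [RCLike.re_to_complex, Complex.ofReal_re] using h1.re, ?_⟩
  rw [← h2]
  refine (le_abs_self _).trans ?_
  rw [← Real.norm_eq_abs, ← setIntegral_eq_integral_of_forall_compl_eq_zero (s := K)]
  · refine (norm_setIntegral_le_of_norm_le_const measure_closedBall_lt_top fun x hxK => ?_)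
    have hxR : ‖x‖ ≤ R := by simpa [hK] using hxK
    have hle : ∀ y, ‖φ (t, x) * f (x - y) * φ (t, y)‖ ≤
        M * (Metric.closedBall (0 : E N) (2 * R)).indicator (fun z => |f z|) (x - y) * M := by
      intro y
      by_cases hy : R < ‖y‖
      · rw [hx t y hy, mul_zero, norm_zero]
        exact mul_nonneg (mul_nonneg hM0 (indicator_nonneg (fun _ _ => abs_nonneg _) _)) hM0
      · rw [indicator_of_mem, norm_mul, norm_mul]
        · have := hM (t, x)
          have := hM (t, y)
          simp only [Real.norm_eq_abs]
          gcongr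
        · rw [mem_closedBall_zero_iff]
          exact (norm_sub_le _ _).trans (by linarith)
    have hFi : Integrable ((Metric.closedBall (0 : E N) (2 * R)).indicator fun z => |f z|) :=
      (integrable_indicator_iff measurableSet_closedBall).2
        (hf.integrableOn_closedBall _).abs
    calc _ ≤ ∫ y, M * (Metric.closedBall (0 : E N) (2 * R)).indicator (fun z => |f z|) (x - y) * M :=
          norm_integral_le_of_norm_le (((hFi.comp_sub_left x).const_mul M).mul_const M)
            (Eventually.of_forall hle)
      _ = M * I * M := by
          rw [integral_mul_const, integral_const_mul, integral_sub_left_eq_self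
            ((Metric.closedBall (0 : E N) (2 * R)).indicator fun z => |f z|) volume x,
            integral_indicator measurableSet_closedBall]
  · intro x hxK
    simp [hx t x (by simpa [hK] using hxK)]

/-- Apply the spatial pairing at each pair of times, then Fubini. Domination comes from |ab| ≤ |a|²
+ |b|² and the uniform bound on time slices. -/
theorem hpInner_eq {N : ℕ} {H β : ℝ} (hH : 1 / 2 ≤ H) (hN : 0 < N) (hβ : 0 < β ∧ β < N)
    {f h : E N → ℝ} (hf : IsSpatialCovariance β f h) (φ ψ : Test N) :
    Integrable (fun ξ => (timeIntegral H fun t s => testFourier φ t ξ *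
      (starRingEnd ℂ) (testFourier ψ s ξ)) * (h ξ : ℂ)) ∧
    (hpInner H f φ ψ : ℂ) = ∫ ξ, (timeIntegral H fun t s => testFourier φ t ξ *
      (starRingEnd ℂ) (testFourier ψ s ξ)) * (h ξ : ℂ) := by
  obtain ⟨R₁, M₁, hM0₁, hM₁, hx₁, ht₁⟩ := φ.exists_bound
  obtain ⟨R₂, M₂, hM0₂, hM₂, hx₂, ht₂⟩ := ψ.exists_bound
  obtain ⟨C₁, hC₁⟩ := integral_norm_sq_testFourier_le hN hβ hf φ
  obtain ⟨C₂, hC₂⟩ := integral_norm_sq_testFourier_le hN hβ hf ψ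
  have hpos := hf.nonneg
  have hx₁' : ∀ t x, max R₁ R₂ < ‖x‖ → φ (t, x) = 0 := fun t x hx =>
    hx₁ t x (lt_of_le_of_lt (le_max_left _ _) hx)
  have hx₂' : ∀ t x, max R₁ R₂ < ‖x‖ → ψ (t, x) = 0 := fun t x hx =>
    hx₂ t x (lt_of_le_of_lt (le_max_right _ _) hx)
  have hpair := fun t s => spatial_pairing hN hβ hf (φ.contDiff_slice t) (ψ.contDiff_slice s)
    (hx₁' t) (hx₂' s)
  set G : (ℝ × ℝ) × E N → ℂ := fun q => testFourier φ q.1.1 q.2 *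
    (starRingEnd ℂ) (testFourier ψ q.1.2 q.2) * (h q.2 : ℂ) with hG
  have hGm : Measurable G := by
    have h1 := (measurable_testFourier φ).comp
      (show Measurable fun q : (ℝ × ℝ) × E N => (q.1.1, q.2) by fun_prop)
    have h2 := (measurable_testFourier ψ).comp
      (show Measurable fun q : (ℝ × ℝ) × E N => (q.1.2, q.2) by fun_prop)
    have h3 := hf.measurable_density
    simp only [Function.comp_def] at h1 h2
    fun_prop
  have hz₁ : ∀ t ξ, R₁ < t → testFourier φ t ξ = 0 := fun t ξ ht =>
    testFourier_eq_zero (fun x => ht₁ t x (lt_of_lt_of_le ht (le_abs_self t))) ξ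
  have hz₂ : ∀ t ξ, R₂ < t → testFourier ψ t ξ = 0 := fun t ξ ht =>
    testFourier_eq_zero (fun x => ht₂ t x (lt_of_lt_of_le ht (le_abs_self t))) ξ
  have hGz : ∀ x : ℝ × ℝ, max R₁ R₂ < x.1 ∨ max R₁ R₂ < x.2 → ∀ ξ, G (x, ξ) = 0 := by
    intro x hx ξ
    rcases hx with hx | hx
    · simp [hG, hz₁ _ ξ (lt_of_le_of_lt (le_max_left _ _) hx)]
    · simp [hG, hz₂ _ ξ (lt_of_le_of_lt (le_max_right _ _) hx)]
  have hGi : Integrable G ((timeMeasure H).prod volume) := by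
    rw [integrable_prod_iff hGm.aestronglyMeasurable]
    refine ⟨Eventually.of_forall fun x => (hpair x.1 x.2).1, ?_⟩
    refine integrable_timeMeasure hH (M := max R₁ R₂) (C := C₁ + C₂)
      hGm.norm.stronglyMeasurable.integral_prod_right.aestronglyMeasurable (fun x => ?_)
      fun x hx => ?_
    · rw [Real.norm_of_nonneg (integral_nonneg fun _ => norm_nonneg _)]
      refine le_trans ?_ (add_le_add (hC₁ x.1).2 (hC₂ x.2).2)
      rw [← integral_add (hC₁ x.1).1 (hC₂ x.2).1]
      refine integral_mono_ae (hpair x.1 x.2).1.norm ((hC₁ x.1).1.add (hC₂ x.2).1) ?_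
      filter_upwards [hpos] with ξ hξ
      simp only [hG, norm_mul, RCLike.norm_conj, Complex.norm_real, Real.norm_of_nonneg hξ,
        ← add_mul]
      gcongr
      nlinarith [sq_nonneg (‖testFourier φ x.1 ξ‖ - ‖testFourier ψ x.2 ξ‖),
        sq_nonneg ‖testFourier φ x.1 ξ‖, sq_nonneg ‖testFourier ψ x.2 ξ‖]
    · simp [hGz x hx]
  have hT : ∀ ξ, (timeIntegral H fun t s => testFourier φ t ξ *
      (starRingEnd ℂ) (testFourier ψ s ξ)) * (h ξ : ℂ) = ∫ x, G (x, ξ) ∂timeMeasure H := by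
    intro ξ
    rw [timeIntegral_eq_integral ((adm_testFourier φ ξ).integrable_timeMeasure hH
      (adm_testFourier ψ ξ)), ← integral_mul_const]
  simp_rw [hT]
  refine ⟨hGi.integral_prod_right, ?_⟩
  rw [← integral_integral_swap (f := fun x ξ => G (x, ξ)) hGi]
  unfold hpInner
  rw [timeIntegral_ofReal]
  simp_rw [(hpair _ _).2]
  exact timeIntegral_eq_integral (k := fun t s => ∫ ξ, G ((t, s), ξ)) hGi.integral_prod_left

/-- Expand bilinearly at each frequency and integrate. Positivity of the time form allows passing
from the real integral to the `ℝ≥0∞`-valued norm. -/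
theorem hpNormSq_sum_testFourier {N : ℕ} {H β : ℝ} (hH : 1 / 2 ≤ H) (hH' : H < 1) (hN : 0 < N)
    (hβ : 0 < β ∧ β < N) {f h : E N → ℝ} (hf : IsSpatialCovariance β f h) {ι : Type*}
    [Fintype ι] (w : ι → ℝ) (φ : ι → Test N) :
    hpNormSq H h (fun s ξ => ∑ i, (w i : ℂ) * testFourier (φ i) s ξ) =
      ENNReal.ofReal (∑ i, ∑ j, w i * w j * hpInner H f (φ i) (φ j)) := by
  set T : ι → ι → E N → ℂ := fun i j ξ => timeIntegral H fun t s => testFourier (φ i) t ξ *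
    (starRingEnd ℂ) (testFourier (φ j) s ξ) with hT
  set S : E N → ℂ := fun ξ => timeIntegral H fun t s =>
    (∑ i, (w i : ℂ) * testFourier (φ i) t ξ) *
      (starRingEnd ℂ) (∑ i, (w i : ℂ) * testFourier (φ i) s ξ) with hS
  have hadm : ∀ ξ, Adm fun s => ∑ i, (w i : ℂ) * testFourier (φ i) s ξ := fun ξ =>
    Adm.sum Finset.univ fun i _ => (adm_testFourier (φ i) ξ).const_mul _
  have hST : ∀ ξ, S ξ = ∑ i, ∑ j, (w i : ℂ) * w j * T i j ξ := by
    intro ξ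
    have hi := fun i j => (adm_testFourier (φ i) ξ).integrable_timeMeasure hH
      (adm_testFourier (φ j) ξ)
    simp only [hS, hT]
    rw [timeIntegral_eq_integral ((hadm ξ).integrable_timeMeasure hH (hadm ξ))]
    have he := fun i j => timeIntegral_eq_integral
      (k := fun t s => testFourier (φ i) t ξ * (starRingEnd ℂ) (testFourier (φ j) s ξ)) (hi i j)
    simp_rw [he, ← integral_const_mul, ← integral_finsetSum _ fun j _ => (hi _ j).const_mul _]
    rw [← integral_finsetSum _ fun i _ => integrable_finsetSum _ fun j _ => (hi i j).const_mul _]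
    congr 1
    ext x
    rw [map_sum, Finset.sum_mul_sum]
    refine Finset.sum_congr rfl fun i _ => ?_
    refine Finset.sum_congr rfl fun j _ => ?_
    rw [map_mul, Complex.conj_ofReal]
    ring
  have hI : Integrable fun ξ => S ξ * (h ξ : ℂ) := by
    simp_rw [hST, Finset.sum_mul, mul_assoc]
    exact integrable_finsetSum _ fun i _ => integrable_finsetSum _ fun j _ =>
      (((hpInner_eq hH hN hβ hf (φ i) (φ j)).1).const_mul _).const_mul _
  have hE : ∫ ξ, S ξ * (h ξ : ℂ) =
      ((∑ i, ∑ j, w i * w j * hpInner H f (φ i) (φ j) : ℝ) : ℂ) := by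
    simp_rw [hST, Finset.sum_mul, mul_assoc]
    rw [integral_finsetSum _ fun i _ => integrable_finsetSum _ fun j _ =>
      (((hpInner_eq hH hN hβ hf (φ i) (φ j)).1).const_mul _).const_mul _]
    push_cast
    refine Finset.sum_congr rfl fun i _ => ?_
    rw [integral_finsetSum _ fun j _ =>
      (((hpInner_eq hH hN hβ hf (φ i) (φ j)).1).const_mul _).const_mul _]
    refine Finset.sum_congr rfl fun j _ => ?_
    rw [integral_const_mul, integral_const_mul, (hpInner_eq hH hN hβ hf (φ i) (φ j)).2]
  have hre : ∀ ξ, (S ξ * (h ξ : ℂ)).re = (S ξ).re * h ξ := fun ξ => by simp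
  have hI' : Integrable fun ξ => (S ξ).re * h ξ := by simpa [hre] using hI.re
  have hE' : ∫ ξ, (S ξ).re * h ξ = ∑ i, ∑ j, w i * w j * hpInner H f (φ i) (φ j) := by
    have := congrArg Complex.re hE
    rw [Complex.ofReal_re] at this
    rw [← this]
    simpa [hre] using integral_re hI
  rw [← hE', ofReal_integral_eq_lintegral_ofReal hI']
  · rfl
  · filter_upwards [hf.nonneg] with ξ hξ
    obtain ⟨r, hr, he⟩ := timeIntegral_self_eq hH hH' (hadm ξ)
    refine mul_nonneg ?_ hξ
    simp only [hS]
    rw [he]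
    simpa using hr

/-! ### Passing to the limit in the `HP` norm -/

/-- Jointly measurable fields that are admissible in time for almost every frequency. -/
structure AdmField {N : ℕ} (A : ℝ → E N → ℂ) : Prop where
  meas : Measurable fun p : ℝ × E N => A p.1 p.2
  adm : ∀ᵐ ξ, Adm fun s => A s ξ

lemma AdmField.add {N : ℕ} {A B : ℝ → E N → ℂ} (hA : AdmField A) (hB : AdmField B) :
    AdmField fun s ξ => A s ξ + B s ξ :=
  ⟨hA.meas.add hB.meas, by filter_upwards [hA.adm, hB.adm] with ξ h1 h2 using h1.add h2⟩

lemma AdmField.const_mul {N : ℕ} {A : ℝ → E N → ℂ} (hA : AdmField A) (c : ℂ) :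
    AdmField fun s ξ => c * A s ξ :=
  ⟨hA.meas.const_mul c, by filter_upwards [hA.adm] with ξ h1 using h1.const_mul c⟩

lemma AdmField.sub {N : ℕ} {A B : ℝ → E N → ℂ} (hA : AdmField A) (hB : AdmField B) :
    AdmField fun s ξ => A s ξ - B s ξ :=
  ⟨hA.meas.sub hB.meas, by filter_upwards [hA.adm, hB.adm] with ξ h1 h2 using h1.sub h2⟩

lemma AdmField.zero {N : ℕ} : AdmField fun (_ : ℝ) (_ : E N) => (0 : ℂ) :=
  ⟨measurable_const, Eventually.of_forall fun _ => Adm.zero⟩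

lemma AdmField.sum {N : ℕ} {ι : Type*} (s : Finset ι) {A : ι → ℝ → E N → ℂ}
    (hA : ∀ i, AdmField (A i)) : AdmField fun t ξ => ∑ i ∈ s, A i t ξ := by
  classical
  induction s using Finset.induction_on with
  | empty => simpa using AdmField.zero
  | insert i s hi ih => simpa [Finset.sum_insert hi] using (hA i).add ih

lemma admField_testFourier {N : ℕ} (φ : Test N) : AdmField (testFourier φ) :=
  ⟨measurable_testFourier φ, Eventually.of_forall fun ξ => adm_testFourier φ ξ⟩

lemma admField_waveFourier {N : ℕ} (hN : 0 < N) (t : ℝ) (x : E N) :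
    AdmField (waveFourier t x) := by
  refine ⟨?_, by filter_upwards [ae_ne_zero hN] with ξ hξ using adm_waveFourier t x hξ⟩
  have h : Measurable fun p : ℝ × E N => Complex.exp (-Complex.I * (inner ℝ x p.2 : ℝ)) *
      ((Real.sin ((t - p.1) * ‖p.2‖) / ‖p.2‖ : ℝ) : ℂ) := by fun_prop
  exact h.indicator (measurable_fst (measurableSet_Icc (a := (0 : ℝ)) (b := t)))

lemma measurable_energy {N : ℕ} (H : ℝ) {A : ℝ → E N → ℂ}
    (hA : Measurable fun p : ℝ × E N => A p.1 p.2) :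
    Measurable fun ξ => energy H fun s => A s ξ := by
  unfold energy
  split_ifs
  · have h : Measurable fun q : E N × ℝ => ‖A q.2 q.1‖ₑ ^ 2 :=
      ((hA.comp measurable_swap).enorm).pow_const 2
    exact h.lintegral_prod_right'
  · refine Measurable.const_mul ?_ _
    have h1 : Measurable fun q : (E N × (ℝ × ℝ)) × ℝ =>
        (expKernel q.1.2.1 q.1.2.2 q.2 : ℂ) * A q.2 q.1.1 := by
      refine Measurable.mul (Complex.measurable_ofReal.comp ?_)
        (hA.comp (show Measurable fun q : (E N × (ℝ × ℝ)) × ℝ => (q.2, q.1.1) by fun_prop))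
      exact measurable_expKernel.comp
        (show Measurable fun q : (E N × (ℝ × ℝ)) × ℝ => (q.1.2.1, q.1.2.2, q.2) by fun_prop)
    have h2 : Measurable fun q : E N × (ℝ × ℝ) => feature (fun s => A s q.1) q.2 :=
      h1.stronglyMeasurable.integral_prod_right.measurable
    exact (h2.enorm.pow_const 2).lintegral_prod_right'

lemma hpNormSq_add_le {N : ℕ} {H : ℝ} (hH : 1 / 2 ≤ H) (hH' : H < 1) {h : E N → ℝ}
    (hm : Measurable h) (hh : ∀ᵐ ξ, 0 ≤ h ξ) {A B : ℝ → E N → ℂ} (hA : AdmField A)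
    (hB : AdmField B) :
    hpNormSq H h (fun s ξ => A s ξ + B s ξ) ≤ 2 * hpNormSq H h A + 2 * hpNormSq H h B := by
  have hmA := measurable_energy H hA.meas
  have hmB := measurable_energy H hB.meas
  rw [hpNormSq_eq hH hH' hh hA.adm, hpNormSq_eq hH hH' hh hB.adm,
    hpNormSq_eq hH hH' hh (hA.add hB).adm, ← lintegral_const_mul _ (by fun_prop),
    ← lintegral_const_mul _ (by fun_prop), ← lintegral_add_left (by fun_prop)]
  refine lintegral_mono_ae ?_
  filter_upwards [hA.adm, hB.adm] with ξ h1 h2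
  rw [← mul_assoc, ← mul_assoc, ← add_mul]
  gcongr
  exact energy_add_le H h1 h2

lemma hpNormSq_const_mul {N : ℕ} {H : ℝ} (hH : 1 / 2 ≤ H) (hH' : H < 1) {h : E N → ℝ}
    (hh : ∀ᵐ ξ, 0 ≤ h ξ) {A : ℝ → E N → ℂ} (hA : AdmField A) (c : ℂ) :
    hpNormSq H h (fun s ξ => c * A s ξ) = ‖c‖ₑ ^ 2 * hpNormSq H h A := by
  rw [hpNormSq_eq hH hH' hh hA.adm, hpNormSq_eq hH hH' hh (hA.const_mul c).adm,
    ← lintegral_const_mul' _ _ (by simp)]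
  simp_rw [energy_const_mul, mul_assoc]

lemma hpNormSq_zero {N : ℕ} (H : ℝ) (h : E N → ℝ) : hpNormSq H h (fun _ _ => 0) = 0 := by
  unfold hpNormSq timeIntegral
  simp

lemma tendsto_hpNormSq_sum {N : ℕ} {H : ℝ} (hH : 1 / 2 ≤ H) (hH' : H < 1) {h : E N → ℝ}
    (hm : Measurable h) (hh : ∀ᵐ ξ, 0 ≤ h ξ) {ι : Type*} (s : Finset ι) (w : ι → ℝ)
    {B : ι → ℕ → ℝ → E N → ℂ} (hB : ∀ i n, AdmField (B i n))
    (hlim : ∀ i, Tendsto (fun n => hpNormSq H h (B i n)) atTop (𝓝 0)) :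
    Tendsto (fun n => hpNormSq H h fun t ξ => ∑ i ∈ s, (w i : ℂ) * B i n t ξ) atTop (𝓝 0) := by
  classical
  induction s using Finset.induction_on with
  | empty => simp [hpNormSq_zero]
  | insert i s hi ih =>
    have h1 : Tendsto (fun n => 2 * (‖(w i : ℂ)‖ₑ ^ 2 * hpNormSq H h (B i n)) +
        2 * hpNormSq H h fun t ξ => ∑ i ∈ s, (w i : ℂ) * B i n t ξ) atTop (𝓝 0) := by
      have := (ENNReal.Tendsto.const_mul (a := 2)
        (ENNReal.Tendsto.const_mul (a := ‖(w i : ℂ)‖ₑ ^ 2) (hlim i) (Or.inr (by simp)))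
        (Or.inr (by simp))).add (ENNReal.Tendsto.const_mul (a := 2) ih (Or.inr (by simp)))
      simpa using this
    refine tendsto_of_tendsto_of_tendsto_of_le_of_le tendsto_const_nhds h1
      (fun _ => bot_le) fun n => ?_
    simp only [Finset.sum_insert hi]
    refine (hpNormSq_add_le hH hH' hm hh ((hB i n).const_mul _)
      (AdmField.sum s fun i => (hB i n).const_mul _)).trans ?_
    rw [hpNormSq_const_mul hH hH' hh (hB i n)]

/-! ### Limits of Gaussian variables in `L²` -/

lemma integral_sq_eq_norm_toLp {Ω : Type*} [MeasurableSpace Ω] {P : Measure Ω} {X : Ω → ℝ}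
    (hX : MemLp X 2 P) : ∫ ω, X ω ^ 2 ∂P = ‖hX.toLp X‖ ^ 2 := by
  rw [← real_inner_self_eq_norm_sq, L2.inner_def]
  refine integral_congr_ae ?_
  filter_upwards [hX.coeFn_toLp] with ω hω
  rw [hω]
  simp [sq]

lemma tendsto_integral_sq {Ω : Type*} [MeasurableSpace Ω] {P : Measure Ω} {X : ℕ → Ω → ℝ}
    {Y : Ω → ℝ} (hX : ∀ n, MemLp (X n) 2 P) (hY : MemLp Y 2 P)
    (hlim : Tendsto (fun n => eLpNorm (X n - Y) 2 P) atTop (𝓝 0)) :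
    Tendsto (fun n => ∫ ω, X n ω ^ 2 ∂P) atTop (𝓝 (∫ ω, Y ω ^ 2 ∂P)) := by
  have h := (Lp.tendsto_Lp_iff_tendsto_eLpNorm'' X hX Y hY).2 hlim
  rw [integral_sq_eq_norm_toLp hY]
  simp_rw [fun n => integral_sq_eq_norm_toLp (hX n)]
  exact (h.norm).pow 2

lemma tendsto_integral_abs_sub {Ω : Type*} [MeasurableSpace Ω] {P : Measure Ω}
    [IsProbabilityMeasure P] {X : ℕ → Ω → ℝ} {Y : Ω → ℝ} (hX : ∀ n, MemLp (X n) 2 P)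
    (hY : MemLp Y 2 P) (hlim : Tendsto (fun n => eLpNorm (X n - Y) 2 P) atTop (𝓝 0)) :
    Tendsto (fun n => ∫ ω, ‖X n ω - Y ω‖ ∂P) atTop (𝓝 0) := by
  have h1 : Tendsto (fun n => eLpNorm (X n - Y) 1 P) atTop (𝓝 0) :=
    tendsto_of_tendsto_of_tendsto_of_le_of_le tendsto_const_nhds hlim (fun _ => bot_le)
      fun n => eLpNorm_le_eLpNorm_of_exponent_le (by norm_num) ((hX n).sub hY).1
  have h2 := (ENNReal.tendsto_toReal ENNReal.zero_ne_top).comp h1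
  simp only [ENNReal.toReal_zero] at h2
  refine h2.congr fun n => ?_
  rw [Function.comp_apply, eLpNorm_one_eq_lintegral_enorm]
  exact (integral_norm_eq_lintegral_enorm ((hX n).sub hY).1).symm

/-- The characteristic functions converge because x ↦ e^{itx} is Lipschitz, and their explicit
Gaussian form converges because second moments do. -/
theorem hasGaussianLaw_of_tendsto {Ω : Type*} [MeasurableSpace Ω] {P : Measure Ω}
    [IsProbabilityMeasure P] {X : ℕ → Ω → ℝ} {Y : Ω → ℝ} (hX : ∀ n, HasGaussianLaw (X n) P)
    (h0 : ∀ n, ∫ ω, X n ω ∂P = 0) (hY : MemLp Y 2 P)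
    (hlim : Tendsto (fun n => eLpNorm (X n - Y) 2 P) atTop (𝓝 0)) :
    HasGaussianLaw Y P ∧ ∫ ω, Y ω ∂P = 0 := by
  have hX2 := fun n => (hX n).memLp_two
  have hd := tendsto_integral_abs_sub hX2 hY hlim
  have hv := tendsto_integral_sq hX2 hY hlim
  have hYi : Integrable Y P := hY.integrable (by norm_num)
  have hXi := fun n => (hX n).integrable
  have hm : ∫ ω, Y ω ∂P = 0 := by
    have h1 : Tendsto (fun n => ∫ ω, X n ω ∂P) atTop (𝓝 (∫ ω, Y ω ∂P)) := by
      rw [tendsto_iff_norm_sub_tendsto_zero]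
      refine squeeze_zero (fun _ => norm_nonneg _) (fun n => ?_) hd
      rw [← integral_sub (hXi n) hYi]
      exact norm_integral_le_integral_norm _
    simp_rw [h0] at h1
    exact tendsto_nhds_unique h1 tendsto_const_nhds |>.symm ▸ rfl
  refine ⟨(hasGaussianLaw_iff_charFun_map_eq hYi.aemeasurable).2 fun t => ?_, hm⟩
  have var0 : ∀ {Z : Ω → ℝ}, MemLp Z 2 P → ∫ ω, Z ω ∂P = 0 →
      Complex.exp (((∫ ω, inner ℝ t (Z ω) ∂P : ℝ) : ℂ) * Complex.I -
        Var[fun ω => inner ℝ t (Z ω); P] / 2) =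
      Complex.exp (-((t ^ 2 * ∫ ω, Z ω ^ 2 ∂P : ℝ) : ℂ) / 2) := by
    intro Z hZ hZ0
    have e : (fun ω => inner ℝ t (Z ω)) = fun ω => t * Z ω := by ext; simp [mul_comm]
    rw [e, integral_const_mul, hZ0, variance_const_mul,
      variance_of_integral_eq_zero hZ.1.aemeasurable hZ0]
    push_cast
    ring_nf
  have cf : ∀ {Z : Ω → ℝ}, AEMeasurable Z P →
      charFun (P.map Z) t = ∫ ω, Complex.exp (t * Z ω * Complex.I) ∂P := by
    intro Z hZ
    rw [charFun_apply_real, integral_map hZ (by fun_prop)]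
  rw [var0 hY hm, cf hYi.aemeasurable]
  have h1 : Tendsto (fun n => ∫ ω, Complex.exp (t * X n ω * Complex.I) ∂P) atTop
      (𝓝 (∫ ω, Complex.exp (t * Y ω * Complex.I) ∂P)) := by
    have hint : ∀ {Z : Ω → ℝ}, AEMeasurable Z P →
        Integrable (fun ω => Complex.exp (t * Z ω * Complex.I)) P := by
      intro Z hZ
      refine Integrable.of_bound (C := 1) (by fun_prop) (Eventually.of_forall fun ω => ?_)
      rw [← Complex.ofReal_mul, Complex.norm_exp_ofReal_mul_I]
    have hd' := hd.const_mul |t|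
    rw [mul_zero] at hd'
    rw [tendsto_iff_norm_sub_tendsto_zero]
    refine squeeze_zero (fun _ => norm_nonneg _) (fun n => ?_) hd'
    rw [← integral_sub (hint (hXi n).aemeasurable) (hint hYi.aemeasurable), ← integral_const_mul]
    refine (norm_integral_le_integral_norm _).trans
      (integral_mono ((hint (hXi n).aemeasurable).sub (hint hYi.aemeasurable)).norm
        (((hXi n).sub hYi).norm.const_mul _) fun ω => ?_)
    have h2 : ∀ a b : ℝ, ‖Complex.exp (a * Complex.I) - Complex.exp (b * Complex.I)‖ ≤ |a - b| := by
      intro a b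
      have : Complex.exp (a * Complex.I) - Complex.exp (b * Complex.I) =
          Complex.exp (b * Complex.I) * (Complex.exp (Complex.I * ((a - b : ℝ) : ℂ)) - 1) := by
        rw [mul_sub, mul_one, ← Complex.exp_add]
        congr 2
        push_cast; ring
      rw [this, norm_mul, Complex.norm_exp_ofReal_mul_I, one_mul]
      exact Real.norm_exp_I_mul_ofReal_sub_one_le
    have h3 := h2 (t * X n ω) (t * Y ω)
    rw [← mul_sub, abs_mul] at h3
    push_cast at h3
    exact h3
  have h2 : Tendsto (fun n => ∫ ω, Complex.exp (t * X n ω * Complex.I) ∂P) atTop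
      (𝓝 (Complex.exp (-((t ^ 2 * ∫ ω, Y ω ^ 2 ∂P : ℝ) : ℂ) / 2))) := by
    have h3 : ∀ n, ∫ ω, Complex.exp (t * X n ω * Complex.I) ∂P =
        Complex.exp (-((t ^ 2 * ∫ ω, X n ω ^ 2 ∂P : ℝ) : ℂ) / 2) := fun n => by
      rw [← cf (hXi n).aemeasurable, (hX n).charFun_map_eq, var0 (hX2 n) (h0 n)]
    simp_rw [h3]
    have h4 : Continuous fun r : ℝ => Complex.exp (-((t ^ 2 * r : ℝ) : ℂ) / 2) := by fun_prop
    exact (h4.tendsto _).comp hv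
  exact tendsto_nhds_unique h1 h2

/-- Cramér-Wold: a linear functional of a finite marginal is a weighted sum of its coordinates. -/
lemma isGaussianProcess_of_forall_sum {Ω T : Type*} [MeasurableSpace Ω] {P : Measure Ω}
    {X : T → Ω → ℝ} (hm : ∀ t, AEMeasurable (X t) P)
    (h : ∀ (I : Finset T) (w : T → ℝ), HasGaussianLaw (fun ω => ∑ t ∈ I, w t * X t ω) P) :
    IsGaussianProcess X P := by
  classical
  refine ⟨fun I => ⟨isGaussian_of_isGaussian_map fun L => ?_⟩⟩
  have hmI : AEMeasurable (fun ω => I.restrict (X · ω)) P :=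
    aemeasurable_pi_lambda _ fun i => hm i
  rw [AEMeasurable.map_map_of_aemeasurable (by fun_prop) hmI]
  have := (h I fun t => if ht : t ∈ I then L (Pi.single ⟨t, ht⟩ 1) else 0).isGaussian_map
  convert this using 2
  ext ω
  simp only [Function.comp_apply]
  conv_lhs => rw [← Finset.univ_sum_single (I.restrict (X · ω)), map_sum]
  rw [← Finset.sum_coe_sort I]
  refine Finset.sum_congr rfl fun i _ => ?_
  rw [dif_pos i.2]
  have : Pi.single (M := fun _ : I => ℝ) i (I.restrict (X · ω) i) =
      X i ω • Pi.single (M := fun _ : I => ℝ) i 1 := by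
    rw [← Pi.single_smul]; simp
  rw [this, map_smul, smul_eq_mul, mul_comm]

lemma IsGaussianProcess.hasGaussianLaw_sum_mul {Ω T : Type*} [MeasurableSpace Ω] {P : Measure Ω}
    {X : T → Ω → ℝ} (hX : IsGaussianProcess X P) (I : Finset T) (w : T → ℝ) :
    HasGaussianLaw (fun ω => ∑ t ∈ I, w t * X t ω) P :=
  (hX.smul w).hasGaussianLaw_fun_sum

/-! ### The solution as a Gaussian process -/

section Solution

variable {N d : ℕ} {H β : ℝ} {f h : E N → ℝ} {Ω : Type*} [MeasurableSpace Ω] {P : Measure Ω}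
  {W : Fin d → Test N → Ω → ℝ} {u : ℝ → E N → Ω → E d}

/-- Joint Gaussianity across components comes from independence: a linear combination splits into d
independent Gaussian sums. -/
lemma IsNoise.isGaussianProcess (hW : IsNoise P H f W) :
    IsGaussianProcess (fun q : Fin d × Test N => W q.1 q.2) P := by
  classical
  refine isGaussianProcess_of_forall_sum (fun q => (hW.measurable q.1 q.2).aemeasurable)
    fun I w => ?_
  set J := I.image Prod.snd with hJ
  -- Extending the weights by zero to a product set lets the sum be grouped by component.
  set c : Fin d × Test N → ℝ := fun q => if q ∈ I then w q else 0 with hc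
  have e : (fun ω => ∑ q ∈ I, w q * W q.1 q.2 ω) =
      fun ω => ∑ j, ∑ φ ∈ J, c (j, φ) * W j φ ω := by
    ext ω
    rw [← Finset.sum_product' (f := fun j φ => c (j, φ) * W j φ ω)]
    have hsub : I ⊆ Finset.univ ×ˢ J := fun q hq => by
      rw [Finset.mem_product]
      exact ⟨Finset.mem_univ _, Finset.mem_image_of_mem _ hq⟩
    rw [← Finset.sum_subset hsub fun q _ hq => by simp [hc, hq]]
    exact Finset.sum_congr rfl fun q hq => by simp [hc, hq]
  rw [e]
  have hi : iIndepFun (fun j ω => ∑ φ ∈ J, c (j, φ) * W j φ ω) P :=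
    hW.indep.comp (fun j x => ∑ φ ∈ J, c (j, φ) * x φ) fun j => by fun_prop
  exact (iIndepFun.hasGaussianLaw
    (fun j => IsGaussianProcess.hasGaussianLaw_sum_mul (hW.gaussian j) J fun φ => c (j, φ))
    hi).fun_sum

/-- The components of the solution, frozen at time `0` for negative times. -/
def field (u : ℝ → E N → Ω → E d) (q : Fin d × (ℝ × E N)) (ω : Ω) : ℝ :=
  u (max q.2.1 0) q.2.2 ω q.1

lemma IsSolution.field (hu : IsSolution P H h W u) (q : Fin d × (ℝ × E N)) :
    IsWienerIntegral P H h (W q.1) (waveFourier (max q.2.1 0) q.2.2) (field u q) :=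
  hu q.1 _ _ (le_max_right _ _)

lemma eLpNorm_sum_sub_tendsto {ι : Type*} (I : Finset ι) (w : ι → ℝ) {X : ι → ℕ → Ω → ℝ}
    {Y : ι → Ω → ℝ} (hX : ∀ i n, MemLp (X i n) 2 P) (hY : ∀ i, MemLp (Y i) 2 P)
    (hlim : ∀ i, Tendsto (fun n => eLpNorm (X i n - Y i) 2 P) atTop (𝓝 0)) :
    Tendsto (fun n => eLpNorm ((fun ω => ∑ i ∈ I, w i * X i n ω) -
      fun ω => ∑ i ∈ I, w i * Y i ω) 2 P) atTop (𝓝 0) := by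
  have h1 : Tendsto (fun n => ∑ i ∈ I, ‖w i‖ₑ * eLpNorm (X i n - Y i) 2 P) atTop (𝓝 0) := by
    have := tendsto_finsetSum I fun i _ => ENNReal.Tendsto.const_mul (a := ‖w i‖ₑ) (hlim i)
      (Or.inr (by simp))
    simpa using this
  refine tendsto_of_tendsto_of_tendsto_of_le_of_le tendsto_const_nhds h1 (fun _ => bot_le)
    fun n => ?_
  have e : ((fun ω => ∑ i ∈ I, w i * X i n ω) - fun ω => ∑ i ∈ I, w i * Y i ω) =
      ∑ i ∈ I, w i • (X i n - Y i) := by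
    ext ω
    simp [Finset.sum_apply, mul_sub]
  rw [e]
  refine (eLpNorm_sum_le (fun i _ => (((hX i n).sub (hY i)).const_smul (w i)).1)
    (by norm_num)).trans (Finset.sum_le_sum fun i _ => ?_)
  rw [eLpNorm_const_smul]

lemma memLp_sum_mul {ι : Type*} (I : Finset ι) (w : ι → ℝ) {Y : ι → Ω → ℝ}
    (hY : ∀ i, MemLp (Y i) 2 P) : MemLp (fun ω => ∑ i ∈ I, w i * Y i ω) 2 P :=
  memLp_finsetSum I fun i _ => (hY i).const_mul (w i)

/-- Combinations of solution values are L² limits of combinations of noise values, and centred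
Gaussian laws are closed under such limits. -/
theorem IsSolution.isGaussianProcess [IsProbabilityMeasure P] (hW : IsNoise P H f W)
    (hu : IsSolution P H h W u) :
    IsGaussianProcess (StochWave.field u) P ∧ ∀ q, ∫ ω, StochWave.field u q ω ∂P = 0 := by
  have hY := fun q => (hu.field q).1
  choose φ hφ1 hφ2 using fun q => (hu.field q).2
  have hX : ∀ q n, MemLp (W q.1 (φ q n)) 2 P := fun q n =>
    ((hW.gaussian q.1).hasGaussianLaw_eval _).memLp_two
  have hG := hW.isGaussianProcess
  constructor
  · refine isGaussianProcess_of_forall_sum (fun q => (hY q).1.aemeasurable) fun I w => ?_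
    refine (hasGaussianLaw_of_tendsto (X := fun n ω => ∑ q ∈ I, w q * W q.1 (φ q n) ω)
      (fun n => ?_) (fun n => ?_) (memLp_sum_mul I w hY)
      (eLpNorm_sum_sub_tendsto I w hX hY hφ2)).1
    · exact IsGaussianProcess.hasGaussianLaw_sum_mul
        (hG.comp_right fun q : Fin d × (ℝ × E N) => (q.1, φ q n)) I w
    · rw [integral_finsetSum _ fun q _ => ((hX q n).integrable (by norm_num)).const_mul _]
      refine Finset.sum_eq_zero fun q _ => ?_
      rw [integral_const_mul, hW.mean_zero, mul_zero]
  · intro q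
    exact (hasGaussianLaw_of_tendsto (fun n => (hW.gaussian q.1).hasGaussianLaw_eval (φ q n))
      (fun n => hW.mean_zero _ _) (hY q) (hφ2 q)).2

/-- For the approximating test functions the variance is the `HP` norm. The inequality
`hpNormSq_add_le` carries this to the limit at the price of a factor 2 in each direction. -/
theorem IsSolution.integral_sq_sum [IsProbabilityMeasure P] (hH : 1 / 2 ≤ H ∧ H < 1)
    (hN : 0 < N) (hβ : 0 < β ∧ β < N) (hf : IsSpatialCovariance β f h) (hW : IsNoise P H f W)
    (hu : IsSolution P H h W u) (j : Fin d) {ι : Type*} [Fintype ι] (w : ι → ℝ)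
    (p : ι → ℝ × E N) :
    ENNReal.ofReal (∫ ω, (∑ i, w i * StochWave.field u (j, p i) ω) ^ 2 ∂P) ≤
      2 * hpNormSq H h (fun s ξ => ∑ i, (w i : ℂ) * waveFourier (max (p i).1 0) (p i).2 s ξ) ∧
    hpNormSq H h (fun s ξ => ∑ i, (w i : ℂ) * waveFourier (max (p i).1 0) (p i).2 s ξ) ≤
      2 * ENNReal.ofReal (∫ ω, (∑ i, w i * StochWave.field u (j, p i) ω) ^ 2 ∂P) := by
  have hY := fun i => (hu.field (j, p i)).1
  choose φ hφ1 hφ2 using fun i => (hu.field (j, p i)).2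
  have hX : ∀ i n, MemLp (W j (φ i n)) 2 P := fun i n =>
    ((hW.gaussian j).hasGaussianLaw_eval _).memLp_two
  set A : ℝ → E N → ℂ := fun s ξ => ∑ i, (w i : ℂ) * waveFourier (max (p i).1 0) (p i).2 s ξ
    with hA
  set B : ℕ → ℝ → E N → ℂ := fun n s ξ => ∑ i, (w i : ℂ) * testFourier (φ i n) s ξ with hB
  have hAa : AdmField A := AdmField.sum _ fun i => (admField_waveFourier hN _ _).const_mul _
  have hBa : ∀ n, AdmField (B n) := fun n =>
    AdmField.sum _ fun i => (admField_testFourier _).const_mul _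
  have hD := tendsto_hpNormSq_sum hH.1 hH.2 hf.measurable_density hf.nonneg Finset.univ w
    (B := fun i n s ξ => testFourier (φ i n) s ξ - waveFourier (max (p i).1 0) (p i).2 s ξ)
    (fun i n => (admField_testFourier _).sub (admField_waveFourier hN _ _)) hφ1
  have hDe : ∀ n, (fun s ξ => ∑ i, (w i : ℂ) * (testFourier (φ i n) s ξ -
      waveFourier (max (p i).1 0) (p i).2 s ξ)) = fun s ξ => B n s ξ - A s ξ := by
    intro n
    ext s ξ
    simp only [hB, hA, mul_sub, Finset.sum_sub_distrib]
  simp_rw [hDe] at hD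
  have hBn : ∀ n, hpNormSq H h (B n) =
      ENNReal.ofReal (∫ ω, (∑ i, w i * W j (φ i n) ω) ^ 2 ∂P) := by
    intro n
    simp only [hB]
    rw [hpNormSq_sum_testFourier hH.1 hH.2 hN hβ hf]
    congr 1
    have hint : ∀ i k, Integrable (fun ω => w i * W j (φ i n) ω * (w k * W j (φ k n) ω)) P :=
      fun i k => ((hX i n).const_mul (w i)).integrable_mul ((hX k n).const_mul (w k))
    simp_rw [sq, Finset.sum_mul_sum]
    rw [integral_finsetSum _ fun i _ => integrable_finsetSum _ fun k _ => hint i k]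
    refine Finset.sum_congr rfl fun i _ => ?_
    rw [integral_finsetSum _ fun k _ => hint i k]
    refine Finset.sum_congr rfl fun k _ => ?_
    rw [← hW.covariance j, ← integral_const_mul]
    congr 1
    ext ω
    ring
  have hlim : Tendsto (fun n => hpNormSq H h (B n)) atTop
      (𝓝 (ENNReal.ofReal (∫ ω, (∑ i, w i * StochWave.field u (j, p i) ω) ^ 2 ∂P))) := by
    simp_rw [hBn]
    exact (ENNReal.continuous_ofReal.tendsto _).comp
      (tendsto_integral_sq (fun n => memLp_sum_mul Finset.univ w fun i => hX i n)
        (memLp_sum_mul Finset.univ w hY) (eLpNorm_sum_sub_tendsto Finset.univ w hX hY hφ2))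
  constructor
  · have h1 : Tendsto (fun n => 2 * hpNormSq H h (fun s ξ => B n s ξ - A s ξ) +
        2 * hpNormSq H h A) atTop (𝓝 (2 * 0 + 2 * hpNormSq H h A)) :=
      (ENNReal.Tendsto.const_mul hD (Or.inr (by simp))).add_const _
    rw [mul_zero, zero_add] at h1
    refine le_of_tendsto_of_tendsto' hlim h1 fun n => ?_
    have h2 := hpNormSq_add_le hH.1 hH.2 hf.measurable_density hf.nonneg ((hBa n).sub hAa) hAa
    simpa using h2
  · have h1 : Tendsto (fun n => 2 * hpNormSq H h (fun s ξ => B n s ξ - A s ξ) +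
        2 * hpNormSq H h (B n)) atTop (𝓝 (2 * 0 + 2 *
          (ENNReal.ofReal (∫ ω, (∑ i, w i * StochWave.field u (j, p i) ω) ^ 2 ∂P)))) :=
      (ENNReal.Tendsto.const_mul hD (Or.inr (by simp))).add
        (ENNReal.Tendsto.const_mul hlim (Or.inr (by simp)))
    rw [mul_zero, zero_add] at h1
    refine ge_of_tendsto' h1 fun n => ?_
    have h2 := hpNormSq_add_le hH.1 hH.2 hf.measurable_density hf.nonneg
      (((hBa n).sub hAa).const_mul (-1)) (hBa n)
    rw [hpNormSq_const_mul hH.1 hH.2 hf.nonneg ((hBa n).sub hAa)] at h2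
    simpa using h2

end Solution

/-! ### Variance bounds for the solution -/

section Variance

variable {N d : ℕ} {H β : ℝ} {f h : E N → ℝ} {Ω : Type*} [MeasurableSpace Ω] {P : Measure Ω}
  {W : Fin d → Test N → Ω → ℝ} {u : ℝ → E N → Ω → E d}

lemma two_mul_ofReal (x : ℝ) : 2 * ENNReal.ofReal x = ENNReal.ofReal (2 * x) := by
  rw [ENNReal.ofReal_mul (by norm_num)]
  simp

/-- Negative times are allowed because `field` freezes them at 0, and t ↦ max t 0 does not increase
`rho`. -/
theorem IsSolution.integral_sq_sub_le [IsProbabilityMeasure P] (hH : 1 / 2 ≤ H ∧ H < 1)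
    (hN : 0 < N) (hβ : 0 < β ∧ β < N)
    (hβH : (N : ℝ) - 2 * H - 1 < β ∧ β < (N : ℝ) - 2 * H + 1)
    (hf : IsSpatialCovariance β f h) (hW : IsNoise P H f W)
    (hu : IsSolution P H h W u) {T D : ℝ} (hT : 0 < T) (hD : 0 < D) :
    ∃ C : ℝ, 0 < C ∧ ∀ (j : Fin d) (p q : ℝ × E N), p.1 ≤ T → q.1 ≤ T → rho p q ≤ D →
      ∫ ω, (StochWave.field u (j, p) ω - StochWave.field u (j, q) ω) ^ 2 ∂P ≤
        C * rho p q ^ (2 * H + 1 - N + β) := by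
  obtain ⟨C, hC, hb⟩ := hpNormSq_waveFourier_sub_le hH hβ hβH hf hT hD
  refine ⟨2 * C, by positivity, fun j p q hp hq hpq => ?_⟩
  set p' : ℝ × E N := (max p.1 0, p.2) with hp'
  set q' : ℝ × E N := (max q.1 0, q.2) with hq'
  have hr : rho p' q' ≤ rho p q := by
    unfold rho
    simp only [hp', hq']
    exact add_le_add_left (abs_max_sub_max_le_abs p.1 q.1 (0 : ℝ)) _
  have h1 := (hu.integral_sq_sum hH hN hβ hf hW j ![1, -1] ![p, q]).1
  have h2 := hb (max p.1 0) (max q.1 0) p.2 q.2 (le_max_right _ _) (le_max_right _ _)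
    (max_le hq hT.le) (max_le hp hT.le) (hr.trans hpq)
  simp only [Fin.sum_univ_two, Matrix.cons_val_zero, Matrix.cons_val_one, Complex.ofReal_one,
    Complex.ofReal_neg, one_mul, neg_mul, ← sub_eq_add_neg] at h1
  have h3 : ENNReal.ofReal (∫ ω, (StochWave.field u (j, p) ω - StochWave.field u (j, q) ω) ^ 2 ∂P) ≤
      ENNReal.ofReal (2 * C * rho p q ^ (2 * H + 1 - N + β)) := by
    refine h1.trans ((mul_le_mul_right h2 2).trans ?_)
    rw [two_mul_ofReal, mul_assoc]
    refine ENNReal.ofReal_le_ofReal ?_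
    have : 0 ≤ rho p' q' := rho_nonneg _ _
    have hg : 0 ≤ 2 * H + 1 - N + β := by linarith [hβH.1]
    gcongr
  have h0 : 0 ≤ 2 * C * rho p q ^ (2 * H + 1 - N + β) :=
    mul_nonneg (by positivity) (Real.rpow_nonneg (rho_nonneg _ _) _)
  exact (ENNReal.ofReal_le_ofReal_iff h0).1 h3

/-- Arbitrary weights make this a lower bound for the conditional variance at p given points of the
line at distance at least δ. -/
theorem IsSolution.integral_sq_add_ge [IsProbabilityMeasure P] (hH : 1 / 2 ≤ H ∧ H < 1)
    (hN : 0 < N) (hβ : 0 < β ∧ β < N)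
    (hf : IsSpatialCovariance β f h) (hW : IsNoise P H f W)
    (hu : IsSolution P H h W u) {a : ℝ} (ha : 0 < a) {D : ℝ × E N}
    {Φ : E N → ℂ} (hΦ : IsProfile H β D Φ) :
    ∃ c : ℝ, 0 < c ∧ ∀ (j : Fin d) (ι : Type) [Fintype ι] (w σ : ι → ℝ) (p : ℝ × E N) (δ : ℝ),
      0 < δ → δ ≤ 1 → a ≤ p.1 → (∀ i, a ≤ p.1 + σ i * D.1) → (∀ i, δ ≤ |σ i|) →
      c * δ ^ (2 * H + 1 - N + β) ≤ ∫ ω, (StochWave.field u (j, p) ω +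
        ∑ i, w i * StochWave.field u (j, p + σ i • D) ω) ^ 2 ∂P := by
  obtain ⟨c, hc, hb⟩ := hΦ.hpNormSq_ge hH hN hf ha
  refine ⟨c / 2, by positivity, fun j ι _ w σ p δ hδ hδ1 hp hpi hσ => ?_⟩
  have h1 := (hu.integral_sq_sum hH hN hβ hf hW j (ι := Option ι) (fun o => o.elim 1 w)
    (fun o => o.elim p fun i => p + σ i • D)).2
  have h2 := hb ι w σ p.1 p.2 δ hδ hδ1 hp hpi hσ
  simp only [Fintype.sum_option, Option.elim, Complex.ofReal_one, one_mul, Prod.fst_add,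
    Prod.snd_add, Prod.smul_fst, Prod.smul_snd, smul_eq_mul] at h1
  have e1 : max p.1 0 = p.1 := max_eq_left (by linarith)
  have e2 : ∀ i, max (p.1 + σ i * D.1) 0 = p.1 + σ i * D.1 := fun i =>
    max_eq_left (by linarith [hpi i])
  simp only [e1, e2] at h1
  have h3 := h2.trans h1
  rw [two_mul_ofReal] at h3
  have h4 := (ENNReal.ofReal_le_ofReal_iff
    (mul_nonneg (by norm_num) (integral_nonneg fun ω => sq_nonneg _))).1 h3
  linarith

end Variance

/-! ### Gaussian estimates -/

section Gaussian

variable {Ω : Type*} [MeasurableSpace Ω] {P : Measure Ω}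

lemma map_eq_gaussianReal_zero {X : Ω → ℝ} (hX : HasGaussianLaw X P) (h0 : ∫ ω, X ω ∂P = 0) :
    P.map X = gaussianReal 0 (∫ ω, X ω ^ 2 ∂P).toNNReal := by
  rw [hX.map_eq_gaussianReal, h0, variance_of_integral_eq_zero hX.aemeasurable h0]

/-- Chernoff's bound with variance proxy s; using a proxy instead of the variance also admits
degenerate variables. -/
lemma measure_abs_ge_le [IsProbabilityMeasure P] {X : Ω → ℝ} (hX : HasGaussianLaw X P) (h0 : ∫ ω, X ω ∂P = 0) {s l : ℝ}
    (hs : 0 < s) (hv : ∫ ω, X ω ^ 2 ∂P ≤ s) (hl : 0 ≤ l) :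
    P {ω | l ≤ |X ω|} ≤ ENNReal.ofReal (2 * Real.exp (-l ^ 2 / (2 * s))) := by
  have hmap := map_eq_gaussianReal_zero hX h0
  have hv0 : 0 ≤ ∫ ω, X ω ^ 2 ∂P := integral_nonneg fun _ => sq_nonneg _
  have hsub : HasSubgaussianMGF X s.toNNReal P := by
    refine ⟨fun t => ?_, fun t => ?_⟩
    · have h1 := integrable_exp_mul_gaussianReal (μ := 0) (v := (∫ ω, X ω ^ 2 ∂P).toNNReal) t
      rw [← hmap, integrable_map_measure (by fun_prop) hX.aemeasurable] at h1
      exact h1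
    · rw [mgf_gaussianReal hmap, Real.coe_toNNReal _ hv0, zero_mul, zero_add]
      rw [Real.coe_toNNReal _ hs.le]
      gcongr
  have h1 := hsub.measure_ge_le hl
  have h2 := hsub.neg.measure_ge_le hl
  have hu : {ω | l ≤ |X ω|} ⊆ {ω | l ≤ X ω} ∪ {ω | l ≤ (-X) ω} := fun ω hω => by
    have hω : l ≤ |X ω| := hω
    rcases le_abs.1 hω with h | h
    · exact Or.inl h
    · exact Or.inr h
  have h3 : P.real {ω | l ≤ |X ω|} ≤ 2 * Real.exp (-l ^ 2 / (2 * s)) := by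
    refine (measureReal_mono hu).trans ((measureReal_union_le _ _).trans ?_)
    rw [Real.coe_toNNReal _ hs.le] at h1 h2
    linarith
  rw [← ofReal_measureReal]
  exact ENNReal.ofReal_le_ofReal h3

/-- A lower bound for the standard Gaussian tail. -/
def tailBound (x : ℝ) : ℝ := (√(2 * Real.pi))⁻¹ * Real.exp (-(x + 1) ^ 2 / 2)

lemma tailBound_le_one {x : ℝ} : tailBound x ≤ 1 := by
  have h1 : 1 ≤ √(2 * Real.pi) := Real.one_le_sqrt.2 (by linarith [Real.pi_gt_three])
  have h2 : Real.exp (-(x + 1) ^ 2 / 2) ≤ 1 :=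
    Real.exp_le_one_iff.2 (by nlinarith [sq_nonneg (x + 1)])
  exact mul_le_one₀ (inv_le_one_of_one_le₀ h1) (Real.exp_pos _).le h2

/-- With r the standard deviation, the density on (xr, (x+1)r] is at least its value at the right
end, and r ≥ s places this window inside the tail. -/
lemma tailBound_le_measure {X : Ω → ℝ} (hX : HasGaussianLaw X P) (h0 : ∫ ω, X ω ∂P = 0)
    {s x : ℝ} (hs : 0 < s) (hv : s ^ 2 ≤ ∫ ω, X ω ^ 2 ∂P) (hx : 0 ≤ x) :
    ENNReal.ofReal (tailBound x) ≤ P {ω | x * s < X ω} := by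
  set v := ∫ ω, X ω ^ 2 ∂P with hvdef
  have hv0 : 0 < v := lt_of_lt_of_le (by positivity) hv
  set r := √v with hr
  have hr0 : 0 < r := Real.sqrt_pos.2 hv0
  have hr2 : r ^ 2 = v := Real.sq_sqrt hv0.le
  have hsr : s ≤ r := Real.le_sqrt_of_sq_le hv
  have hmap := map_eq_gaussianReal_zero hX h0
  have hvn : v.toNNReal ≠ 0 := (Real.toNNReal_pos.2 hv0).ne'
  have h1 : P {ω | x * s < X ω} = gaussianReal 0 v.toNNReal (Ioi (x * s)) := by
    rw [← hmap, Measure.map_apply_of_aemeasurable hX.aemeasurable measurableSet_Ioi]; rfl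
  rw [h1, gaussianReal_apply _ hvn]
  calc ENNReal.ofReal (tailBound x)
      = ∫⁻ y in Ioc (x * r) ((x + 1) * r), gaussianPDF 0 v.toNNReal ((x + 1) * r) := by
        rw [setLIntegral_const, Real.volume_Ioc, gaussianPDF, gaussianPDFReal,
          ← ENNReal.ofReal_mul (by positivity), Real.coe_toNNReal _ hv0.le, tailBound]
        congr 1
        rw [Real.sqrt_mul (show 0 ≤ 2 * Real.pi by positivity) v, ← hr, sub_zero, mul_pow, hr2,
          show -((x + 1) ^ 2 * v) / (2 * v) = -(x + 1) ^ 2 / 2 by field_simp]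
        field_simp
        ring
    _ ≤ ∫⁻ y in Ioc (x * r) ((x + 1) * r), gaussianPDF 0 v.toNNReal y := by
        refine setLIntegral_mono (by fun_prop) fun y hy => ?_
        have hy0 : 0 ≤ y := le_trans (by positivity) hy.1.le
        unfold gaussianPDF gaussianPDFReal
        refine ENNReal.ofReal_le_ofReal ?_
        gcongr
        simpa using hy.2
    _ ≤ ∫⁻ y in Ioi (x * s), gaussianPDF 0 v.toNNReal y := by
        refine lintegral_mono_set fun y hy => lt_of_le_of_lt ?_ hy.1
        gcongr

/-- Freeze Y. Whatever the sign of S(Y), one of the events R > l and R < -l forces |S(Y) + R| > l,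
and each has probability at least q independently of Y. -/
lemma measure_inter_abs_add_le [IsProbabilityMeasure P] {κ : Type*} {Y : Ω → κ → ℝ} {R : Ω → ℝ} (hY : AEMeasurable Y P)
    (hR : AEMeasurable R P) (hi : IndepFun Y R P) {A : Set (κ → ℝ)} (hA : MeasurableSet A)
    {S : (κ → ℝ) → ℝ} (hS : Measurable S) {l : ℝ} {q : ℝ≥0∞}
    (h1 : q ≤ P {ω | l < R ω}) (h2 : q ≤ P {ω | l < -R ω}) :
    P {ω | Y ω ∈ A ∧ |S (Y ω) + R ω| ≤ l} ≤ P {ω | Y ω ∈ A} * (1 - q) := by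
  have hmap := (indepFun_iff_map_prod_eq_prod_map_map hY hR).1 hi
  set B : Set ((κ → ℝ) × ℝ) := {z | z.1 ∈ A ∧ |S z.1 + z.2| ≤ l} with hB
  have hBm : MeasurableSet B :=
    (measurable_fst hA).inter (measurableSet_le
      (((hS.comp measurable_fst).add measurable_snd).abs) measurable_const)
  have hq : ∀ y, P.map R {r | |S y + r| ≤ l} ≤ 1 - q := by
    intro y
    have hm : MeasurableSet {r : ℝ | |S y + r| ≤ l} :=
      measurableSet_le (by fun_prop) measurable_const
    rw [Measure.map_apply_of_aemeasurable hR hm]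
    have hq1 : q ≠ ∞ := (h1.trans_lt (measure_lt_top _ _)).ne
    rw [ENNReal.le_sub_iff_add_le_right hq1 (h1.trans prob_le_one)]
    rcases le_total 0 (S y) with h | h
    · have hnm : NullMeasurableSet {ω | l < R ω} P := nullMeasurableSet_lt (by fun_prop) hR
      refine (add_le_add_right h1 _).trans ?_
      rw [← measure_union₀ hnm]
      · exact prob_le_one
      · refine Disjoint.aedisjoint (Set.disjoint_left.2 fun ω hω hω' => ?_)
        have a1 : |S y + R ω| ≤ l := hω
        have a2 : l < R ω := hω'
        linarith [le_abs_self (S y + R ω)]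
    · have hnm : NullMeasurableSet {ω | l < -R ω} P := nullMeasurableSet_lt (by fun_prop) hR.neg
      refine (add_le_add_right h2 _).trans ?_
      rw [← measure_union₀ hnm]
      · exact prob_le_one
      · refine Disjoint.aedisjoint (Set.disjoint_left.2 fun ω hω hω' => ?_)
        have a1 : |S y + R ω| ≤ l := hω
        have a2 : l < -R ω := hω'
        linarith [neg_abs_le (S y + R ω)]
  have e1 : P {ω | Y ω ∈ A ∧ |S (Y ω) + R ω| ≤ l} = P.map (fun ω => (Y ω, R ω)) B := by
    rw [Measure.map_apply_of_aemeasurable (hY.prodMk hR) hBm]; rfl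
  have : IsProbabilityMeasure (P.map R) := Measure.isProbabilityMeasure_map hR
  have : IsProbabilityMeasure (P.map Y) := Measure.isProbabilityMeasure_map hY
  rw [e1, hmap, Measure.prod_apply hBm]
  calc ∫⁻ y, P.map R (Prod.mk y ⁻¹' B) ∂P.map Y
      ≤ ∫⁻ y, A.indicator (fun _ => 1 - q) y ∂P.map Y := by
        refine lintegral_mono fun y => ?_
        by_cases hy : y ∈ A
        · rw [indicator_of_mem hy]
          refine (measure_mono fun r hr => ?_).trans (hq y)
          exact hr.2
        · rw [indicator_of_notMem hy]
          have : Prod.mk y ⁻¹' B = ∅ := by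
            ext r; simp [hB, hy]
          rw [this, measure_empty]
    _ = P {ω | Y ω ∈ A} * (1 - q) := by
        rw [lintegral_indicator hA, setLIntegral_const, mul_comm,
          Measure.map_apply_of_aemeasurable hY hA]
        rfl

/-- Orthogonal projection onto the span of the Z's. They may be linearly dependent, so a linear
right inverse fixes the coefficients; linearity and boundedness make them Lipschitz functions of the
projected variable. -/
lemma exists_projection_coeff {κ : Type*} [Fintype κ] {Z : κ → Ω → ℝ}
    (hZ : ∀ k, MemLp (Z k) 2 P) :
    ∃ (K : ℝ) (c : Lp ℝ 2 P →ₗ[ℝ] κ → ℝ), (∀ y, ‖c y‖ ≤ K * ‖y‖) ∧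
      ∀ {Y : Ω → ℝ} (hY : MemLp Y 2 P) (k : κ),
        ∫ ω, (Y ω - ∑ i, c (hY.toLp Y) i * Z i ω) * Z k ω ∂P = 0 := by
  classical
  set z : κ → Lp ℝ 2 P := fun k => (hZ k).toLp (Z k) with hz
  set V := Submodule.span ℝ (Set.range z) with hV
  have hfd : FiniteDimensional ℝ V := FiniteDimensional.span_of_finite ℝ (Set.finite_range z)
  set T : (κ → ℝ) →ₗ[ℝ] V := (Fintype.linearCombination ℝ z).codRestrict V fun w => by
    rw [hV, Submodule.mem_span_range_iff_exists_fun]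
    exact ⟨w, by simp [Fintype.linearCombination_apply]⟩ with hT
  have hTs : LinearMap.range T = ⊤ := by
    rw [LinearMap.range_eq_top]
    rintro ⟨y, hy⟩
    obtain ⟨w, hw⟩ := (Submodule.mem_span_range_iff_exists_fun ℝ).1 hy
    exact ⟨w, Subtype.ext (by simp [hT, Fintype.linearCombination_apply, hw])⟩
  obtain ⟨s, hs⟩ := T.exists_rightInverse_of_surjective hTs
  refine ⟨‖s.toContinuousLinearMap‖, s ∘ₗ V.orthogonalProjectionOnto.toLinearMap, fun y => ?_,
    fun {Y} hY k => ?_⟩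
  · calc _ ≤ ‖s.toContinuousLinearMap‖ * ‖V.orthogonalProjectionOnto y‖ :=
          s.toContinuousLinearMap.le_opNorm _
      _ ≤ _ := by
          gcongr
          exact V.norm_orthogonalProjectionOnto_apply_le y
  · set c := (s ∘ₗ V.orthogonalProjectionOnto.toLinearMap) (hY.toLp Y) with hc
    have h1 : ((V.orthogonalProjectionOnto (hY.toLp Y) : V) : Lp ℝ 2 P) = ∑ i, c i • z i := by
      have := congrArg (fun g => ((g (V.orthogonalProjectionOnto (hY.toLp Y)) : V) : Lp ℝ 2 P)) hs
      simp only [LinearMap.coe_comp, Function.comp_apply, LinearMap.id_coe, id_eq, hT,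
        LinearMap.codRestrict_apply, Fintype.linearCombination_apply] at this
      exact this.symm
    have h2 : inner ℝ (hY.toLp Y - ∑ i, c i • z i) (z k) = 0 := by
      rw [← h1]
      exact V.starProjection_inner_eq_zero _ _ (Submodule.subset_span ⟨k, rfl⟩)
    have hin : ∀ {A B : Ω → ℝ} (hA : MemLp A 2 P) (hB : MemLp B 2 P),
        inner ℝ (hA.toLp A) (hB.toLp B) = ∫ ω, A ω * B ω ∂P := by
      intro A B hA hB
      rw [L2.inner_def]
      refine integral_congr_ae ?_
      filter_upwards [hA.coeFn_toLp, hB.coeFn_toLp] with ω a1 a2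
      rw [a1, a2]
      simp [mul_comm]
    rw [inner_sub_left, sum_inner] at h2
    simp_rw [inner_smul_left, hz, hin] at h2
    have hint : ∀ i, Integrable (fun ω => c i * (Z i ω * Z k ω)) P := fun i =>
      ((hZ i).integrable_mul (hZ k)).const_mul (c i)
    have e : ∀ ω, (Y ω - ∑ i, c i * Z i ω) * Z k ω =
        Y ω * Z k ω - ∑ i, c i * (Z i ω * Z k ω) := fun ω => by
      rw [sub_mul, Finset.sum_mul]
      simp_rw [mul_assoc]
    simp_rw [e]
    rw [integral_sub (f := fun ω => Y ω * Z k ω) (hY.integrable_mul (hZ k)) (integrable_finsetSum _ fun i _ => hint i),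
      integral_finsetSum _ fun i _ => hint i]
    simp_rw [integral_const_mul]
    exact h2

end Gaussian

lemma exists_sum_eq_sub {Ω T κ : Type*} [Fintype κ] (X : T → Ω → ℝ) (t : T) (e : κ → T)
    (c : κ → ℝ) : ∃ (I : Finset T) (w : T → ℝ),
      ∀ ω, X t ω - ∑ k, c k * X (e k) ω = ∑ t ∈ I, w t * X t ω := by
  classical
  refine ⟨insert t (Finset.univ.image e), fun s => (if s = t then 1 else 0) -
    ∑ k, if e k = s then c k else 0, fun ω => ?_⟩
  simp_rw [sub_mul, Finset.sum_sub_distrib, Finset.sum_mul]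
  congr 1
  · simp
  · rw [Finset.sum_comm]
    refine Finset.sum_congr rfl fun k _ => ?_
    simp

lemma comap_comp_le {Ω α β : Type*} [MeasurableSpace α] [MeasurableSpace β] (f : Ω → α)
    {g : α → β} (hg : Measurable g) :
    MeasurableSpace.comap (g ∘ f) inferInstance ≤ MeasurableSpace.comap f inferInstance := by
  rw [← MeasurableSpace.comap_comp]
  exact MeasurableSpace.comap_mono hg.comap_le

/-! ### Gaussian residuals: independence, small balls, zero-one law -/

section Residual

variable {Ω : Type*} [MeasurableSpace Ω] {P : Measure Ω}

lemma IsGaussianProcess.of_eq_sum {S T : Type*} {X : T → Ω → ℝ} (hX : IsGaussianProcess X P)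
    {Y : S → Ω → ℝ}
    (h : ∀ s, ∃ (I : Finset T) (w : T → ℝ), ∀ ω, Y s ω = ∑ t ∈ I, w t * X t ω) :
    IsGaussianProcess Y P := by
  refine hX.of_isGaussianProcess fun s => ?_
  obtain ⟨I, w, hw⟩ := h s
  refine ⟨I, ∑ t : I, w t • ContinuousLinearMap.proj (R := ℝ) (φ := fun _ : I => ℝ) t,
    fun ω => ?_⟩
  rw [hw, ← Finset.sum_coe_sort]
  simp

/-- Residuals and conditioning variables are jointly Gaussian and uncorrelated, hence independent.
-/
lemma indepFun_residual {T κ ι : Type*} [Fintype κ] {X : T → Ω → ℝ}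
    (hX : IsGaussianProcess X P) (h0 : ∀ t, ∫ ω, X t ω ∂P = 0) (e : κ → T) (g : ι → T)
    (c : ι → κ → ℝ)
    (ho : ∀ i k, ∫ ω, (X (g i) ω - ∑ l, c i l * X (e l) ω) * X (e k) ω ∂P = 0) :
    IndepFun (fun ω i => X (g i) ω - ∑ l, c i l * X (e l) ω) (fun ω k => X (e k) ω) P := by
  have := hX.isProbabilityMeasure
  have hR : IsGaussianProcess (fun i ω => X (g i) ω - ∑ l, c i l * X (e l) ω) P :=
    IsGaussianProcess.of_eq_sum hX fun i => exists_sum_eq_sub X _ _ _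
  refine IsGaussianProcess.indepFun_of_covariance_eq_zero
    (X := fun i ω => X (g i) ω - ∑ l, c i l * X (e l) ω) (Y := fun k ω => X (e k) ω) ?_
    hR.aemeasurable (fun k => hX.aemeasurable _) fun i k => ?_
  · refine IsGaussianProcess.of_eq_sum hX fun s => ?_
    rcases s with i | k
    · exact exists_sum_eq_sub X _ _ _
    · exact ⟨{e k}, fun _ => 1, fun ω => by simp⟩
  · rw [covariance_eq_sub (hR.hasGaussianLaw_eval i).memLp_two
      (hX.hasGaussianLaw_eval _).memLp_two, h0, mul_zero, sub_zero]
    exact ho i k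

/-- Induction on m: the last variable is a combination of the previous ones plus an independent
residual of variance at least s², so each new constraint costs a factor 1 minus the tail, whatever
the past. -/
theorem measure_forall_abs_le {Z : ℕ → Ω → ℝ} (hZ : IsGaussianProcess Z P)
    (h0 : ∀ k, ∫ ω, Z k ω ∂P = 0) {s x : ℝ} (hs : 0 < s) (hx : 0 ≤ x) (m : ℕ)
    (hv : ∀ k < m, ∀ w : Fin k → ℝ, s ^ 2 ≤ ∫ ω, (Z k ω + ∑ i, w i * Z i ω) ^ 2 ∂P) :
    P {ω | ∀ k < m, |Z k ω| ≤ x * s} ≤ (1 - ENNReal.ofReal (tailBound x)) ^ m := by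
  have := hZ.isProbabilityMeasure
  induction m with
  | zero => simp
  | succ m ih =>
    have hL : ∀ k, MemLp (Z k) 2 P := fun k => (hZ.hasGaussianLaw_eval k).memLp_two
    obtain ⟨K, c, -, hc⟩ := exists_projection_coeff (P := P) (Z := fun i : Fin m => Z i)
      fun i => hL i
    set b := c ((hL m).toLp (Z m)) with hb
    set R : Ω → ℝ := fun ω => Z m ω - ∑ i, b i * Z i ω with hR
    have hi := indepFun_residual hZ h0 (fun i : Fin m => (i : ℕ)) (fun _ : Unit => m)
      (fun _ => b) fun _ k => hc (hL m) k
    have hi' : IndepFun (fun ω (i : Fin m) => Z i ω) R P :=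
      (hi.comp (measurable_pi_apply ()) measurable_id).symm
    have hRg : HasGaussianLaw R P := by
      obtain ⟨I, w, hw⟩ := exists_sum_eq_sub Z m (fun i : Fin m => (i : ℕ)) b
      rw [show R = fun ω => ∑ t ∈ I, w t * Z t ω from funext hw]
      exact IsGaussianProcess.hasGaussianLaw_sum_mul hZ I w
    have hR0 : ∫ ω, R ω ∂P = 0 := by
      have hint : ∀ i : Fin m, Integrable (fun ω => b i * Z i ω) P := fun i =>
        ((hL i).integrable (by norm_num)).const_mul _
      rw [hR, integral_sub ((hL m).integrable (by norm_num))
        (integrable_finsetSum _ fun i _ => hint i), integral_finsetSum _ fun i _ => hint i, h0]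
      simp_rw [integral_const_mul, h0]
      simp
    -- Of all weights in `hv`, only the negated projection coefficients are used.
    have hRv : s ^ 2 ≤ ∫ ω, R ω ^ 2 ∂P := by
      have := hv m (Nat.lt_succ_self m) fun i => -b i
      simpa [hR, sub_eq_add_neg] using this
    have hq1 := tailBound_le_measure hRg hR0 hs hRv hx
    have hq2 := tailBound_le_measure (X := fun ω => -R ω) hRg.fun_neg
      (by rw [integral_neg, hR0, neg_zero]) hs (by simpa using hRv) hx
    have hYm : AEMeasurable (fun ω (i : Fin m) => Z i ω) P :=
      aemeasurable_pi_lambda _ fun i => hZ.aemeasurable _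
    have hA : MeasurableSet {y : Fin m → ℝ | ∀ i, |y i| ≤ x * s} :=
      by
        rw [ofPred_forall]
        exact MeasurableSet.iInter fun i => measurableSet_le (by fun_prop) measurable_const
    have key := measure_inter_abs_add_le hYm hRg.aemeasurable hi' hA
      (S := fun y => ∑ i, b i * y i) (by fun_prop) hq1 hq2
    have e1 : {ω | ∀ k < m + 1, |Z k ω| ≤ x * s} =
        {ω | (fun i : Fin m => Z i ω) ∈ {y : Fin m → ℝ | ∀ i, |y i| ≤ x * s} ∧
          |∑ i : Fin m, b i * Z i ω + R ω| ≤ x * s} := by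
      ext ω
      simp only [mem_ofPred_eq, hR, add_sub_cancel]
      refine ⟨fun h => ⟨fun i => h i (by omega), h m (by omega)⟩, fun h k hk => ?_⟩
      rcases Nat.lt_succ_iff_lt_or_eq.1 hk with h1 | rfl
      · exact h.1 ⟨k, h1⟩
      · exact h.2
    have e2 : {ω | (fun i : Fin m => Z i ω) ∈ {y : Fin m → ℝ | ∀ i, |y i| ≤ x * s}} =
        {ω | ∀ k < m, |Z k ω| ≤ x * s} := by
      ext ω
      exact ⟨fun h k hk => h ⟨k, hk⟩, fun h i => h i i.2⟩
    rw [e1, pow_succ]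
    rw [e2] at key
    refine key.trans ?_
    gcongr
    exact ih fun k hk w => hv k (by omega) w

/-- A functional of a centred Gaussian process which is invariant under shifts by functions
that are Lipschitz in the canonical metric is almost surely constant. -/
theorem exists_ae_eq_const_of_shift_invariant {ι : Type*} {X : ι → Ω → ℝ}
    (hX : IsGaussianProcess X P) (hm : ∀ i, Measurable (X i)) (h0 : ∀ i, ∫ ω, X i ω ∂P = 0)
    {L : (ι → ℝ) → ℝ≥0∞} (hL : Measurable L)
    (hinv : ∀ x g : ι → ℝ, (∃ K, ∀ i i', |g i - g i'| ≤ K * √(∫ ω, (X i ω - X i' ω) ^ 2 ∂P)) →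
      L (fun i => x i + g i) = L x) :
    ∃ C, ∀ᵐ ω ∂P, L (fun i => X i ω) = C := by
  classical
  have := hX.isProbabilityMeasure
  have hL2 : ∀ i, MemLp (X i) 2 P := fun i => (hX.hasGaussianLaw_eval i).memLp_two
  set F : Ω → ℝ≥0∞ := fun ω => L fun i => X i ω with hF
  have hFm : Measurable F := hL.comp (measurable_pi_lambda _ hm)
  -- Subtract from X its projection onto the coordinates in S. For fixed ω the subtracted function
  -- of i is Lipschitz in the canonical metric, so L does not see it; L of the residual is
  -- independent of those coordinates.
  have hind : ∀ S : Finset ι, IndepFun (fun ω (k : S) => X k ω) F P := by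
    intro S
    obtain ⟨K, c, hK, hc⟩ := exists_projection_coeff (P := P) (Z := fun k : S => X k)
      fun k => hL2 k
    have hi := indepFun_residual hX h0 (fun k : S => (k : ι)) id
      (fun i => c ((hL2 i).toLp (X i))) fun i k => hc (hL2 i) k
    have e : F = L ∘ fun ω i => X (id i) ω - ∑ l : S, c ((hL2 i).toLp (X i)) l * X l ω := by
      ext ω
      rw [Function.comp_apply]
      simp_rw [sub_eq_add_neg]
      rw [hinv]
      · rfl
      · refine ⟨K * ∑ l : S, |X l ω|, fun i i' => ?_⟩
        have h1 : √(∫ ω, (X i ω - X i' ω) ^ 2 ∂P) =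
            ‖(hL2 i).toLp (X i) - (hL2 i').toLp (X i')‖ := by
          rw [← MemLp.toLp_sub, ← Real.sqrt_sq (norm_nonneg _), ← integral_sq_eq_norm_toLp]
          rfl
        rw [h1, neg_sub_neg, ← Finset.sum_sub_distrib]
        simp_rw [← sub_mul]
        refine (Finset.abs_sum_le_sum_abs _ _).trans ?_
        rw [mul_right_comm, Finset.mul_sum]
        refine Finset.sum_le_sum fun l _ => ?_
        rw [abs_mul]
        gcongr
        have h2 := hK ((hL2 i').toLp (X i') - (hL2 i).toLp (X i))
        rw [map_sub, norm_sub_rev ((hL2 i').toLp (X i'))] at h2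
        exact (norm_le_pi_norm (c ((hL2 i').toLp (X i')) - c ((hL2 i).toLp (X i))) l).trans h2
    rw [e]
    exact (hi.comp hL measurable_id).symm
  have hle : MeasurableSpace.comap F inferInstance ≤ ⨆ S : Finset ι,
      MeasurableSpace.comap (fun ω (k : S) => X k ω) inferInstance := by
    refine (comap_comp_le (fun ω i => X i ω) hL).trans ?_
    rw [MeasurableSpace.pi, MeasurableSpace.comap_iSup]
    refine iSup_le fun i => ?_
    rw [MeasurableSpace.comap_comp]
    refine le_trans ?_ (le_iSup (fun S : Finset ι => MeasurableSpace.comap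
      (fun ω (k : S) => X k ω) inferInstance) {i})
    exact comap_comp_le (fun ω (k : ({i} : Finset ι)) => X k ω)
      (measurable_pi_apply (⟨i, by simp⟩ : ({i} : Finset ι)))
  -- Finite families of coordinates form a directed system whose σ-algebras generate one containing
  -- that of F, so F becomes independent of itself.
  have hI : Indep (⨆ S : Finset ι, MeasurableSpace.comap (fun ω (k : S) => X k ω) inferInstance)
      (MeasurableSpace.comap F inferInstance) P := by
    refine indep_iSup_of_directed_le (fun S => (IndepFun_iff_Indep _ _ _).1 (hind S))
      (fun S => (measurable_pi_lambda _ fun k => hm _).comap_le) hFm.comap_le ?_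
    have hmono : ∀ {S S' : Finset ι}, S ⊆ S' →
        MeasurableSpace.comap (fun ω (k : S) => X k ω) inferInstance ≤
        MeasurableSpace.comap (fun ω (k : S') => X k ω) inferInstance := by
      intro S S' h
      exact comap_comp_le (fun ω (k : S') => X k ω)
        (g := fun (y : S' → ℝ) (k : S) => y ⟨k, h k.2⟩) (by fun_prop)
    exact fun S S' => ⟨S ∪ S', hmono Finset.subset_union_left, hmono Finset.subset_union_right⟩
  have hself := indep_of_indep_of_le_left hI hle
  obtain ⟨C, hC⟩ := Filter.exists_eventuallyEq_const_of_forall_separating (l := ae P) (f := F)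
    MeasurableSet fun U hU => by
      have hA : MeasurableSet[MeasurableSpace.comap F inferInstance] (F ⁻¹' U) := ⟨U, hU, rfl⟩
      have h1 : IndepSet (F ⁻¹' U) (F ⁻¹' U) P := hself.indepSet_of_measurableSet hA hA
      rcases measure_eq_zero_or_one_of_indepSet_self h1 with h | h
      · right
        rw [ae_iff]
        simp only [not_not]
        exact h
      · left
        exact (prob_compl_eq_zero_iff (hFm hU)).2 h
  exact ⟨C, hC⟩

end Residual

/-! ### Chaining along dyadic lattices -/

section Chaining

variable {N : ℕ}

/-- The point of the lattice `2⁻ⁿ ℤ^{1+N}` with integer coordinates `k`. -/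
def latticePoint (n : ℕ) (k : ℤ × (Fin N → ℤ)) : ℝ × E N :=
  ((k.1 : ℝ) / 2 ^ n, WithLp.toLp 2 fun i => (k.2 i : ℝ) / 2 ^ n)

/-- The integer coordinates of the lower corner of the dyadic cube containing `p`. -/
def dyadicFloor (n : ℕ) (p : ℝ × E N) : ℤ × (Fin N → ℤ) :=
  (⌊2 ^ n * p.1⌋, fun i => ⌊2 ^ n * p.2 i⌋)

/-- Adjacency of lattice points, including diagonals. -/
def Near (k l : ℤ × (Fin N → ℤ)) : Prop := |k.1 - l.1| ≤ 1 ∧ ∀ i, |k.2 i - l.2 i| ≤ 1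

/-- The lattice points of level `n` in the cube `[-M, M]^{1+N}`. -/
def latticeBox (N M n : ℕ) : Finset (ℤ × (Fin N → ℤ)) :=
  Finset.Icc (-(M * 2 ^ n : ℤ)) (M * 2 ^ n) ×ˢ
    Fintype.piFinset fun _ => Finset.Icc (-(M * 2 ^ n : ℤ)) (M * 2 ^ n)

/-- The cube `[-M, M]^{1+N}`. -/
def cube (N M : ℕ) : Set (ℝ × E N) := {p | |p.1| ≤ M ∧ ∀ i, |p.2 i| ≤ M}

lemma norm_le_sum_abs (x : E N) : ‖x‖ ≤ ∑ i, |x i| := by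
  have h := (EuclideanSpace.basisFun (Fin N) ℝ).sum_repr x
  conv_lhs => rw [← h]
  refine (norm_sum_le _ _).trans (le_of_eq (Finset.sum_congr rfl fun i _ => ?_))
  simp [norm_smul]

lemma rho_le_of_coord {p q : ℝ × E N} {r : ℝ} (h1 : |p.1 - q.1| ≤ r)
    (h2 : ∀ i, |p.2 i - q.2 i| ≤ r) : rho p q ≤ (N + 1) * r := by
  unfold rho
  have h3 : ‖p.2 - q.2‖ ≤ N * r := by
    refine (norm_le_sum_abs _).trans ?_
    calc ∑ i, |(p.2 - q.2) i| ≤ ∑ _i : Fin N, r := Finset.sum_le_sum fun i _ => by simpa using h2 i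
      _ = N * r := by simp
  linarith

lemma coord_le_rho (p q : ℝ × E N) : |p.1 - q.1| ≤ rho p q ∧ ∀ i, |p.2 i - q.2 i| ≤ rho p q := by
  unfold rho
  refine ⟨le_add_of_nonneg_right (norm_nonneg _), fun i => ?_⟩
  have := PiLp.norm_apply_le (p.2 - q.2) i
  simp only [PiLp.sub_apply, Real.norm_eq_abs] at this
  exact this.trans (le_add_of_nonneg_left (abs_nonneg _))

lemma Near.rho_le {k l : ℤ × (Fin N → ℤ)} (h : Near k l) (n : ℕ) :
    rho (latticePoint n k) (latticePoint n l) ≤ (N + 1) * (1 / 2 ^ n) := by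
  have key : ∀ a b : ℤ, |a - b| ≤ 1 → |(a : ℝ) / 2 ^ n - b / 2 ^ n| ≤ 1 / 2 ^ n := by
    intro a b hab
    rw [← sub_div, abs_div, abs_of_pos (show (0 : ℝ) < 2 ^ n by positivity)]
    gcongr
    exact_mod_cast hab
  exact rho_le_of_coord (key _ _ h.1) fun i => key _ _ (h.2 i)

lemma rho_dyadicFloor_le (n : ℕ) (p : ℝ × E N) :
    rho (latticePoint n (dyadicFloor n p)) p ≤ (N + 1) * (1 / 2 ^ n) := by
  have key : ∀ a : ℝ, |(⌊2 ^ n * a⌋ : ℝ) / 2 ^ n - a| ≤ 1 / 2 ^ n := by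
    intro a
    have h0 : (0 : ℝ) < 2 ^ n := by positivity
    have e : (⌊2 ^ n * a⌋ : ℝ) / 2 ^ n - a = (⌊2 ^ n * a⌋ - 2 ^ n * a) / 2 ^ n := by field_simp
    rw [e, abs_div, abs_of_pos h0]
    gcongr
    rw [abs_le]
    constructor <;> linarith [Int.floor_le (2 ^ n * a), Int.lt_floor_add_one (2 ^ n * a)]
  exact rho_le_of_coord (key _) fun i => key _

lemma latticePoint_succ (n : ℕ) (k : ℤ × (Fin N → ℤ)) :
    latticePoint (n + 1) (2 * k.1, fun i => 2 * k.2 i) = latticePoint n k := by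
  have key : ∀ a : ℤ, ((2 * a : ℤ) : ℝ) / 2 ^ (n + 1) = a / 2 ^ n := by
    intro a; push_cast; rw [pow_succ]; field_simp
  unfold latticePoint
  simp only [key]

/-- Doubling coordinates represents the level n point at level n + 1, so one refinement step of the
chain is an edge at level n + 1. -/
lemma near_dyadicFloor_succ (n : ℕ) (p : ℝ × E N) :
    Near (2 * (dyadicFloor n p).1, fun i => 2 * (dyadicFloor n p).2 i) (dyadicFloor (n + 1) p) := by
  have key : ∀ a : ℝ, |2 * ⌊2 ^ n * a⌋ - ⌊2 ^ (n + 1) * a⌋| ≤ 1 := by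
    intro a
    have e : (2 : ℝ) ^ (n + 1) * a = 2 * (2 ^ n * a) := by ring
    rw [e]
    have h1 := Int.floor_le (2 ^ n * a)
    have h2 := Int.lt_floor_add_one (2 ^ n * a)
    have h3 : 2 * ⌊2 ^ n * a⌋ ≤ ⌊2 * (2 ^ n * a)⌋ := by
      rw [Int.le_floor]; push_cast; linarith
    have h4 : ⌊2 * (2 ^ n * a)⌋ < 2 * ⌊2 ^ n * a⌋ + 2 := by
      rw [Int.floor_lt]; push_cast; linarith
    rw [abs_le]
    constructor <;> omega
  exact ⟨key _, fun i => key _⟩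

lemma near_dyadicFloor {n : ℕ} {p q : ℝ × E N} (h : rho p q ≤ 1 / 2 ^ n) :
    Near (dyadicFloor n p) (dyadicFloor n q) := by
  have key : ∀ a b : ℝ, |a - b| ≤ 1 / 2 ^ n → |⌊2 ^ n * a⌋ - ⌊2 ^ n * b⌋| ≤ 1 := by
    intro a b hab
    have h0 : (0 : ℝ) < 2 ^ n := by positivity
    rw [le_div_iff₀ h0] at hab
    have h5 : |2 ^ n * a - 2 ^ n * b| ≤ 1 := by
      rw [← mul_sub, abs_mul, abs_of_pos h0, mul_comm]; exact hab
    rw [abs_le] at h5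
    have h1 := Int.floor_le (2 ^ n * a)
    have h2 := Int.lt_floor_add_one (2 ^ n * a)
    have h3 := Int.floor_le (2 ^ n * b)
    have h4 := Int.lt_floor_add_one (2 ^ n * b)
    have h6 : ⌊2 ^ n * a⌋ < ⌊2 ^ n * b⌋ + 2 := by
      rw [Int.floor_lt]; push_cast; linarith
    have h7 : ⌊2 ^ n * b⌋ < ⌊2 ^ n * a⌋ + 2 := by
      rw [Int.floor_lt]; push_cast; linarith
    rw [abs_le]
    constructor <;> omega
  obtain ⟨h1, h2⟩ := coord_le_rho p q
  exact ⟨key _ _ (h1.trans h), fun i => key _ _ ((h2 i).trans h)⟩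

lemma mem_latticeBox {M n : ℕ} {k : ℤ × (Fin N → ℤ)} :
    k ∈ latticeBox N M n ↔ |k.1| ≤ M * 2 ^ n ∧ ∀ i, |k.2 i| ≤ M * 2 ^ n := by
  simp [latticeBox, abs_le]

lemma dyadicFloor_mem {M : ℕ} {p : ℝ × E N} (hp : p ∈ cube N M) (n : ℕ) :
    dyadicFloor n p ∈ latticeBox N M n := by
  have key : ∀ a : ℝ, |a| ≤ M → |⌊2 ^ n * a⌋| ≤ M * 2 ^ n := by
    intro a ha
    have h0 : (0 : ℝ) < 2 ^ n := by positivity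
    rw [abs_le] at ha ⊢
    constructor
    · rw [Int.le_floor]; push_cast; nlinarith
    · have h2 : (⌊2 ^ n * a⌋ : ℝ) ≤ M * 2 ^ n := (Int.floor_le _).trans (by nlinarith)
      exact_mod_cast h2
  exact mem_latticeBox.2 ⟨key _ hp.1, fun i => key _ (hp.2 i)⟩

lemma double_mem_latticeBox {M n : ℕ} {k : ℤ × (Fin N → ℤ)} (hk : k ∈ latticeBox N M n) :
    ((2 * k.1, fun i => 2 * k.2 i) : ℤ × (Fin N → ℤ)) ∈ latticeBox N M (n + 1) := by
  rw [mem_latticeBox] at hk ⊢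
  have key : ∀ a : ℤ, |a| ≤ M * 2 ^ n → |2 * a| ≤ M * 2 ^ (n + 1) := by
    intro a ha
    rw [abs_mul, pow_succ]
    norm_num
    linarith
  exact ⟨key _ hk.1, fun i => key _ (hk.2 i)⟩

lemma card_latticeBox_le {M : ℕ} (hM : 1 ≤ M) (n : ℕ) :
    ((latticeBox N M n).card : ℝ) ≤ (3 * M * 2 ^ n) ^ (N + 1) := by
  have h1 : ((Finset.Icc (-(M * 2 ^ n : ℤ)) (M * 2 ^ n)).card : ℝ) ≤ 3 * M * 2 ^ n := by
    rw [Int.card_Icc]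
    have h2 : ((M * 2 ^ n + 1 - -(M * 2 ^ n) : ℤ).toNat : ℤ) = M * 2 ^ n + 1 - -(M * 2 ^ n) :=
      Int.toNat_of_nonneg (by have : (0 : ℤ) ≤ M * 2 ^ n := by positivity
                              linarith)
    have h3 : (((M * 2 ^ n + 1 - -(M * 2 ^ n) : ℤ).toNat : ℤ) : ℝ) = M * 2 ^ n + 1 + M * 2 ^ n := by
      rw [h2]; push_cast; ring
    rw [Int.cast_natCast] at h3
    rw [h3]
    have h4 : (1 : ℝ) ≤ M := by exact_mod_cast hM
    have h5 : (1 : ℝ) ≤ 2 ^ n := one_le_pow₀ (by norm_num)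
    nlinarith
  rw [latticeBox, Finset.card_product, Fintype.card_piFinset, Finset.prod_const, Finset.card_univ,
    Fintype.card_fin, Nat.cast_mul, Nat.cast_pow, pow_succ, mul_comm]
  gcongr

/-- The tail is comparable to its leading scale because √(n+m+1) ≤ √(m+2) √n for n ≥ 1, which
factors n out of the sum. -/
lemma exists_chaining_const {r : ℝ} (hr0 : 0 < r) (hr1 : r < 1) :
    ∃ S : ℝ, 0 < S ∧ ∀ n : ℕ, 1 ≤ n →
      Summable (fun m : ℕ => r ^ (n + m + 1) * √((n + m + 1 : ℕ) : ℝ)) ∧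
      ∑' m : ℕ, r ^ (n + m + 1) * √((n + m + 1 : ℕ) : ℝ) ≤ S * (r ^ n * √n) := by
  have hs : Summable fun m : ℕ => r ^ (m + 1) * √((m + 2 : ℕ) : ℝ) := by
    have h1 : Summable fun m : ℕ => ((m : ℝ) ^ 1 * r ^ m + 2 * r ^ m) :=
      (summable_pow_mul_geometric_of_norm_lt_one 1 (by rwa [Real.norm_of_nonneg hr0.le])).add
        ((summable_geometric_of_lt_one hr0.le hr1).mul_left 2)
    refine Summable.of_nonneg_of_le (fun m => by positivity) (fun m => ?_) h1
    have h2 : √((m + 2 : ℕ) : ℝ) ≤ m + 2 := by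
      rw [Real.sqrt_le_left (by positivity)]
      push_cast
      nlinarith [(Nat.cast_nonneg m : (0 : ℝ) ≤ m)]
    have h3 : r ^ (m + 1) ≤ r ^ m := pow_le_pow_of_le_one hr0.le hr1.le (Nat.le_succ m)
    calc _ ≤ r ^ m * (m + 2) := by gcongr
      _ = _ := by ring
  refine ⟨∑' m : ℕ, r ^ (m + 1) * √((m + 2 : ℕ) : ℝ), hs.tsum_pos (fun m => by positivity) 0
    (by positivity), fun n hn => ?_⟩
  have hle : ∀ m : ℕ, r ^ (n + m + 1) * √((n + m + 1 : ℕ) : ℝ) ≤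
      (r ^ (m + 1) * √((m + 2 : ℕ) : ℝ)) * (r ^ n * √n) := by
    intro m
    have h1 : √((n + m + 1 : ℕ) : ℝ) ≤ √((m + 2 : ℕ) : ℝ) * √n := by
      rw [← Real.sqrt_mul (by positivity)]
      refine Real.sqrt_le_sqrt ?_
      have : n + m + 1 ≤ (m + 2) * n := by nlinarith
      exact_mod_cast this
    calc _ ≤ r ^ (n + m + 1) * (√((m + 2 : ℕ) : ℝ) * √n) := by gcongr
      _ = _ := by rw [show n + m + 1 = (m + 1) + n by ring, pow_add]; ring
  have hs2 := Summable.of_nonneg_of_le (fun m => by positivity) hle (hs.mul_right (r ^ n * √n))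
  refine ⟨hs2, ?_⟩
  rw [← tsum_mul_right]
  exact hs2.tsum_le_tsum hle (hs.mul_right _)

/-- The increments of `G` along adjacent lattice points are of order `K rⁿ √n` from level `n₀`
on. -/
def ChainBound {F : Type*} [NormedAddCommGroup F] (r K : ℝ) (M n₀ : ℕ) (G : ℝ × E N → F) : Prop :=
  ∀ n, n₀ ≤ n → ∀ k ∈ latticeBox N M n, ∀ l ∈ latticeBox N M n, Near k l →
    ‖G (latticePoint n k) - G (latticePoint n l)‖ ≤ K * (r ^ n * √n)

/-- Consecutive dyadic approximations of p are adjacent, so their distances are summable and the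
limit is reached at the rate of the tail. -/
theorem ChainBound.exists_limit {F : Type*} [NormedAddCommGroup F] [CompleteSpace F] {r S : ℝ}
    (hS : ∀ n : ℕ, 1 ≤ n →
      Summable (fun m : ℕ => r ^ (n + m + 1) * √((n + m + 1 : ℕ) : ℝ)) ∧
      ∑' m : ℕ, r ^ (n + m + 1) * √((n + m + 1 : ℕ) : ℝ) ≤ S * (r ^ n * √n)) {K : ℝ} (hK : 0 ≤ K)
    {M n₀ : ℕ} (hn₀ : 1 ≤ n₀) {G : ℝ × E N → F} (hG : ChainBound r K M n₀ G) {p : ℝ × E N}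
    (hp : p ∈ cube N M) :
    ∃ y, Tendsto (fun n => G (latticePoint n (dyadicFloor n p))) atTop (𝓝 y) ∧
      ∀ n, n₀ ≤ n → ‖G (latticePoint n (dyadicFloor n p)) - y‖ ≤ S * K * (r ^ n * √n) := by
  have hstep : ∀ n, n₀ ≤ n → ∀ m : ℕ, dist (G (latticePoint (n + m) (dyadicFloor (n + m) p)))
      (G (latticePoint (n + m.succ) (dyadicFloor (n + m.succ) p))) ≤
        K * (r ^ (n + m + 1) * √((n + m + 1 : ℕ) : ℝ)) := by
    intro n hn m
    rw [dist_eq_norm, ← latticePoint_succ]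
    exact hG (n + m + 1) (by omega) _ (double_mem_latticeBox (dyadicFloor_mem hp _)) _
      (dyadicFloor_mem hp _) (near_dyadicFloor_succ _ p)
  obtain ⟨y, hy⟩ := cauchySeq_tendsto_of_complete
    (cauchySeq_of_dist_le_of_summable _ (hstep n₀ le_rfl) ((hS n₀ hn₀).1.mul_left K))
  have hy' : Tendsto (fun n => G (latticePoint n (dyadicFloor n p))) atTop (𝓝 y) := by
    rw [← tendsto_add_atTop_iff_nat n₀]
    simpa [add_comm] using hy
  refine ⟨y, hy', fun n hn => ?_⟩
  have h1 := dist_le_tsum_of_dist_le_of_tendsto₀ _ (hstep n hn)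
    ((hS n (hn₀.trans hn)).1.mul_left K) (a := y) (by
      have := (tendsto_add_atTop_iff_nat n).2 hy'
      simpa [add_comm] using this)
  rw [add_zero, dist_eq_norm, tsum_mul_left] at h1
  refine h1.trans ?_
  have := mul_le_mul_of_nonneg_left (hS n (hn₀.trans hn)).2 hK
  linarith

/-- Go from p to its level n approximation, cross one edge, and return to q, with 2⁻ⁿ of the size of
the distance. This costs (2S + 1)K (2^{-α})ⁿ √n, and √n is comparable to the root of the logarithm.
-/
theorem ChainBound.norm_sub_le {F : Type*} [NormedAddCommGroup F] [CompleteSpace F] {α S : ℝ}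
    (hα : 0 < α) (hS0 : 0 < S) (hS : ∀ n : ℕ, 1 ≤ n →
      Summable (fun m : ℕ => (2 ^ (-α) : ℝ) ^ (n + m + 1) * √((n + m + 1 : ℕ) : ℝ)) ∧
      ∑' m : ℕ, (2 ^ (-α) : ℝ) ^ (n + m + 1) * √((n + m + 1 : ℕ) : ℝ) ≤
        S * ((2 ^ (-α) : ℝ) ^ n * √n)) {K : ℝ} (hK : 0 ≤ K)
    {M n₀ : ℕ} (hn₀ : 1 ≤ n₀) {G g : ℝ × E N → F} (hG : ChainBound (2 ^ (-α)) K M n₀ G)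
    (hg : ∀ p ∈ cube N M, Tendsto (fun n => G (latticePoint n (dyadicFloor n p))) atTop (𝓝 (g p)))
    {p q : ℝ × E N} (hp : p ∈ cube N M) (hq : q ∈ cube N M) (h0 : 0 < rho p q)
    (h1 : rho p q ≤ 1 / 2 ^ n₀) :
    ‖g p - g q‖ ≤ (2 * S + 1) * K * (2 ^ α / √(Real.log 2)) *
      (rho p q ^ α * √(Real.log (1 + (rho p q)⁻¹))) := by
  set ρ := rho p q with hρ
  have hρ1 : ρ ≤ 1 := h1.trans (by
    rw [div_le_one (by positivity)]; exact one_le_pow₀ (by norm_num))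
  -- The scale: 2ⁿ ≤ 1/ρ < 2ⁿ⁺¹. The first inequality makes the floors adjacent, the second converts
  -- back to ρ^α.
  obtain ⟨n, hn1, hn2⟩ := exists_nat_pow_near (x := ρ⁻¹) (y := (2 : ℝ))
    ((one_le_inv₀ h0).2 hρ1) (by norm_num)
  have hn : n₀ ≤ n := by
    have h2 : (2 : ℝ) ^ n₀ ≤ ρ⁻¹ := by
      rw [le_inv_comm₀ (by positivity) h0]; simpa using h1
    have h3 : (2 : ℝ) ^ n₀ < 2 ^ (n + 1) := lt_of_le_of_lt h2 hn2
    have := (pow_lt_pow_iff_right₀ (by norm_num : (1 : ℝ) < 2)).1 h3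
    omega
  have hnear : rho p q ≤ 1 / 2 ^ n := by
    rw [one_div, ← hρ, le_inv_comm₀ h0 (by positivity)]; exact hn1
  have lim : ∀ {p}, p ∈ cube N M → ‖G (latticePoint n (dyadicFloor n p)) - g p‖ ≤
      S * K * ((2 ^ (-α) : ℝ) ^ n * √n) := by
    intro p hp
    obtain ⟨y, hy, hb⟩ := hG.exists_limit hS hK hn₀ hp
    rw [tendsto_nhds_unique (hg p hp) hy]
    exact hb n hn
  have hmid := hG n hn _ (dyadicFloor_mem hp n) _ (dyadicFloor_mem hq n) (near_dyadicFloor hnear)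
  have h2 : ‖g p - g q‖ ≤ (2 * S + 1) * K * ((2 ^ (-α) : ℝ) ^ n * √n) := by
    have e : g p - g q = -(G (latticePoint n (dyadicFloor n p)) - g p) +
      (G (latticePoint n (dyadicFloor n p)) - G (latticePoint n (dyadicFloor n q))) +
      (G (latticePoint n (dyadicFloor n q)) - g q) := by abel
    rw [e]
    refine (norm_add₃_le).trans ?_
    rw [norm_neg]
    linarith [lim hp, lim hq]
  refine h2.trans ?_
  rw [mul_assoc ((2 * S + 1) * K)]
  have hlog2 : 0 < Real.log 2 := Real.log_pos (by norm_num)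
  have h3 : (2 ^ (-α) : ℝ) ^ n ≤ 2 ^ α * ρ ^ α := by
    rw [← Real.mul_rpow (by norm_num) h0.le, ← Real.rpow_natCast, ← Real.rpow_mul (by norm_num),
      neg_mul, mul_comm α, ← neg_mul, Real.rpow_mul (by norm_num), Real.rpow_neg (by norm_num),
      Real.rpow_natCast]
    refine Real.rpow_le_rpow (by positivity) ?_ hα.le
    rw [inv_le_comm₀ (by positivity) (by positivity), mul_inv, inv_mul_le_iff₀ (by norm_num)]
    rw [pow_succ] at hn2
    linarith
  have h4 : √n ≤ √(Real.log (1 + ρ⁻¹)) / √(Real.log 2) := by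
    rw [← Real.sqrt_div' _ hlog2.le]
    refine Real.sqrt_le_sqrt ?_
    rw [le_div_iff₀ hlog2, ← Real.log_pow]
    exact Real.log_le_log (by positivity) (by linarith)
  have h5 : (2 ^ (-α) : ℝ) ^ n * √n ≤ 2 ^ α / √(Real.log 2) *
      (ρ ^ α * √(Real.log (1 + ρ⁻¹))) := by
    calc _ ≤ 2 ^ α * ρ ^ α * (√(Real.log (1 + ρ⁻¹)) / √(Real.log 2)) := by gcongr
      _ = _ := by ring
  gcongr

end Chaining

/-! ### The chaining bound holds almost surely -/

section ChainProb

variable {N d : ℕ} {Ω : Type*} [MeasurableSpace Ω] {P : Measure Ω}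

lemma latticePoint_fst_le {M n : ℕ} {k : ℤ × (Fin N → ℤ)} (hk : k ∈ latticeBox N M n) :
    (latticePoint n k).1 ≤ M := by
  have h1 := (abs_le.1 (mem_latticeBox.1 hk).1).2
  have h2 : (k.1 : ℝ) ≤ M * 2 ^ n := by exact_mod_cast h1
  show (k.1 : ℝ) / 2 ^ n ≤ M
  rw [div_le_iff₀ (by positivity)]
  exact h2

/-- Union bound over adjacent pairs, crudely counted by all pairs, followed by Borel-Cantelli. -/
theorem ae_exists_chainBound [IsProbabilityMeasure P] {X : Fin d × (ℝ × E N) → Ω → ℝ}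
    (hX : IsGaussianProcess X P) (h0 : ∀ q, ∫ ω, X q ω ∂P = 0) {M : ℕ} (hM : 1 ≤ M) {C α : ℝ}
    (hC : 0 < C) (hα : 0 < α) (hv : ∀ (j : Fin d) (p q : ℝ × E N), p.1 ≤ M → q.1 ≤ M →
      rho p q ≤ N + 1 → ∫ ω, (X (j, p) ω - X (j, q) ω) ^ 2 ∂P ≤ C * rho p q ^ (2 * α)) :
    ∃ K : ℝ, 0 < K ∧ ∀ᵐ ω ∂P, ∃ n₀, 1 ≤ n₀ ∧
      ChainBound (2 ^ (-α)) K M n₀ (fun p => (WithLp.toLp 2 fun j => X (j, p) ω : E d)) := by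
  classical
  set Q : ℕ → Finset ((ℤ × (Fin N → ℤ)) × (ℤ × (Fin N → ℤ))) := fun n =>
    (latticeBox N M n ×ˢ latticeBox N M n).filter (fun z => Near z.1 z.2) with hQ
  -- There are O(2^{2(N+1)n}) pairs, each bad with probability at most 2e^{-nA}, so this A leaves a
  -- summable e^{-n}; κ is chosen below so that l n squared over twice the variance bound equals nA.
  set A : ℝ := 2 * (N + 1) * Real.log 2 + 1 with hA
  have hlog2 : 0 < Real.log 2 := Real.log_pos (by norm_num)
  have hA0 : 0 < A := by positivity
  set κ : ℝ := √(2 * C * (N + 1 : ℝ) ^ (2 * α) * A) with hκ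
  have hκ0 : 0 < κ := Real.sqrt_pos.2 (by positivity)
  have hκ2 : κ ^ 2 = 2 * C * (N + 1 : ℝ) ^ (2 * α) * A := Real.sq_sqrt (by positivity)
  set r : ℝ := 2 ^ (-α) with hr
  have hr0 : 0 < r := by positivity
  set l : ℕ → ℝ := fun n => κ * (r ^ n * √n) with hl
  set B : ℕ → Set Ω := fun n => ⋃ j : Fin d, ⋃ z ∈ Q n, {ω | l n ≤ |X (j, latticePoint n z.1) ω - X (j, latticePoint n z.2) ω|}
    with hB
  have hPB : ∀ n, P (B n) ≤ ENNReal.ofReal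
      ((d * ((3 * M : ℝ) ^ (N + 1)) ^ 2 * 2) * Real.exp (-1) ^ n) := by
    intro n
    have hone : ∀ (j : Fin d), ∀ z ∈ Q n,
        P {ω | l n ≤ |X (j, latticePoint n z.1) ω - X (j, latticePoint n z.2) ω|} ≤
          ENNReal.ofReal (2 * Real.exp (-(n * A))) := by
      intro j z hz
      simp only [hQ, Finset.mem_filter, Finset.mem_product] at hz
      obtain ⟨⟨hz1, hz2⟩, hz3⟩ := hz
      have hrho := hz3.rho_le n
      have h2n : (1 : ℝ) / 2 ^ n ≤ 1 := by
        rw [div_le_one (by positivity)]; exact one_le_pow₀ (by norm_num)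
      have hrho1 : rho (latticePoint n z.1) (latticePoint n z.2) ≤ N + 1 :=
        hrho.trans (by nlinarith [(Nat.cast_nonneg N : (0 : ℝ) ≤ N)])
      have hs : 0 < C * ((N + 1 : ℝ) * (1 / 2 ^ n)) ^ (2 * α) := by positivity
      have hvar := (hv j _ _ (latticePoint_fst_le hz1) (latticePoint_fst_le hz2) hrho1).trans
        (show _ ≤ C * ((N + 1 : ℝ) * (1 / 2 ^ n)) ^ (2 * α) by
          have := rho_nonneg (latticePoint n z.1) (latticePoint n z.2)
          gcongr)
      have hg := hX.hasGaussianLaw_fun_sub (s := (j, latticePoint n z.1))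
        (t := (j, latticePoint n z.2))
      have hm : ∫ ω, (X (j, latticePoint n z.1) ω - X (j, latticePoint n z.2) ω) ∂P = 0 := by
        rw [integral_sub (hX.hasGaussianLaw_eval _).integrable
          (hX.hasGaussianLaw_eval _).integrable, h0, h0, sub_zero]
      refine (measure_abs_ge_le hg hm hs hvar (by positivity)).trans (le_of_eq ?_)
      congr 3
      have e1 : ((N + 1 : ℝ) * (1 / 2 ^ n)) ^ (2 * α) = (N + 1 : ℝ) ^ (2 * α) * (r ^ n) ^ 2 := by
        rw [Real.mul_rpow (by positivity) (by positivity)]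
        congr 1
        have e2 : (1 / 2 ^ n : ℝ) = (2 : ℝ) ^ (-(n : ℝ)) := by
          rw [Real.rpow_neg (by norm_num), Real.rpow_natCast, one_div]
        have e3 : r ^ n = (2 : ℝ) ^ (-α * n) := (Real.rpow_mul_natCast (by norm_num) _ _).symm
        rw [e2, e3, ← Real.rpow_natCast, ← Real.rpow_mul (by norm_num),
          ← Real.rpow_mul (by norm_num)]
        congr 1
        push_cast
        ring
      rw [e1, hl]
      simp only
      rw [mul_pow, mul_pow, hκ2, Real.sq_sqrt (by positivity)]
      field_simp
    calc P (B n) ≤ ∑ j : Fin d, P (⋃ z ∈ Q n,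
          {ω | l n ≤ |X (j, latticePoint n z.1) ω - X (j, latticePoint n z.2) ω|}) :=
          measure_iUnion_fintype_le _ _
      _ ≤ ∑ j : Fin d, ∑ z ∈ Q n,
          P {ω | l n ≤ |X (j, latticePoint n z.1) ω - X (j, latticePoint n z.2) ω|} :=
          Finset.sum_le_sum fun j _ => measure_biUnion_finset_le _ _
      _ ≤ ∑ j : Fin d, ∑ z ∈ Q n, ENNReal.ofReal (2 * Real.exp (-(n * A))) :=
          Finset.sum_le_sum fun j _ => Finset.sum_le_sum fun z hz => hone j z hz
      _ = ENNReal.ofReal (d * ((Q n).card * (2 * Real.exp (-(n * A))))) := by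
          rw [Finset.sum_const, Finset.sum_const, Finset.card_univ, Fintype.card_fin, nsmul_eq_mul,
            nsmul_eq_mul, ENNReal.ofReal_mul (p := (d : ℝ)) (by positivity),
            ENNReal.ofReal_mul (p := ((Q n).card : ℝ)) (by positivity),
            ENNReal.ofReal_natCast, ENNReal.ofReal_natCast]
      _ ≤ _ := by
          refine ENNReal.ofReal_le_ofReal ?_
          have hcard : ((Q n).card : ℝ) ≤ ((3 * M * 2 ^ n : ℝ) ^ (N + 1)) ^ 2 := by
            refine le_trans (Nat.cast_le.2 (Finset.card_filter_le _ _)) ?_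
            rw [Finset.card_product, Nat.cast_mul, sq]
            have := card_latticeBox_le (N := N) hM n
            gcongr
          have hexp : ((2 : ℝ) ^ n) ^ (N + 1) ^ 1 * ((2 : ℝ) ^ n) ^ (N + 1) *
              Real.exp (-(n * A)) = Real.exp (-1) ^ n := by
            have h2 : (2 : ℝ) = Real.exp (Real.log 2) := (Real.exp_log (by norm_num)).symm
            rw [h2]
            simp only [← Real.exp_nat_mul, ← Real.exp_add]
            congr 1
            rw [hA]
            push_cast
            ring
          calc _ ≤ (d : ℝ) * (((3 * M * 2 ^ n : ℝ) ^ (N + 1)) ^ 2 *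
                (2 * Real.exp (-(n * A)))) := by gcongr
            _ = (d * ((3 * M : ℝ) ^ (N + 1)) ^ 2 * 2) * (((2 : ℝ) ^ n) ^ (N + 1) ^ 1 *
                ((2 : ℝ) ^ n) ^ (N + 1) * Real.exp (-(n * A))) := by
                rw [mul_pow (3 * M : ℝ)]; ring
            _ = _ := by rw [hexp]
  have hsum : ∑' n, P (B n) ≠ ∞ := by
    have hgeo : Summable fun n : ℕ => (d * ((3 * M : ℝ) ^ (N + 1)) ^ 2 * 2) * Real.exp (-1) ^ n :=
      (summable_geometric_of_lt_one (Real.exp_pos _).le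
        (Real.exp_lt_one_iff.2 (by norm_num))).mul_left _
    refine ne_top_of_le_ne_top ?_ (ENNReal.tsum_le_tsum hPB)
    rw [← ENNReal.ofReal_tsum_of_nonneg (fun n => by positivity) hgeo]
    exact ENNReal.ofReal_ne_top
  refine ⟨(d + 1) * κ, by positivity, ?_⟩
  filter_upwards [ae_eventually_notMem hsum] with ω hω
  obtain ⟨n₁, hn₁⟩ := eventually_atTop.1 hω
  refine ⟨max n₁ 1, le_max_right _ _, fun n hn k hk k' hk' hkk => ?_⟩
  have hnot := hn₁ n ((le_max_left _ _).trans hn)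
  have hj : ∀ j : Fin d, |X (j, latticePoint n k) ω - X (j, latticePoint n k') ω| ≤ l n := by
    intro j
    by_contra hcon
    refine hnot ?_
    simp only [hB, mem_iUnion]
    exact ⟨j, (k, k'), Finset.mem_filter.2 ⟨Finset.mem_product.2 ⟨hk, hk'⟩, hkk⟩,
      (not_le.1 hcon).le⟩
  refine (norm_le_sum_abs _).trans ?_
  calc _ ≤ ∑ _j : Fin d, l n := Finset.sum_le_sum fun j _ => by simpa using hj j
    _ = d * l n := by simp
    _ ≤ (d + 1) * l n := by
        have : 0 ≤ l n := by positivity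
        nlinarith
    _ = _ := by rw [hl]; ring

end ChainProb

/-! ### The continuous version -/

section Version

variable {N d : ℕ} {H β : ℝ} {f h : E N → ℝ} {Ω : Type*} [MeasurableSpace Ω] {P : Measure Ω}
  {W : Fin d → Test N → Ω → ℝ} {u : ℝ → E N → Ω → E d}

lemma exists_mem_cube (p : ℝ × E N) : ∃ M : ℕ, p ∈ cube N M := by
  obtain ⟨M, hM⟩ := exists_nat_ge (rho p 0)
  obtain ⟨h1, h2⟩ := coord_le_rho p 0
  exact ⟨M, by simpa using h1.trans hM, fun i => by simpa using (h2 i).trans hM⟩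

lemma cube_mono {M M' : ℕ} (h : M ≤ M') : cube N M ⊆ cube N M' := fun _ hp =>
  ⟨hp.1.trans (Nat.cast_le.2 h), fun i => (hp.2 i).trans (Nat.cast_le.2 h)⟩

lemma mem_cube_succ {M : ℕ} {p q : ℝ × E N} (hp : p ∈ cube N M) (h : rho q p ≤ 1) :
    q ∈ cube N (M + 1) := by
  obtain ⟨h1, h2⟩ := coord_le_rho q p
  have key : ∀ a b : ℝ, |b| ≤ M → |a - b| ≤ 1 → |a| ≤ ((M + 1 : ℕ) : ℝ) := by
    intro a b hb hab
    rw [abs_le] at *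
    push_cast
    constructor <;> linarith [hb.1, hb.2, hab.1, hab.2]
  exact ⟨key _ _ hp.1 (h1.trans h), fun i => key _ _ (hp.2 i) ((h2 i).trans h)⟩

lemma continuous_rho_left (p : ℝ × E N) : Continuous fun q => rho q p := by
  unfold rho; fun_prop

/-- The logarithm is dominated by a power, so the modulus vanishes with ρ and yields continuity. -/
lemma modulus_le {α ρ : ℝ} (hα : 0 < α) (h0 : 0 < ρ) (h1 : ρ ≤ 1) :
    ρ ^ α * √(Real.log (1 + ρ⁻¹)) ≤ √(2 ^ α / α * ρ ^ α) := by
  refine Real.le_sqrt_of_sq_le ?_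
  have hinv : 1 ≤ ρ⁻¹ := (one_le_inv₀ h0).2 h1
  have hlog : Real.log (1 + ρ⁻¹) ≤ (2 * ρ⁻¹) ^ α / α :=
    (Real.log_le_rpow_div (by positivity) hα).trans (by gcongr; linarith)
  rw [mul_pow, Real.sq_sqrt (Real.log_nonneg (by linarith))]
  calc (ρ ^ α) ^ 2 * Real.log (1 + ρ⁻¹) ≤ (ρ ^ α) ^ 2 * ((2 * ρ⁻¹) ^ α / α) := by gcongr
    _ = 2 ^ α / α * ρ ^ α := by
        rw [Real.mul_rpow (by norm_num) (by positivity), Real.inv_rpow h0.le]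
        have : ρ ^ α ≠ 0 := by positivity
        field_simp

lemma eLpNorm_two_eq {X : Ω → ℝ} (hX : MemLp X 2 P) :
    eLpNorm X 2 P = ENNReal.ofReal √(∫ ω, X ω ^ 2 ∂P) := by
  rw [integral_sq_eq_norm_toLp hX, Real.sqrt_sq (norm_nonneg _), Lp.norm_toLp,
    ENNReal.ofReal_toReal hX.2.ne]

/-- The limit of the solution along dyadic approximations. -/
def dyadicLimit (u : ℝ → E N → Ω → E d) (t : ℝ) (x : E N) (ω : Ω) : E d :=
  limUnder atTop fun n => (WithLp.toLp 2 fun j =>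
    field u (j, latticePoint n (dyadicFloor n (t, x))) ω : E d)

/-- Chaining makes the dyadic approximations converge at all points simultaneously and gives the
modulus of the limit; mean-square continuity identifies the limit with u at each fixed point. -/
theorem IsSolution.exists_continuousVersion [IsProbabilityMeasure P] (hH : 1 / 2 ≤ H ∧ H < 1)
    (hN : 0 < N) (hβ : 0 < β ∧ β < N)
    (hβH : (N : ℝ) - 2 * H - 1 < β ∧ β < (N : ℝ) - 2 * H + 1)
    (hf : IsSpatialCovariance β f h) (hW : IsNoise P H f W) (hu : IsSolution P H h W u) :
    ∃ v, IsContinuousVersion P u v ∧ ∀ M : ℕ, ∃ K : ℝ, 0 < K ∧ ∀ᵐ ω ∂P, ∃ n₀ : ℕ,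
      ∀ p ∈ cube N M, ∀ q ∈ cube N M, 0 < rho p q → rho p q ≤ 1 / 2 ^ n₀ →
        ‖v p.1 p.2 ω - v q.1 q.2 ω‖ ≤ K * (rho p q ^ ((2 * H + 1 - N + β) / 2) *
          √(Real.log (1 + (rho p q)⁻¹))) := by
  set α := (2 * H + 1 - N + β) / 2 with hαdef
  have hα : 0 < α := by rw [hαdef]; linarith [hβH.1]
  have h2α : 2 * H + 1 - N + β = 2 * α := by rw [hαdef]; ring
  obtain ⟨hX, h0⟩ := hu.isGaussianProcess hW
  have hvar : ∀ M : ℕ, ∃ C : ℝ, 0 < C ∧ ∀ (j : Fin d) (p q : ℝ × E N), p.1 ≤ (M + 1 : ℕ) →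
      q.1 ≤ (M + 1 : ℕ) → rho p q ≤ N + 1 →
      ∫ ω, (StochWave.field u (j, p) ω - StochWave.field u (j, q) ω) ^ 2 ∂P ≤
        C * rho p q ^ (2 * α) := fun M => by
    rw [← h2α]
    exact hu.integral_sq_sub_le hH hN hβ hβH hf hW (by positivity) (by positivity)
  choose C hC0 hC using hvar
  -- Working on the cube M + 1 gives every point of the cube M a full neighbourhood on which the
  -- modulus holds.
  choose K hK0 hK using fun M : ℕ => ae_exists_chainBound hX h0 (M := M + 1) (by omega) (hC0 M)
    hα (hC M)
  have hr1 : (2 : ℝ) ^ (-α) < 1 := Real.rpow_lt_one_of_one_lt_of_neg (by norm_num) (by linarith)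
  obtain ⟨S, hS0, hS⟩ := exists_chaining_const (r := 2 ^ (-α)) (by positivity) hr1
  set v := dyadicLimit u with hvdef
  have hall := ae_all_iff.2 hK
  have hlim : ∀ᵐ ω ∂P, ∀ p : ℝ × E N, Tendsto (fun n => (WithLp.toLp 2 fun j =>
      StochWave.field u (j, latticePoint n (dyadicFloor n p)) ω : E d)) atTop
      (𝓝 (v p.1 p.2 ω)) := by
    filter_upwards [hall] with ω hω p
    obtain ⟨M, hM⟩ := exists_mem_cube p
    obtain ⟨n₀, hn₀, hch⟩ := hω M
    obtain ⟨y, hy, -⟩ := hch.exists_limit hS (hK0 M).le hn₀ (cube_mono (Nat.le_succ M) hM)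
    exact tendsto_nhds_limUnder ⟨y, hy⟩
  have hmod : ∀ M : ℕ, ∀ᵐ ω ∂P, ∃ n₀ : ℕ,
      ∀ p ∈ cube N (M + 1), ∀ q ∈ cube N (M + 1), 0 < rho p q → rho p q ≤ 1 / 2 ^ n₀ →
        ‖v p.1 p.2 ω - v q.1 q.2 ω‖ ≤ (2 * S + 1) * K M * (2 ^ α / √(Real.log 2)) *
          (rho p q ^ α * √(Real.log (1 + (rho p q)⁻¹))) := by
    intro M
    filter_upwards [hK M, hlim] with ω hω hl
    obtain ⟨n₀, hn₀, hch⟩ := hω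
    exact ⟨n₀, fun p hp q hq h1 h2 => hch.norm_sub_le (g := fun p => v p.1 p.2 ω) hα hS0 hS
      (hK0 M).le hn₀ (fun p _ => hl p) hp hq h1 h2⟩
  have hlog2 : 0 < Real.log 2 := Real.log_pos (by norm_num)
  have hKpos : ∀ M, 0 < (2 * S + 1) * K M * (2 ^ α / √(Real.log 2)) := fun M => by
    have := hK0 M
    positivity
  refine ⟨v, ⟨fun t x ht => ?_, ?_⟩, fun M => ⟨_, hKpos M, ?_⟩⟩
  · have hj : ∀ j : Fin d, (fun ω => v t x ω j) =ᵐ[P] fun ω => u t x ω j := by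
      intro j
      have hm : ∀ q, MemLp (StochWave.field u q) 2 P := fun q =>
        (hX.hasGaussianLaw_eval q).memLp_two
      have e : (fun ω => u t x ω j) = StochWave.field u (j, (t, x)) := by
        ext ω
        simp [StochWave.field, max_eq_left ht]
      rw [e]
      set X : ℕ → Ω → ℝ := fun n =>
        StochWave.field u (j, latticePoint n (dyadicFloor n (t, x))) with hXdef
      have h1 : TendstoInMeasure P X atTop (fun ω => v t x ω j) := by
        refine tendstoInMeasure_of_tendsto_ae (fun n => (hm _).1) ?_
        filter_upwards [hlim] with ω hω
        have := hω (t, x)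
        exact ((EuclideanSpace.proj (𝕜 := ℝ) j).continuous.tendsto _).comp this
      -- The same approximations converge almost surely to v and in L² to u; limits in measure are
      -- unique.
      have h2 : TendstoInMeasure P X atTop (StochWave.field u (j, (t, x))) := by
        refine tendstoInMeasure_of_tendsto_eLpNorm (p := 2) (by norm_num) (fun n => (hm _).1)
          (hm _).1 ?_
        obtain ⟨M, hM⟩ := exists_mem_cube ((t, x) : ℝ × E N)
        have hM' := cube_mono (Nat.le_succ M) hM
        have hb : ∀ n, ∫ ω, (X n ω - StochWave.field u (j, (t, x)) ω) ^ 2 ∂P ≤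
            C M * ((N + 1) * (1 / 2 ^ n)) ^ (2 * α) := by
          intro n
          have hr := rho_dyadicFloor_le n ((t, x) : ℝ × E N)
          have h2n : (1 : ℝ) / 2 ^ n ≤ 1 := by
            rw [div_le_one (by positivity)]; exact one_le_pow₀ (by norm_num)
          refine (hC M j _ _ (latticePoint_fst_le (dyadicFloor_mem hM' n))
            ((le_abs_self _).trans hM'.1)
            (hr.trans (by nlinarith [(Nat.cast_nonneg N : (0 : ℝ) ≤ N)]))).trans ?_
          have := rho_nonneg (latticePoint n (dyadicFloor n ((t, x) : ℝ × E N))) (t, x)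
          have := hC0 M
          gcongr
        have hz : Tendsto (fun n : ℕ => ENNReal.ofReal
            √(C M * ((N + 1) * (1 / 2 ^ n)) ^ (2 * α))) atTop (𝓝 0) := by
          have h3 : Tendsto (fun n : ℕ => (1 : ℝ) / 2 ^ n) atTop (𝓝 0) := by
            simpa [one_div, inv_pow] using tendsto_pow_atTop_nhds_zero_of_lt_one
              (show (0 : ℝ) ≤ 1 / 2 by norm_num) (by norm_num)
          have h4 : Continuous fun y : ℝ => ENNReal.ofReal
              √(C M * ((N + 1) * y) ^ (2 * α)) := by
            have : Continuous fun y : ℝ => ((N + 1) * y) ^ (2 * α) :=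
              Continuous.rpow_const (by fun_prop) fun _ => Or.inr (by positivity)
            exact ENNReal.continuous_ofReal.comp (Real.continuous_sqrt.comp (this.const_mul _))
          have h5 := (h4.tendsto 0).comp h3
          simpa [Real.zero_rpow (show 2 * α ≠ 0 by positivity), Function.comp_def] using h5
        refine tendsto_of_tendsto_of_tendsto_of_le_of_le tendsto_const_nhds hz (fun _ => bot_le)
          fun n => ?_
        rw [eLpNorm_two_eq ((hm _).sub (hm _))]
        exact ENNReal.ofReal_le_ofReal (Real.sqrt_le_sqrt (hb n))
      exact tendstoInMeasure_ae_unique h1 h2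
    filter_upwards [ae_all_iff.2 hj] with ω hω
    ext j
    exact hω j
  · filter_upwards [ae_all_iff.2 hmod] with ω hω
    refine Continuous.continuousOn (continuous_iff_continuousAt.2 fun p => ?_)
    obtain ⟨M, hM⟩ := exists_mem_cube p
    obtain ⟨n₀, hn₀⟩ := hω M
    have hρ := continuous_rho_left p
    have hself : rho p p = 0 := by simp [rho]
    have hev : ∀ᶠ q in 𝓝 p, rho q p < 1 / 2 ^ n₀ :=
      (hρ.tendsto p).eventually_lt_const (by rw [hself]; positivity)
    set B := (2 * S + 1) * K M * (2 ^ α / √(Real.log 2)) with hB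
    have hcont : Continuous fun q => B * √(2 ^ α / α * rho q p ^ α) :=
      (Real.continuous_sqrt.comp ((hρ.rpow_const fun _ => Or.inr hα.le).const_mul _)).const_mul _
    have hlim0 : Tendsto (fun q => B * √(2 ^ α / α * rho q p ^ α)) (𝓝 p) (𝓝 0) := by
      have := hcont.tendsto p
      simpa [hself, Real.zero_rpow hα.ne'] using this
    rw [ContinuousAt, tendsto_iff_norm_sub_tendsto_zero]
    refine squeeze_zero' (Eventually.of_forall fun _ => norm_nonneg _) ?_ hlim0
    filter_upwards [hev] with q hq
    have hq1 : rho q p ≤ 1 := hq.le.trans (by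
      rw [div_le_one (by positivity)]; exact one_le_pow₀ (by norm_num))
    rcases (rho_nonneg q p).eq_or_lt with h0 | h0
    · have : q = p := by
        obtain ⟨h1, h2⟩ := coord_le_rho q p
        rw [← h0] at h1 h2
        refine Prod.ext (by linarith [abs_nonpos_iff.1 h1]) ?_
        ext i
        linarith [abs_nonpos_iff.1 (h2 i)]
      rw [this, sub_self, norm_zero]
      have := hKpos M
      positivity
    · refine (hn₀ q (mem_cube_succ hM hq1) p (cube_mono (Nat.le_succ M) hM) h0 hq.le).trans ?_
      have := hKpos M
      gcongr
      exact modulus_le hα h0 hq1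
  · filter_upwards [hmod M] with ω hω
    obtain ⟨n₀, hn₀⟩ := hω
    exact ⟨n₀, fun p hp q hq => hn₀ p (cube_mono (Nat.le_succ M) hp) q
      (cube_mono (Nat.le_succ M) hq)⟩

end Version

/-! ### The modulus of continuity along a dense sequence -/

section SeqModulus

variable {N d : ℕ}

/-- The normalisation `ρ^α √log(1 + 1/ρ)`. -/
def modulus (α ρ : ℝ) : ℝ := ρ ^ α * √(Real.log (1 + ρ⁻¹))

lemma modulus_pos {α ρ : ℝ} (h : 0 < ρ) : 0 < modulus α ρ := by
  have h1 : 0 < Real.log (1 + ρ⁻¹) := Real.log_pos (by have := inv_pos.2 h; linarith)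
  unfold modulus
  positivity

lemma continuousAt_modulus {α ρ : ℝ} (h : 0 < ρ) : ContinuousAt (modulus α) ρ := by
  unfold modulus
  have h1 : (1 + ρ⁻¹) ≠ 0 := by positivity
  exact (Real.continuousAt_rpow_const _ _ (Or.inl h.ne')).mul
    (((continuousAt_const.add (continuousAt_inv₀ h.ne')).log h1).sqrt)

/-- The values of a family of coordinates at the `n`-th point, as a vector. -/
def vec (x : Fin d × ℕ → ℝ) (n : ℕ) : E d := WithLp.toLp 2 fun j => x (j, n)

/-- The analogue of `modulusSup` along a sequence of points `z`. -/
def seqSup (α : ℝ) (z : ℕ → ℝ × E N) (x : Fin d × ℕ → ℝ) (ε : ℝ) : ℝ≥0∞ :=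
  ⨆ (n : ℕ) (m : ℕ) (_ : 0 < rho (z n) (z m) ∧ rho (z n) (z m) ≤ ε),
    ENNReal.ofReal (‖vec x n - vec x m‖ / modulus α (rho (z n) (z m)))

/-- The limit of `seqSup` as `ε → 0`. -/
def seqLim (α : ℝ) (z : ℕ → ℝ × E N) (x : Fin d × ℕ → ℝ) : ℝ≥0∞ :=
  ⨅ k : ℕ, seqSup α z x (1 / (k + 1))

lemma seqSup_mono (α : ℝ) (z : ℕ → ℝ × E N) (x : Fin d × ℕ → ℝ) : Monotone (seqSup α z x) :=
  fun _ _ h => iSup_mono fun _ => iSup_mono fun _ =>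
    iSup_mono' fun hr => ⟨⟨hr.1, hr.2.trans h⟩, le_rfl⟩

/-- Only countably many coordinates enter, which is why the modulus is first studied along a
sequence. -/
lemma measurable_seqLim (α : ℝ) (z : ℕ → ℝ × E N) :
    Measurable fun x : Fin d × ℕ → ℝ => seqLim α z x := by
  unfold seqLim seqSup
  refine Measurable.iInf fun k => Measurable.iSup fun n => Measurable.iSup fun m =>
    Measurable.iSup fun _ => ?_
  have h : ∀ n, Measurable fun x : Fin d × ℕ → ℝ => vec x n := fun n => by
    unfold vec; fun_prop
  exact (((h n).sub (h m)).norm.div_const _).ennreal_ofReal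

/-- A Hölder-α perturbation contributes at most a constant times 1/√log(1 + 1/ρ), which disappears
as the scale tends to zero. -/
lemma seqLim_add_le {α K : ℝ} (z : ℕ → ℝ × E N) (x g : Fin d × ℕ → ℝ)
    (hg : ∀ j n m, rho (z n) (z m) ≤ 1 → |g (j, n) - g (j, m)| ≤ K * rho (z n) (z m) ^ α) :
    seqLim α z (fun i => x i + g i) ≤ seqLim α z x := by
  set b : ℕ → ℝ≥0∞ := fun k => ENNReal.ofReal (d * |K| * (√(Real.log (1 + (k + 1 : ℝ))))⁻¹) with hb
  have hstep : ∀ k : ℕ, seqSup α z (fun i => x i + g i) (1 / (k + 1)) ≤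
      seqSup α z x (1 / (k + 1)) + b k := by
    intro k
    refine iSup_le fun n => iSup_le fun m => iSup_le fun hr => ?_
    set ρ := rho (z n) (z m) with hρ
    obtain ⟨h0, h1⟩ := hr
    have hk1 : (1 : ℝ) / (k + 1) ≤ 1 := by
      rw [div_le_one (by positivity)]; linarith [(Nat.cast_nonneg k : (0 : ℝ) ≤ k)]
    have hmp := modulus_pos (α := α) h0
    have h2 : ‖vec (fun i => x i + g i) n - vec (fun i => x i + g i) m‖ ≤
        ‖vec x n - vec x m‖ + d * |K| * ρ ^ α := by
      have e : vec (fun i => x i + g i) n - vec (fun i => x i + g i) m =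
          (vec x n - vec x m) + (vec g n - vec g m) := by
        ext j; simp [vec]; ring
      rw [e]
      refine (norm_add_le _ _).trans (add_le_add_right ?_ _)
      refine (norm_le_sum_abs _).trans ?_
      calc _ ≤ ∑ _j : Fin d, |K| * ρ ^ α := Finset.sum_le_sum fun j _ => by
            refine le_trans ?_ (mul_le_mul_of_nonneg_right (le_abs_self K) (by positivity))
            exact hg j n m (h1.trans hk1)
        _ = _ := by simp; ring
    have h3 : d * |K| * ρ ^ α / modulus α ρ ≤ d * |K| * (√(Real.log (1 + (k + 1 : ℝ))))⁻¹ := by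
      have hk2 : (k + 1 : ℝ) ≤ ρ⁻¹ := by
        rw [le_inv_comm₀ (by positivity) h0, ← one_div]; exact h1
      have hl : 0 < Real.log (1 + (k + 1 : ℝ)) :=
        Real.log_pos (by linarith [(Nat.cast_nonneg k : (0 : ℝ) ≤ k)])
      have hra : ρ ^ α ≠ 0 := by positivity
      unfold modulus
      rw [mul_div_assoc, div_mul_cancel_left₀ hra]
      gcongr
    calc ENNReal.ofReal (‖vec (fun i => x i + g i) n - vec (fun i => x i + g i) m‖ / modulus α ρ)
        ≤ ENNReal.ofReal (‖vec x n - vec x m‖ / modulus α ρ +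
            d * |K| * (√(Real.log (1 + (k + 1 : ℝ))))⁻¹) := by
          refine ENNReal.ofReal_le_ofReal (le_trans ?_ (add_le_add_right h3 _))
          rw [← add_div]
          gcongr
      _ = ENNReal.ofReal (‖vec x n - vec x m‖ / modulus α ρ) + b k :=
          ENNReal.ofReal_add (by positivity) (by positivity)
      _ ≤ _ := by
          gcongr
          exact le_iSup₂_of_le n m (le_iSup_of_le ⟨h0, h1⟩ le_rfl)
  have hlim : Tendsto (fun k : ℕ => seqSup α z x (1 / (k + 1)) + b k) atTop
      (𝓝 (seqLim α z x + 0)) := by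
    refine Tendsto.add ?_ ?_
    · refine tendsto_atTop_iInf fun k l hkl => seqSup_mono α z x ?_
      gcongr
    · have h1 : Tendsto (fun k : ℕ => 1 + ((k : ℝ) + 1)) atTop atTop :=
        tendsto_atTop_add_const_left _ _
          (tendsto_atTop_add_const_right _ _ tendsto_natCast_atTop_atTop)
      have h2 : Tendsto (fun k : ℕ => (√(Real.log (1 + ((k : ℝ) + 1))))⁻¹) atTop (𝓝 0) :=
        (Real.tendsto_sqrt_atTop.comp (Real.tendsto_log_atTop.comp h1)).inv_tendsto_atTop
      have h3 := (ENNReal.continuous_ofReal.tendsto _).comp (h2.const_mul (d * |K|))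
      simpa [Function.comp_def] using h3
  rw [add_zero] at hlim
  exact ge_of_tendsto' hlim fun k => (iInf_le _ k).trans (hstep k)

lemma seqLim_add_eq {α K : ℝ} (z : ℕ → ℝ × E N) (x g : Fin d × ℕ → ℝ)
    (hg : ∀ j n m, rho (z n) (z m) ≤ 1 → |g (j, n) - g (j, m)| ≤ K * rho (z n) (z m) ^ α) :
    seqLim α z (fun i => x i + g i) = seqLim α z x := by
  refine le_antisymm (seqLim_add_le z x g hg) ?_
  have h := seqLim_add_le (K := K) z (fun i => x i + g i) (fun i => -g i) fun j n m hr => by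
    rw [neg_sub_neg, abs_sub_comm]
    exact hg j n m hr
  simpa using h

lemma modulusSup_mono (α : ℝ) (I : Set (ℝ × E N)) (w : ℝ → E N → E d) :
    Monotone (modulusSup α I w) :=
  fun _ _ h => iSup₂_mono fun _ _ => iSup₂_mono fun _ _ =>
    iSup_mono' fun hr => ⟨⟨hr.1, hr.2.trans h⟩, le_rfl⟩

/-- The modulus of continuity of a continuous function is determined by a dense sequence. -/
theorem tendsto_modulusSup {α : ℝ} {I : Set (ℝ × E N)} {w : ℝ → E N → E d}
    (hw : ContinuousOn (fun p : ℝ × E N => w p.1 p.2) I) {z : ℕ → I} (hz : DenseRange z) :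
    Tendsto (modulusSup α I w) (𝓝[>] 0)
      (𝓝 (seqLim α (fun n => (z n : ℝ × E N)) fun i => w (z i.2).1.1 (z i.2).1.2 i.1)) := by
  set x : Fin d × ℕ → ℝ := fun i => w (z i.2).1.1 (z i.2).1.2 i.1 with hx
  have hvec : ∀ n, vec x n = w (z n).1.1 (z n).1.2 := fun n => by ext j; simp [vec, hx]
  have h1 : ∀ ε, seqSup α (fun n => (z n : ℝ × E N)) x ε ≤ modulusSup α I w ε := by
    intro ε
    refine iSup_le fun n => iSup_le fun m => iSup_le fun hr => ?_
    rw [hvec, hvec]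
    exact le_iSup₂_of_le _ (z n).2 (le_iSup₂_of_le _ (z m).2 (le_iSup_of_le hr le_rfl))
  -- Approximating a pair by the dense sequence may slightly increase its distance, hence the larger
  -- ε'; the limit at 0 is unaffected.
  have h2 : ∀ ε ε', ε < ε' → modulusSup α I w ε ≤ seqSup α (fun n => (z n : ℝ × E N)) x ε' := by
    intro ε ε' hε
    refine iSup₂_le fun p hp => iSup₂_le fun q hq => iSup_le fun hr => ?_
    by_contra hcon
    rw [not_le] at hcon
    have hrc : Continuous fun y : I × I => rho y.1.1 y.2.1 := by unfold rho; fun_prop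
    have hwc : Continuous fun y : I => w y.1.1 y.1.2 := hw.domRestrict
    have hΨ : ContinuousAt (fun y : I × I => ENNReal.ofReal
        (‖w y.1.1.1 y.1.1.2 - w y.2.1.1 y.2.1.2‖ / modulus α (rho y.1.1 y.2.1)))
        (⟨p, hp⟩, ⟨q, hq⟩) := by
      refine ENNReal.continuous_ofReal.continuousAt.comp (ContinuousAt.div ?_ ?_
        (modulus_pos hr.1).ne')
      · exact (((hwc.comp continuous_fst).sub (hwc.comp continuous_snd)).norm).continuousAt
      · exact ContinuousAt.comp (f := fun y : I × I => rho y.1.1 y.2.1)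
          (continuousAt_modulus (α := α) hr.1) hrc.continuousAt
    have hev1 := hΨ.eventually_const_lt hcon
    have hev2 := (hrc.tendsto (⟨p, hp⟩, ⟨q, hq⟩)).eventually_const_lt hr.1
    have hev3 := (hrc.tendsto (⟨p, hp⟩, ⟨q, hq⟩)).eventually_lt_const (hr.2.trans_lt hε)
    obtain ⟨y, ⟨⟨n, m⟩, hnm⟩, hy⟩ := (hz.prodMap hz).inter_nhds_nonempty
      (hev1.and (hev2.and hev3))
    subst hnm
    simp only [Prod.map] at hy
    refine absurd hy.1 (not_lt.2 ?_)
    rw [← hvec, ← hvec]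
    exact le_iSup₂_of_le (f := fun n m => ⨆ (_ : 0 < rho (z n : ℝ × E N) (z m) ∧
      rho (z n : ℝ × E N) (z m) ≤ ε'), ENNReal.ofReal (‖vec x n - vec x m‖ /
      modulus α (rho (z n : ℝ × E N) (z m)))) n m (le_iSup_of_le ⟨hy.2.1, hy.2.2.le⟩ le_rfl)
  have h3 : sInf (modulusSup α I w '' Ioi 0) = seqLim α (fun n => (z n : ℝ × E N)) x := by
    refine le_antisymm (le_iInf fun k => ?_) (le_sInf ?_)
    · have hk : (1 : ℝ) / (k + 1 + 1) < 1 / (k + 1) := by gcongr; linarith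
      have hk0 : (1 : ℝ) / (k + 1 + 1) ∈ Ioi (0 : ℝ) := by
        rw [mem_Ioi]
        positivity
      exact (sInf_le (mem_image_of_mem _ hk0)).trans (h2 _ _ hk)
    · rintro _ ⟨ε, hε, rfl⟩
      obtain ⟨k, hk⟩ := exists_nat_one_div_lt (show (0 : ℝ) < ε from hε)
      exact (iInf_le _ k).trans ((h1 _).trans (modulusSup_mono α I w hk.le))
  rw [← h3]
  exact (modulusSup_mono α I w).tendsto_nhdsGT 0

end SeqModulus

/-! ### Deterministic limit and lower bound for the solution -/

section Final

variable {N d : ℕ} {H β : ℝ} {f h : E N → ℝ} {Ω : Type*} [MeasurableSpace Ω] {P : Measure Ω}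
  {W : Fin d → Test N → Ω → ℝ} {u : ℝ → E N → Ω → E d}

/-- By the variance bound a function Lipschitz in the canonical metric is Hölder α in space-time, so
`seqLim` is invariant under the shifts of the zero-one law. -/
theorem IsSolution.exists_seqLim_eq_const [IsProbabilityMeasure P] (hH : 1 / 2 ≤ H ∧ H < 1)
    (hN : 0 < N) (hβ : 0 < β ∧ β < N)
    (hβH : (N : ℝ) - 2 * H - 1 < β ∧ β < (N : ℝ) - 2 * H + 1)
    (hf : IsSpatialCovariance β f h) (hW : IsNoise P H f W) (hu : IsSolution P H h W u)
    {z : ℕ → ℝ × E N} {T : ℝ} (hT : 0 < T) (hz : ∀ n, (z n).1 ≤ T) :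
    ∃ C, ∀ᵐ ω ∂P, seqLim ((2 * H + 1 - N + β) / 2) z
      (fun i : Fin d × ℕ => StochWave.field u (i.1, z i.2) ω) = C := by
  obtain ⟨hX, h0⟩ := hu.isGaussianProcess hW
  obtain ⟨C, hC, hvar⟩ := hu.integral_sq_sub_le hH hN hβ hβH hf hW hT one_pos
  set α := (2 * H + 1 - N + β) / 2 with hα
  have h2α : 2 * H + 1 - N + β = 2 * α := by rw [hα]; ring
  rw [h2α] at hvar
  set Y : Fin d × ℕ → Ω → ℝ := fun i => StochWave.field u (i.1, z i.2) with hY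
  have hYg : IsGaussianProcess Y P := hX.comp_right fun i : Fin d × ℕ => (i.1, z i.2)
  have hYm := fun i => hYg.aemeasurable i
  -- The zero-one law wants measurable coordinates; as there are countably many, replacing each by a
  -- measurable copy costs one null set.
  set Y' : Fin d × ℕ → Ω → ℝ := fun i => (hYm i).mk (Y i) with hY'
  have hae : ∀ i, Y i =ᵐ[P] Y' i := fun i => (hYm i).ae_eq_mk
  obtain ⟨L, hL⟩ := exists_ae_eq_const_of_shift_invariant (hYg.congr hae)
    (fun i => (hYm i).measurable_mk)
    (fun i => by rw [← integral_congr_ae (hae i)]; exact h0 _) (measurable_seqLim (d := d) α z)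
    (by
      rintro x g ⟨K, hK⟩
      refine seqLim_add_eq (K := |K| * √C) z x g fun j n m hr => ?_
      refine (hK _ _).trans ?_
      have e : ∫ ω, (Y' (j, n) ω - Y' (j, m) ω) ^ 2 ∂P =
          ∫ ω, (Y (j, n) ω - Y (j, m) ω) ^ 2 ∂P := by
        refine integral_congr_ae ?_
        filter_upwards [hae (j, n), hae (j, m)] with ω h1 h2
        rw [h1, h2]
      have hρ := rho_nonneg (z n) (z m)
      have h3 : √(∫ ω, (Y' (j, n) ω - Y' (j, m) ω) ^ 2 ∂P) ≤ √C * rho (z n) (z m) ^ α := by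
        rw [e]
        refine (Real.sqrt_le_sqrt (hvar j _ _ (hz n) (hz m) hr)).trans (le_of_eq ?_)
        rw [Real.sqrt_mul hC.le, mul_comm 2 α, Real.rpow_mul hρ, Real.rpow_two,
          Real.sqrt_sq (by positivity)]
      calc _ ≤ |K| * √(∫ ω, (Y' (j, n) ω - Y' (j, m) ω) ^ 2 ∂P) := by
            gcongr; exact le_abs_self K
        _ ≤ |K| * (√C * rho (z n) (z m) ^ α) := by gcongr
        _ = _ := by ring)
  refine ⟨L, ?_⟩
  filter_upwards [hL, ae_all_iff.2 hae] with ω h1 h2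
  rw [← h1]
  congr 1
  ext i
  exact h2 i

/-- The small ball estimate for the increments along an arithmetic progression. -/
theorem IsSolution.measure_increments_le [IsProbabilityMeasure P] (hH : 1 / 2 ≤ H ∧ H < 1)
    (hN : 0 < N) (hβ : 0 < β ∧ β < N) (hf : IsSpatialCovariance β f h) (hW : IsNoise P H f W)
    (hu : IsSolution P H h W u) {a : ℝ} (ha : 0 < a) {D : ℝ × E N} {Φ : E N → ℂ}
    (hΦ : IsProfile H β D Φ) :
    ∃ c : ℝ, 0 < c ∧ ∀ (j : Fin d) (p : ℝ × E N) (m : ℕ) (δ x : ℝ), 0 < δ → δ ≤ 1 → 0 ≤ x →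
      (∀ k : ℕ, k ≤ m → a ≤ p.1 + k * δ * D.1) →
      P {ω | ∀ k < m, |StochWave.field u (j, p + ((k + 1 : ℕ) * δ) • D) ω -
        StochWave.field u (j, p + (k * δ) • D) ω| ≤
          x * (c * δ ^ ((2 * H + 1 - N + β) / 2))} ≤
        (1 - ENNReal.ofReal (tailBound x)) ^ m := by
  obtain ⟨hX, h0⟩ := hu.isGaussianProcess hW
  obtain ⟨c, hc, hvar⟩ := hu.integral_sq_add_ge hH hN hβ hf hW ha hΦ
  refine ⟨√c, Real.sqrt_pos.2 hc, fun j p m δ x hδ hδ1 hx hp => ?_⟩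
  set Y : ℕ → Ω → ℝ := fun k => StochWave.field u (j, p + (k * δ) • D) with hY
  have hYg : IsGaussianProcess Y P := hX.comp_right fun k : ℕ => (j, p + (k * δ) • D)
  have hYi : ∀ k, Integrable (Y k) P := fun k => (hYg.hasGaussianLaw_eval k).integrable
  have hZg : IsGaussianProcess (fun k ω => Y (k + 1) ω - Y k ω) P :=
    IsGaussianProcess.of_eq_sum hYg fun k => by
      obtain ⟨I, w, hw⟩ := exists_sum_eq_sub Y (k + 1) (fun _ : Unit => k) fun _ => 1
      exact ⟨I, w, fun ω => by rw [← hw]; simp⟩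
  refine measure_forall_abs_le (Z := fun k ω => Y (k + 1) ω - Y k ω) hZg (fun k => ?_)
    (by positivity) hx m fun k hk w => ?_
  · rw [integral_sub (hYi _) (hYi _), h0, h0, sub_zero]
  · set node : Unit ⊕ (Fin k ⊕ Fin k) → ℕ :=
      Sum.elim (fun _ => k) (Sum.elim (fun i => (i : ℕ) + 1) fun i => (i : ℕ)) with hnode
    have hnk : ∀ i, node i ≤ k := by
      rintro (i | i | i) <;> simp only [hnode, Sum.elim_inl, Sum.elim_inr] <;> omega
    have hpt : ∀ i, p + ((k + 1 : ℕ) * δ) • D + (((node i : ℝ) - (k + 1 : ℕ)) * δ) • D =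
        p + (node i * δ) • D := by
      intro i
      rw [add_assoc, ← add_smul]
      congr 2
      ring
    have hv := hvar j (Unit ⊕ (Fin k ⊕ Fin k))
      (Sum.elim (fun _ => -1) (Sum.elim w fun i => -w i))
      (fun i => ((node i : ℝ) - (k + 1 : ℕ)) * δ) (p + ((k + 1 : ℕ) * δ) • D) δ hδ hδ1
      (by simpa using hp (k + 1) hk) (fun i => by
        have h1 := hp (node i) ((hnk i).trans hk.le)
        have h2 : (p + ((k + 1 : ℕ) * δ) • D).1 + ((node i : ℝ) - (k + 1 : ℕ)) * δ * D.1 =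
            p.1 + node i * δ * D.1 := by
          simp only [Prod.fst_add, Prod.smul_fst, smul_eq_mul]
          ring
        rw [h2]
        exact h1) (fun i => by
        rw [abs_mul, abs_of_pos hδ]
        have h1 : (node i : ℝ) + 1 ≤ (k + 1 : ℕ) := by
          exact_mod_cast Nat.succ_le_succ (hnk i)
        have h2 : 1 ≤ |(node i : ℝ) - (k + 1 : ℕ)| := by
          rw [le_abs]; right; linarith
        nlinarith)
    simp only [hpt] at hv
    have hs : (√c * δ ^ ((2 * H + 1 - N + β) / 2)) ^ 2 = c * δ ^ (2 * H + 1 - N + β) := by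
      rw [mul_pow, Real.sq_sqrt hc.le, ← Real.rpow_natCast, ← Real.rpow_mul hδ.le]
      congr 2
      push_cast
      ring
    rw [hs]
    refine hv.trans (le_of_eq ?_)
    congr 1
    ext ω
    congr 1
    simp only [Fintype.sum_sum_type, hnode, Sum.elim_inl, Sum.elim_inr, Finset.univ_unique,
      Finset.sum_singleton, neg_mul, one_mul, Finset.sum_neg_distrib, mul_sub,
      Finset.sum_sub_distrib, hY]
    ring

/-- The threshold makes a single tail at least c₀ 2^{-n/2}, so 2ⁿ trials fail together with
probability at most exp(-c₀ 2^{n/2}). -/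
lemma tendsto_one_sub_tailBound_pow : Tendsto (fun n : ℕ =>
    (1 - ENNReal.ofReal (tailBound (√(Real.log 2 / 2) * √n))) ^ 2 ^ n) atTop (𝓝 0) := by
  have hlog2 : 0 < Real.log 2 := Real.log_pos (by norm_num)
  set c₀ : ℝ := (√(2 * Real.pi))⁻¹ * Real.exp (-1) with hc₀
  have hc₀0 : 0 < c₀ := by positivity
  have hq : ∀ n : ℕ, c₀ * Real.exp (-(n * Real.log 2 / 2)) ≤
      tailBound (√(Real.log 2 / 2) * √n) := by
    intro n
    set y := √(Real.log 2 / 2) * √n with hy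
    have hy2 : y ^ 2 = n * Real.log 2 / 2 := by
      rw [hy, mul_pow, Real.sq_sqrt (by positivity), Real.sq_sqrt (by positivity)]; ring
    rw [hc₀, mul_assoc, ← Real.exp_add, tailBound]
    gcongr
    -- This is (y + 1)²/2 ≤ y² + 1.
    nlinarith [sq_nonneg (y - 1)]
  have hle : ∀ n : ℕ, (1 - ENNReal.ofReal (tailBound (√(Real.log 2 / 2) * √n))) ^ 2 ^ n ≤
      ENNReal.ofReal (Real.exp (-(c₀ * Real.exp (n * (Real.log 2 / 2))))) := by
    intro n
    set q := tailBound (√(Real.log 2 / 2) * √n) with hqd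
    have hq0 : 0 ≤ q := by rw [hqd, tailBound]; positivity
    have hq1 : q ≤ 1 := tailBound_le_one
    rw [← ENNReal.ofReal_one, ← ENNReal.ofReal_sub _ hq0, ← ENNReal.ofReal_pow (by linarith)]
    refine ENNReal.ofReal_le_ofReal ?_
    calc (1 - q) ^ 2 ^ n ≤ Real.exp (-q) ^ 2 ^ n := by
          have h1q : 0 ≤ 1 - q := by linarith
          exact pow_le_pow_left₀ h1q (Real.one_sub_le_exp_neg q) _
      _ = Real.exp (-(q * 2 ^ n)) := by
          rw [← Real.exp_nat_mul]; congr 1; push_cast; ring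
      _ ≤ _ := by
          have e : c₀ * Real.exp (n * (Real.log 2 / 2)) =
              c₀ * Real.exp (-(n * Real.log 2 / 2)) * 2 ^ n := by
            have h2 : (2 : ℝ) ^ n = Real.exp (n * Real.log 2) := by
              rw [Real.exp_nat_mul, Real.exp_log (by norm_num)]
            rw [h2, mul_assoc c₀, ← Real.exp_add (-(n * Real.log 2 / 2))]
            congr 2
            ring
          rw [e]
          gcongr
          exact hq n
  have h1 : Tendsto (fun n : ℕ => c₀ * Real.exp (n * (Real.log 2 / 2))) atTop atTop :=
    (Real.tendsto_exp_atTop.comp (tendsto_natCast_atTop_atTop.atTop_mul_const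
      (by positivity))).const_mul_atTop hc₀0
  have h2 := (ENNReal.continuous_ofReal.tendsto _).comp (Real.tendsto_exp_neg_atTop_nhds_zero.comp h1)
  rw [ENNReal.ofReal_zero] at h2
  exact tendsto_of_tendsto_of_tendsto_of_le_of_le tendsto_const_nhds h2 (fun _ => bot_le) hle

/-- Cut the segment into 2ⁿ steps. For infinitely many n some step has an increment above a multiple
of √n δₙ^α, which is of the order of the modulus at δₙ. One component suffices. -/
theorem IsSolution.le_modulusSup [IsProbabilityMeasure P] (hd : 0 < d) (hH : 1 / 2 ≤ H ∧ H < 1)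
    (hN : 0 < N) (hβ : 0 < β ∧ β < N) (hf : IsSpatialCovariance β f h) (hW : IsNoise P H f W)
    (hu : IsSolution P H h W u) {a : ℝ} (ha : 0 < a) {D : ℝ × E N} {Φ : E N → ℂ}
    (hΦ : IsProfile H β D Φ) (hD : |D.1| + ‖D.2‖ = 1) {I : Set (ℝ × E N)}
    (hI : ∀ p ∈ I, a ≤ p.1) {p : ℝ × E N} {l : ℝ} (hl : 0 < l) (hl1 : l ≤ 1)
    (hp : ∀ s : ℝ, 0 ≤ s → s ≤ l → p + s • D ∈ I) :
    ∃ c : ℝ, 0 < c ∧ ∀ v, IsContinuousVersion P u v → ∀ᵐ ω ∂P, ∀ ε : ℝ, 0 < ε →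
      ENNReal.ofReal c ≤
        modulusSup ((2 * H + 1 - N + β) / 2) I (fun t x => v t x ω) ε := by
  obtain ⟨c, hc, hPc⟩ := hu.measure_increments_le hH hN hβ hf hW ha hΦ
  set α := (2 * H + 1 - N + β) / 2 with hα
  have hlog2 : 0 < Real.log 2 := Real.log_pos (by norm_num)
  -- Chosen so that log(1 + 1/δₙ) ≤ nB for n ≥ 1, which converts √n into the logarithmic factor.
  set B := Real.log (1 + l⁻¹) + Real.log 2 with hB
  have hB0 : 0 < B := by
    have : 0 < Real.log (1 + l⁻¹) := Real.log_pos (by have := inv_pos.2 hl; linarith)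
    positivity
  set κ := √(Real.log 2 / 2) with hκ
  have hκ0 : 0 < κ := Real.sqrt_pos.2 (by positivity)
  set j : Fin d := ⟨0, hd⟩
  set δ : ℕ → ℝ := fun n => l / 2 ^ n with hδ
  have hδ0 : ∀ n, 0 < δ n := fun n => by positivity
  have h2n : ∀ n : ℕ, (1 : ℝ) ≤ 2 ^ n := fun n => one_le_pow₀ (by norm_num)
  have hδl : ∀ n, δ n ≤ l := fun n => div_le_self hl.le (h2n n)
  set A : ℕ → Set Ω := fun n => {ω | ∀ k < 2 ^ n,
    |StochWave.field u (j, p + ((k + 1 : ℕ) * δ n) • D) ω -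
        StochWave.field u (j, p + (k * δ n) • D) ω| ≤ κ * √n * (c * δ n ^ α)} with hA
  have hmem : ∀ n k : ℕ, k ≤ 2 ^ n → p + (k * δ n) • D ∈ I := by
    intro n k hk
    refine hp _ (by have := hδ0 n; positivity) ?_
    have h1 : (k : ℝ) ≤ 2 ^ n := by exact_mod_cast hk
    calc (k : ℝ) * δ n ≤ 2 ^ n * δ n := by have := (hδ0 n).le; gcongr
      _ = l := by rw [hδ]; field_simp
  have hPA : ∀ n, P (A n) ≤ (1 - ENNReal.ofReal (tailBound (κ * √n))) ^ 2 ^ n := fun n =>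
    hPc j p (2 ^ n) (δ n) (κ * √n) (hδ0 n) ((hδl n).trans hl1) (by positivity) fun k hk => by
      simpa using hI _ (hmem n k hk)
  have hPA0 : Tendsto (fun n => P (A n)) atTop (𝓝 0) :=
    tendsto_of_tendsto_of_tendsto_of_le_of_le tendsto_const_nhds tendsto_one_sub_tailBound_pow
      (fun _ => bot_le) hPA
  -- The intersection over n ≥ n₀ lies in each A n, whose probability tends to 0; neither
  -- independence between scales nor summability is required.
  have hfreq : ∀ᵐ ω ∂P, ∀ n₀ : ℕ, ∃ n, n₀ ≤ n ∧ ω ∉ A n := by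
    rw [ae_all_iff]
    intro n₀
    have h1 : P (⋂ n ∈ Ici n₀, A n) = 0 := by
      refine le_antisymm (ge_of_tendsto hPA0 ?_) bot_le
      filter_upwards [eventually_ge_atTop n₀] with n hn
      exact measure_mono (biInter_subset_of_mem hn)
    filter_upwards [measure_eq_zero_iff_ae_notMem.1 h1] with ω hω
    simpa using hω
  refine ⟨κ * c / √B, by positivity, fun v hv => ?_⟩
  have hvu : ∀ᵐ ω ∂P, ∀ n k : ℕ, k ≤ 2 ^ n →
      v (p + (k * δ n) • D).1 (p + (k * δ n) • D).2 ω j =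
        StochWave.field u (j, p + (k * δ n) • D) ω := by
    simp only [ae_all_iff]
    intro n k hk
    have h1 : 0 ≤ (p + (k * δ n) • D).1 := ha.le.trans (hI _ (hmem n k hk))
    filter_upwards [hv.1 _ (p + (k * δ n) • D).2 h1] with ω hω
    rw [hω, StochWave.field, max_eq_left h1]
  filter_upwards [hfreq, hvu] with ω hω hvω ε hε
  obtain ⟨n₁, hn₁⟩ := exists_nat_one_div_lt hε
  obtain ⟨n, hn, hnA⟩ := hω (n₁ + 1)
  simp only [hA, mem_ofPred_eq, not_forall, not_le] at hnA
  obtain ⟨k, hk, hlt⟩ := hnA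
  set y := p + ((k + 1 : ℕ) * δ n) • D with hy
  set y' := p + (k * δ n) • D with hy'
  have hrho : rho y y' = δ n := by
    have e : y - y' = δ n • D := by
      rw [hy, hy', add_sub_add_left_eq_sub, ← sub_smul]
      congr 1
      push_cast
      ring
    have e1 : y.1 - y'.1 = δ n * D.1 := congrArg Prod.fst e
    have e2 : y.2 - y'.2 = δ n • D.2 := congrArg Prod.snd e
    rw [rho, e1, e2, abs_mul, norm_smul, Real.norm_eq_abs, abs_of_pos (hδ0 n), ← mul_add, hD,
      mul_one]
  have hn1 : (1 : ℝ) ≤ n := by exact_mod_cast (show 1 ≤ n by omega)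
  have hnε : δ n ≤ ε := by
    refine le_trans ?_ hn₁.le
    have h3 : ((n₁ : ℝ) + 1) ≤ 2 ^ n := by
      have h4 : n < 2 ^ n := Nat.lt_two_pow_self
      have h5 : n₁ + 1 ≤ 2 ^ n := by omega
      exact_mod_cast h5
    rw [hδ]
    exact div_le_div₀ zero_le_one hl1 (by positivity) h3
  have hlogb : Real.log (1 + (δ n)⁻¹) ≤ n * B := by
    have h3 : 1 + (δ n)⁻¹ ≤ (1 + l⁻¹) * 2 ^ n := by
      rw [hδ]
      simp only [inv_div]
      have := h2n n
      rw [add_mul, one_mul, div_eq_inv_mul]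
      linarith
    have hd0 := hδ0 n
    refine (Real.log_le_log (by positivity) h3).trans ?_
    rw [Real.log_mul (by positivity) (by positivity), Real.log_pow, hB, mul_add]
    have : 0 ≤ Real.log (1 + l⁻¹) := Real.log_nonneg (by have := inv_pos.2 hl; linarith)
    nlinarith
  have hnorm : κ * √n * (c * δ n ^ α) ≤ ‖v y.1 y.2 ω - v y'.1 y'.2 ω‖ := by
    refine hlt.le.trans ?_
    rw [← hvω n (k + 1) hk, ← hvω n k hk.le]
    exact PiLp.norm_apply_le (v y.1 y.2 ω - v y'.1 y'.2 ω) j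
  have hmp : 0 < modulus α (δ n) := modulus_pos (hδ0 n)
  refine le_trans ?_ (le_iSup₂_of_le y (hmem n (k + 1) hk) (le_iSup₂_of_le y' (hmem n k hk.le)
    (le_iSup_of_le ⟨by rw [hrho]; exact hδ0 n, by rw [hrho]; exact hnε⟩ le_rfl)))
  refine ENNReal.ofReal_le_ofReal ?_
  rw [hrho]
  change _ ≤ _ / modulus α (δ n)
  rw [le_div_iff₀ hmp]
  refine le_trans ?_ hnorm
  have hsB : √(Real.log (1 + (δ n)⁻¹)) ≤ √n * √B := by
    rw [← Real.sqrt_mul (by positivity)]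
    exact Real.sqrt_le_sqrt hlogb
  have hd0 := hδ0 n
  calc κ * c / √B * modulus α (δ n) ≤ κ * c / √B * (δ n ^ α * (√n * √B)) := by
        unfold modulus; gcongr
    _ = κ * √n * (c * δ n ^ α) := by
        have : √B ≠ 0 := (Real.sqrt_pos.2 hB0).ne'
        field_simp

end Final

/-! ### Assembly on a nontrivial interval -/

variable {N d : ℕ} {H β : ℝ} {f h : E N → ℝ} {Ω : Type*} [MeasurableSpace Ω] {P : Measure Ω}
  {W : Fin d → Test N → Ω → ℝ} {u : ℝ → E N → Ω → E d}

/-- A nontrivial interval contains a segment parallel to one of the coordinate axes. -/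
lemma exists_segment_mem_interval {a b : ℝ} {c e : Fin N → ℝ}
    (hI : (interval a b c e).Nontrivial) (hH : 1 / 2 ≤ H ∧ H < 1) (hN : 0 < N)
    (hβ : 0 < β ∧ β < N) (hβH : (N : ℝ) - 2 * H - 1 < β) :
    ∃ (D : ℝ × E N) (Φ : E N → ℂ) (p : ℝ × E N) (l : ℝ), IsProfile H β D Φ ∧
      |D.1| + ‖D.2‖ = 1 ∧ 0 < l ∧ l ≤ 1 ∧
      ∀ s : ℝ, 0 ≤ s → s ≤ l → p + s • D ∈ interval a b c e := by
  obtain ⟨p, hp, q, hq, hpq⟩ := hI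
  have hab : a ≤ b := hp.1.1.trans hp.1.2
  have hce : ∀ i, c i ≤ e i := fun i => (hp.2 i).1.trans (hp.2 i).2
  rcases hab.lt_or_eq with hlt | heq
  · obtain ⟨Φ, hΦ⟩ := exists_time_profile (N := N) hH hβ hβH hN
    refine ⟨_, Φ, (a, p.2), min 1 (b - a), hΦ, by simp, lt_min one_pos (by linarith),
      min_le_left _ _, fun s h0 hs => ?_⟩
    have := hs.trans (min_le_right _ _)
    refine ⟨⟨?_, ?_⟩, ?_⟩
    · simp; linarith
    · simp; linarith
    · simpa using hp.2
  · have : ∃ i, c i < e i := by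
      by_contra! hc
      refine hpq (Prod.ext ?_ ?_)
      · have := hp.1.1; have := hp.1.2; have := hq.1.1; have := hq.1.2; linarith
      · ext i
        have := (hp.2 i).1; have := (hp.2 i).2; have := (hq.2 i).1; have := (hq.2 i).2
        have := hc i
        linarith
    obtain ⟨i, hi⟩ := this
    obtain ⟨Φ, hΦ⟩ := exists_space_profile (N := N) hH hβ hN i
    refine ⟨_, Φ, (p.1, WithLp.toLp 2 c), min 1 (e i - c i), hΦ, by simp,
      lt_min one_pos (by linarith), min_le_left _ _, fun s h0 hs => ?_⟩
    have := hs.trans (min_le_right _ _)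
    refine ⟨by simpa using hp.1, fun j => ?_⟩
    rcases eq_or_ne j i with rfl | hj
    · simp; constructor <;> linarith
    · simp [hj, hce j]

/-- The supremum of the normalized increments of a continuous version converges, as the scale
tends to zero, to a deterministic limit in `[0, ∞]`. -/
theorem IsSolution.exists_tendsto_modulusSup [IsProbabilityMeasure P] (hH : 1 / 2 ≤ H ∧ H < 1)
    (hN : 0 < N) (hβ : 0 < β ∧ β < N)
    (hβH : (N : ℝ) - 2 * H - 1 < β ∧ β < (N : ℝ) - 2 * H + 1)
    (hf : IsSpatialCovariance β f h) (hW : IsNoise P H f W) (hu : IsSolution P H h W u)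
    {a b : ℝ} {c e : Fin N → ℝ} (ha : 0 < a) (hI : (interval a b c e).Nonempty) :
    ∃ C : ℝ≥0∞, ∀ v, IsContinuousVersion P u v → ∀ᵐ ω ∂P,
      Tendsto (modulusSup ((2 * H + 1 - N + β) / 2) (interval a b c e) fun t x => v t x ω)
        (𝓝[>] 0) (𝓝 C) := by
  have hb : 0 < b := by
    obtain ⟨p, hp⟩ := hI
    linarith [hp.1.1, hp.1.2]
  have : Nonempty (interval a b c e) := hI.to_subtype
  set z := TopologicalSpace.denseSeq (interval a b c e)
  obtain ⟨C, hC⟩ := hu.exists_seqLim_eq_const hH hN hβ hβH hf hW hb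
    (z := fun n => (z n : ℝ × E N)) fun n => (z n).2.1.2
  refine ⟨C, fun v hv => ?_⟩
  have hz0 : ∀ n, 0 < (z n).1.1 := fun n => ha.trans_le (z n).2.1.1
  have hvu : ∀ᵐ ω ∂P, ∀ n, v (z n).1.1 (z n).1.2 ω = u (z n).1.1 (z n).1.2 ω :=
    ae_all_iff.2 fun n => hv.1 _ _ (hz0 n).le
  filter_upwards [hC, hvu, hv.2] with ω hCω hvω hcont
  have hsub : interval a b c e ⊆ Ioi 0 ×ˢ univ := fun p hp => ⟨ha.trans_le hp.1.1, mem_univ _⟩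
  have key := tendsto_modulusSup (α := (2 * H + 1 - N + β) / 2) (w := fun t x => v t x ω)
    (hcont.mono hsub) (z := z) (TopologicalSpace.denseRange_denseSeq _)
  have heq : (fun i : Fin d × ℕ => v (z i.2).1.1 (z i.2).1.2 ω i.1) =
      fun i : Fin d × ℕ => StochWave.field u (i.1, (z i.2 : ℝ × E N)) ω := by
    ext i
    simp only [StochWave.field, hvω, max_eq_left (hz0 i.2).le]
  rw [heq, hCω] at key
  exact key

/-- A continuous version on an interval obeys a deterministic uniform modulus bound. -/
theorem IsSolution.exists_modulusSup_le [IsProbabilityMeasure P] (hH : 1 / 2 ≤ H ∧ H < 1)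
    (hN : 0 < N) (hβ : 0 < β ∧ β < N)
    (hβH : (N : ℝ) - 2 * H - 1 < β ∧ β < (N : ℝ) - 2 * H + 1)
    (hf : IsSpatialCovariance β f h) (hW : IsNoise P H f W) (hu : IsSolution P H h W u)
    (a b : ℝ) (c e : Fin N → ℝ) :
    ∃ v, IsContinuousVersion P u v ∧ ∃ K : ℝ, ∀ᵐ ω ∂P, ∃ ε : ℝ, 0 < ε ∧
      modulusSup ((2 * H + 1 - N + β) / 2) (interval a b c e) (fun t x => v t x ω) ε ≤
        ENNReal.ofReal K := by
  obtain ⟨v, hv, hM⟩ := hu.exists_continuousVersion hH hN hβ hβH hf hW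
  obtain ⟨M, hMle⟩ : ∃ M : ℕ, |a| + |b| + ∑ i, (|c i| + |e i|) ≤ M := exists_nat_ge _
  have hsub : interval a b c e ⊆ cube N M := by
    intro p hp
    have hs : 0 ≤ ∑ i, (|c i| + |e i|) := by positivity
    refine ⟨?_, fun i => ?_⟩
    · have h1 := abs_le_max_abs_abs hp.1.1 hp.1.2
      have h2 : max |a| |b| ≤ |a| + |b| := max_le_add_of_nonneg (abs_nonneg _) (abs_nonneg _)
      linarith
    · have h1 := abs_le_max_abs_abs (hp.2 i).1 (hp.2 i).2
      have h2 : max |c i| |e i| ≤ |c i| + |e i| :=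
        max_le_add_of_nonneg (abs_nonneg _) (abs_nonneg _)
      have h3 : |c i| + |e i| ≤ ∑ i, (|c i| + |e i|) :=
        Finset.single_le_sum (f := fun i => |c i| + |e i|) (fun j _ => by positivity)
          (Finset.mem_univ i)
      linarith [abs_nonneg a, abs_nonneg b]
  obtain ⟨K, -, hK⟩ := hM M
  refine ⟨v, hv, K, ?_⟩
  filter_upwards [hK] with ω ⟨n₀, hn⟩
  refine ⟨1 / 2 ^ n₀, by positivity, ?_⟩
  refine iSup₂_le fun p hp => iSup₂_le fun q hq => iSup_le fun hr =>
    ENNReal.ofReal_le_ofReal ?_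
  have hpos : 0 < rho p q ^ ((2 * H + 1 - N + β) / 2) * √(Real.log (1 + (rho p q)⁻¹)) :=
    modulus_pos hr.1
  exact (div_le_iff₀ hpos).2 (hn p (hsub hp) q (hsub hq) hr.1 hr.2)

/-- The exact uniform modulus of continuity on a nontrivial interval. -/
theorem IsSolution.exists_tendsto_modulusSup_pos [IsProbabilityMeasure P] (hd : 0 < d)
    (hH : 1 / 2 ≤ H ∧ H < 1) (hN : 0 < N) (hβ : 0 < β ∧ β < N)
    (hβH : (N : ℝ) - 2 * H - 1 < β ∧ β < (N : ℝ) - 2 * H + 1)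
    (hf : IsSpatialCovariance β f h) (hW : IsNoise P H f W) (hu : IsSolution P H h W u)
    {a b : ℝ} {c e : Fin N → ℝ} (ha : 0 < a) (hI : (interval a b c e).Nontrivial) :
    ∃ C : ℝ, 0 < C ∧ ∀ v, IsContinuousVersion P u v → ∀ᵐ ω ∂P,
      Tendsto (modulusSup ((2 * H + 1 - N + β) / 2) (interval a b c e) fun t x => v t x ω)
        (𝓝[>] 0) (𝓝 (ENNReal.ofReal C)) := by
  obtain ⟨C, hC⟩ := hu.exists_tendsto_modulusSup hH hN hβ hβH hf hW ha hI.nonempty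
  obtain ⟨v, hv, K, hK⟩ := hu.exists_modulusSup_le hH hN hβ hβH hf hW a b c e
  obtain ⟨D, Φ, p, l, hΦ, hD, hl, hl1, hp⟩ := exists_segment_mem_interval hI hH hN hβ hβH.1
  obtain ⟨c', hc', hlow⟩ := hu.le_modulusSup hd hH hN hβ hf hW ha hΦ hD
    (fun p hp => hp.1.1) hl hl1 hp
  -- The limit is deterministic, so a single ω at which the convergence and both bounds hold shows
  -- that it is positive and finite.
  obtain ⟨ω, ⟨hCω, ε, hε, hKω⟩, hlω⟩ := (((hC v hv).and hK).and (hlow v hv)).exists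
  have hle : C ≤ ENNReal.ofReal K := by
    refine le_of_tendsto hCω ?_
    filter_upwards [Ioc_mem_nhdsGT hε] with δ hδ
    exact (modulusSup_mono _ _ _ hδ.2).trans hKω
  have hge : ENNReal.ofReal c' ≤ C :=
    ge_of_tendsto hCω (by filter_upwards [self_mem_nhdsWithin] with δ hδ using hlω δ hδ)
  have htop : C ≠ ∞ := (hle.trans_lt ENNReal.ofReal_lt_top).ne
  refine ⟨C.toReal, ENNReal.toReal_pos (fun h0 => ?_) htop, ?_⟩
  · rw [h0, nonpos_iff_eq_zero, ENNReal.ofReal_eq_zero] at hge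
    exact hge.not_gt hc'
  · rwa [ENNReal.ofReal_toReal htop]

end StochWave

end

theorem theorem3p7 {N d : ℕ} (hd : 0 < d) (H β : ℝ)
    (hH : 1 / 2 ≤ H ∧ H < 1) (hβ : 0 < β ∧ β < N)
    (hβH : (N : ℝ) - 2 * H - 1 < β ∧ β < (N : ℝ) - 2 * H + 1)
    (f h : StochWave.E N → ℝ) (hf : StochWave.IsSpatialCovariance β f h)
    {Ω : Type*} [MeasurableSpace Ω] (P : MeasureTheory.Measure Ω)
    [MeasureTheory.IsProbabilityMeasure P]
    (W : Fin d → StochWave.Test N → Ω → ℝ) (hW : StochWave.IsNoise P H f W)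
    (u : ℝ → StochWave.E N → Ω → StochWave.E d) (hu : StochWave.IsSolution P H h W u) :
    (∃ v, StochWave.IsContinuousVersion P u v) ∧
    ∀ (a b : ℝ) (c e : Fin N → ℝ), 0 < a → (StochWave.interval a b c e).Nontrivial →
      ∃ C : ℝ, 0 < C ∧ ∀ v, StochWave.IsContinuousVersion P u v →
        ∀ᵐ ω ∂P, Filter.Tendsto
          (StochWave.modulusSup ((2 * H + 1 - N + β) / 2) (StochWave.interval a b c e)
            (fun t x => v t x ω))
          (nhdsWithin 0 (Set.Ioi 0)) (nhds (ENNReal.ofReal C)) := by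
  have hN : 0 < N := by exact_mod_cast hβ.1.trans hβ.2
  obtain ⟨v, hv, -⟩ := hu.exists_continuousVersion hH hN hβ hβH hf hW
  exact ⟨⟨v, hv⟩, fun a b c e ha hI =>
    hu.exists_tendsto_modulusSup_pos hd hH hN hβ hβH hf hW ha hI⟩
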